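/- Let $d\ge 2$ and let $\theta=(\theta_{kj})$ be a real skew-symmetric $d\times d$ matrix. Let $\mathcal A_\theta$ be the universal C*-algebra generated by $d$ unitaries $U_1,\dots,U_d$ subject to $U_kU_j=e^{2\pi i\theta_{kj}}U_jU_k$ for all $k,j$. For $m\in\mathbb Z^d$ put $U^m=U_1^{m_1}\cdots U_d^{m_d}$, and let $\tau$ be the canonical tracial state of $\mathcal A_\theta$, determined by $\tau(U^0)=1$ and $\tau(U^m)=0$ for $m\ne0$. Let $\mathbb T^d_\theta$ be the von Neumann algebra generated by $\mathcal A_\theta$ in the GNS representation of $\tau$, with the extension of $\tau$ to it as the vector state of the cyclic vector. For $1\le p<\infty$ let $L_p(\mathbb T^d_\theta)$ be the completion of $\mathbb T^d_\theta$ for the norm $\|x\|_p=\tau(|x|^p)^{1/p}$, $|x|=(x^*x)^{1/2}$. For $x\in L_p(\mathbb T^d_\theta)$ or $x\in\mathcal A_\theta$ let $\hat x(m)=\tau((U^m)^*x)$, $m\in\mathbb Z^d$, be its Fourier coefficients (on $L_p(\mathbb T^d_\theta)$ the functional $x\mapsto\tau((U^m)^*x)$ is extended by continuity). With $|m|_\infty=\max_j|m_j|$,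 $|m|_1=\sum_j|m_j|$ and $|m|_2=(\sum_j|m_j|^2)^{1/2}$, define $$F_N[x]=\sum_{|m|_\infty\le N}\Big(1-\frac{|m_1|}{N+1}\Big)\cdots\Big(1-\frac{|m_d|}{N+1}\Big)\hat x(m)U^m\quad(N\in\mathbb N,\ N\ge0),$$ $$P_r[x]=\sum_{m\in\mathbb Z^d}\hat x(m)r^{|m|_1}U^m,\qquad \mathbb P_r[x]=\sum_{m\in\mathbb Z^d}\hat x(m)r^{|m|_2}U^m\quad(0\le r<1),$$ $$\Phi^\varepsilon[x]=\sum_{m\in\mathbb Z^d}\Phi(\varepsilon m)\hat x(m)U^m\quad(\varepsilon>0).$$ Here $\Phi:\mathbb R^d\to\mathbb C$ is any continuous function with $\Phi(0)=1$ for which there are a function $\varphi:\mathbb R^d\to\mathbb C$ and constants $A,\delta>0$ with $\int_{\mathbb R^d}\varphi(s)\,ds=1$, $\Phi(s)=\hat\varphi(s)=\int_{\mathbb R^d}\varphi(t)e^{-2\pi i\langle t,s\rangle}\,dt$ and $|\Phi(s)|+|\varphi(s)|\le A(1+|s|)^{-d-\delta}$ for all $s\in\mathbb R^d$, where $|s|$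 is the Euclidean norm. (i) Let $1\le p<\infty$ and $x\in L_p(\mathbb T^d_\theta)$. Then the series defining $P_r[x]$, $\mathbb P_r[x]$ ($0\le r<1$) and $\Phi^\varepsilon[x]$ ($\varepsilon>0$) converge unconditionally in $L_p(\mathbb T^d_\theta)$, and, in the norm of $L_p(\mathbb T^d_\theta)$, $F_N[x]\to x$ as $N\to\infty$, $P_r[x]\to x$ and $\mathbb P_r[x]\to x$ as $r\to1^-$, and $\Phi^\varepsilon[x]\to x$ as $\varepsilon\to0^+$. (ii) (The case $p=\infty$.) Let $x\in\mathcal A_\theta$. Then the same series converge unconditionally in the norm of $\mathcal A_\theta$, and all the limits in (i) hold in the norm of $\mathcal A_\theta$. -/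

import Mathlib

set_option linter.unusedSectionVars false

noncomputable section

namespace QuantumTorus

open scoped ComplexOrder InnerProductSpace ENNReal unitInterval
open Filter Topology

/-- A tracial state on a unital C*-algebra: a positive linear functional `τ` with `τ 1 = 1` and
`τ (x y) = τ (y x)`. -/
structure TracialState (M : Type*) [CStarAlgebra M] [PartialOrder M] [StarOrderedRing M] where
  toPos : M →ₚ[ℂ] ℂ
  map_one : toPos 1 = 1
  tracial : ∀ x y, toPos (x * y) = toPos (y * x)

section TracialState

variable {M : Type*} [CStarAlgebra M] [PartialOrder M] [StarOrderedRing M] (τ : TracialState M)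

/-- `‖x‖_p = (τ (|x| ^ p)) ^ (1 / p)`, with `|x| = (x* x) ^ (1/2)` and the power `|x| ^ p` taken in
the continuous functional calculus. -/
def pNorm (p : ℝ) (x : M) : ℝ := (τ.toPos (CFC.abs x ^ p)).re ^ (1 / p)

/-- The real part of the trace, as a real linear functional. -/
def reTr : M →ₗ[ℝ] ℝ := Complex.reLm ∘ₗ τ.toPos.toLinearMap.restrictScalars ℝ

theorem tr_apply (x : M) : reTr τ x = (τ.toPos x).re := rfl

theorem tr_comm (x y : M) : reTr τ (x * y) = reTr τ (y * x) := by
  rw [tr_apply, tr_apply, τ.tracial]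

theorem tr_nonneg {x : M} (hx : 0 ≤ x) : 0 ≤ reTr τ x :=
  (Complex.nonneg_iff.mp (τ.toPos.map_nonneg hx)).1

theorem tr_mono {x y : M} (h : x ≤ y) : reTr τ x ≤ reTr τ y := by
  have := tr_nonneg τ (sub_nonneg.mpr h)
  rw [map_sub] at this; linarith

theorem tr_one : reTr τ (1 : M) = 1 := by rw [tr_apply, τ.map_one]; rfl

theorem cauchySchwarz (x y : M) :
    ‖τ.toPos (star x * y)‖ ≤ √(reTr τ (star x * x)) * √(reTr τ (star y * y)) :=
  norm_inner_le_norm (𝕜 := ℂ) (τ.toPos.toPreGNS x) (τ.toPos.toPreGNS y)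

theorem star_mul_self_le {w : M} (hw : ‖w‖ ≤ 1) : star w * w ≤ 1 := by
  refine (CStarAlgebra.star_mul_le_algebraMap_norm_sq (a := w)).trans ?_
  rw [← map_one (algebraMap ℝ M)]
  exact algebraMap_mono M (by nlinarith [norm_nonneg w])

theorem mul_star_self_le {w : M} (hw : ‖w‖ ≤ 1) : w * star w ≤ 1 := by
  simpa using star_mul_self_le (w := star w) (by simpa using hw)

theorem norm_toPos_le (x : M) : ‖τ.toPos x‖ ≤ ‖x‖ := by
  have h := cauchySchwarz τ 1 x
  have h1 : reTr τ (star x * x) ≤ ‖x‖ ^ 2 := by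
    refine (tr_mono τ (CStarAlgebra.star_mul_le_algebraMap_norm_sq (a := x))).trans ?_
    rw [Algebra.algebraMap_eq_smul_one, map_smul, tr_one]; simp
  simp only [star_one, one_mul, tr_one, Real.sqrt_one] at h
  exact h.trans ((Real.sqrt_le_sqrt h1).trans (by rw [Real.sqrt_sq (norm_nonneg _)]))

theorem abs_tr_le (x : M) : |reTr τ x| ≤ ‖x‖ :=
  (Complex.abs_re_le_norm _).trans (norm_toPos_le τ x)

theorem continuous_tr : Continuous (reTr τ) :=
  ((reTr τ).mkContinuous 1 (by simpa using abs_tr_le τ)).continuous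

theorem tr_conj_nonneg {c d : M} (hc : 0 ≤ c) (hd : 0 ≤ d) (w : M) :
    0 ≤ reTr τ (star w * c * w * d) := by
  have h : reTr τ (star w * c * w * d) = reTr τ (star (w * CFC.sqrt d) * c * (w * CFC.sqrt d)) := by
    conv_lhs => rw [← CFC.sqrt_mul_sqrt_self d, ← mul_assoc, tr_comm]
    rw [star_mul, (CFC.sqrt_nonneg d).isSelfAdjoint.star_eq]
    simp only [mul_assoc]
  rw [h]
  exact tr_nonneg τ (star_left_conjugate_nonneg hc _)

theorem tr_mul_le {c d : M} (hc : 0 ≤ c) (hd : d ≤ 1) : reTr τ (d * c) ≤ reTr τ c := by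
  have h := tr_conj_nonneg τ (sub_nonneg.mpr hd) hc 1
  simp only [star_one, one_mul, mul_one, sub_mul, map_sub] at h
  linarith

/-- The functional calculus of a positive contraction, on continuous functions on `[0, 1]`. -/
def unitCalc (b : M) : C(I, ℝ) →L[ℝ] M :=
  LinearMap.mkContinuous
    { toFun := fun F => cfc (Set.IccExtend zero_le_one F : ℝ → ℝ) b
      map_add' := fun F G => by
        rw [← cfc_add (a := b) _ _ (F.continuous.Icc_extend' (h := zero_le_one)).continuousOn
          (G.continuous.Icc_extend' (h := zero_le_one)).continuousOn]
        rfl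
      map_smul' := fun r F => by
        rw [RingHom.id_apply, ← cfc_smul (a := b) r _
          (F.continuous.Icc_extend' (h := zero_le_one)).continuousOn]
        rfl } 1 (fun F => by
      rw [one_mul]
      exact norm_cfc_le (norm_nonneg _) fun x _ => F.norm_coe_le_norm _)

theorem unitCalc_apply (b : M) (F : C(I, ℝ)) :
    unitCalc b F = cfc (Set.IccExtend zero_le_one F : ℝ → ℝ) b := rfl

theorem unitCalc_nonneg (b : M) {F : C(I, ℝ)} (hF : 0 ≤ F) : 0 ≤ unitCalc b F :=
  cfc_nonneg fun _ _ => hF _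

theorem unitCalc_eq {b : M} (hb : 0 ≤ b) (hb1 : ‖b‖ ≤ 1) (f : ℝ → ℝ) (F : C(I, ℝ))
    (h : ∀ t : I, F t = f t) : unitCalc b F = cfc f b := by
  rw [unitCalc_apply]
  refine cfc_congr fun x hx => ?_
  have h0 : 0 ≤ x := spectrum_nonneg_of_nonneg hb hx
  have h1 : x ≤ 1 := by
    have := (spectrum.norm_le_norm_mul_of_mem hx)
    have h2 : ‖(1 : M)‖ ≤ 1 := by
      rcases subsingleton_or_nontrivial M with _ | _
      · rw [Subsingleton.elim (1 : M) 0]; simp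
      · simp
    have h3 : x ≤ ‖x‖ := le_abs_self x
    nlinarith [norm_nonneg b]
  rw [Set.IccExtend_of_mem _ _ ⟨h0, h1⟩, h]

/-- Young's inequality under the trace. -/
theorem trace_young {p q : ℝ} (hpq : p.HolderConjugate q) {a b w : M} (ha : 0 ≤ a) (hb : 0 ≤ b)
    (hb1 : ‖b‖ ≤ 1) (hw : ‖w‖ ≤ 1) {l r : ℝ} (hl : 0 ≤ l) (hr : 0 ≤ r) :
    l * r * reTr τ (star w * b * w * a) ≤
      l ^ p / p * reTr τ (a ^ p) + r ^ q / q * reTr τ (b ^ q) := by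
  have hp0 := hpq.pos
  have hq0 := hpq.symm.pos
  let F1 : C(I, ℝ) := ⟨fun t => (t : ℝ), by fun_prop⟩
  let F2 : C(I, ℝ) := ⟨fun t => (t : ℝ) ^ q, by
    exact (Real.continuous_rpow_const hq0.le).comp continuous_subtype_val⟩
  let G : C(I, ℝ) → M → ℝ := fun F d => reTr τ (star w * unitCalc b F * w * d)
  have hG : ∀ d, Continuous fun F => G F d := fun d =>
    (continuous_tr τ).comp (by fun_prop)
  have hGsum : ∀ (n : ℕ) (c : Fin (n + 1) → ℝ) (β : Fin (n + 1) → C(I, ℝ)) (d : M),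
      G (∑ k, c k • β k) d = ∑ k, c k * G (β k) d := by
    intro n c β d
    simp only [G, map_sum, Finset.mul_sum, Finset.sum_mul, map_smul, mul_smul_comm,
      smul_mul_assoc, smul_eq_mul]
  have hB : ∀ (n : ℕ) (F : C(I, ℝ)),
      bernsteinApproximation n F = ∑ k : Fin (n + 1), F (bernstein.z k) • bernstein n k := by
    intro n F
    ext x
    simp [bernsteinApproximation.apply, mul_comm]
  have key : ∀ n : ℕ, l * r * G (bernsteinApproximation n F1) a ≤
      l ^ p / p * reTr τ (star w * w * a ^ p) + r ^ q / q * G (bernsteinApproximation n F2) 1 := by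
    intro n
    have hone : ∑ k : Fin (n + 1), (1 : ℝ) • bernstein n k = 1 := by
      ext x; simp [bernstein.probability n x]
    have e1 : reTr τ (star w * w * a ^ p) = G (∑ k : Fin (n + 1), (1 : ℝ) • bernstein n k) (a ^ p) := by
      rw [hone]
      have : unitCalc b 1 = 1 := by
        rw [unitCalc_apply]
        exact cfc_const_one ℝ b
      simp only [G, this, mul_one]
    rw [e1, hB, hB, hGsum, hGsum, hGsum, Finset.mul_sum, Finset.mul_sum, Finset.mul_sum,
      ← Finset.sum_add_distrib]
    refine Finset.sum_le_sum fun k _ => ?_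
    set t : ℝ := F1 (bernstein.z k) with ht
    have ht0 : 0 ≤ t := (bernstein.z k).2.1
    have hF2 : F2 (bernstein.z k) = t ^ q := rfl
    rw [hF2]
    have hle : (l * r * t) • a ≤ (l ^ p / p) • a ^ p + (r ^ q / q * t ^ q) • (1 : M) := by
      have hsa : IsSelfAdjoint a := ha.isSelfAdjoint
      have hcont : Continuous fun s : ℝ => s ^ p := Real.continuous_rpow_const hp0.le
      have E1 : (l * r * t) • a = cfc (fun s : ℝ => (l * r * t) * s) a := by
        rw [cfc_const_mul_id (R := ℝ) (l * r * t) a]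
      have E2 : (l ^ p / p) • a ^ p + (r ^ q / q * t ^ q) • (1 : M)
          = cfc (fun s : ℝ => (l ^ p / p) * s ^ p + (r ^ q / q * t ^ q)) a := by
        rw [cfc_add_const (R := ℝ) _ _ a (by fun_prop), cfc_const_mul (R := ℝ) _ _ a
          hcont.continuousOn, CFC.rpow_eq_cfc_real, Algebra.algebraMap_eq_smul_one]
      rw [E1, E2]
      refine cfc_mono (fun s hs => ?_) (by fun_prop) (by fun_prop)
      have hs0 : 0 ≤ s := spectrum_nonneg_of_nonneg ha hs
      have := Real.young_inequality_of_nonneg (mul_nonneg hl hs0) (mul_nonneg hr ht0) hpq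
      rw [Real.mul_rpow hl hs0, Real.mul_rpow hr ht0] at this
      calc l * r * t * s = l * s * (r * t) := by ring
        _ ≤ _ := this
        _ = _ := by ring
    have hβ : (0 : C(I, ℝ)) ≤ bernstein n k := fun x => bernstein_nonneg
    have := tr_conj_nonneg τ (unitCalc_nonneg b hβ) (sub_nonneg.mpr hle) w
    simp only [mul_sub, mul_add, mul_smul_comm, map_sub, map_add, map_smul, smul_eq_mul] at this
    simp only [G]
    nlinarith [this]
  have hlim := le_of_tendsto_of_tendsto'
    ((((hG a).tendsto F1).comp (bernsteinApproximation_uniform F1)).const_mul (l * r))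
    ((((hG 1).tendsto F2).comp (bernsteinApproximation_uniform F2)).const_mul (r ^ q / q)
      |>.const_add (l ^ p / p * reTr τ (star w * w * a ^ p))) key
  have c1 : unitCalc b F1 = b := by
    rw [unitCalc_eq hb hb1 id F1 fun _ => rfl, cfc_id ℝ b]
  have c2 : unitCalc b F2 = b ^ q := by
    rw [unitCalc_eq hb hb1 (fun t => t ^ q) F2 fun _ => rfl, CFC.rpow_eq_cfc_real]
  simp only [G, c1, c2, mul_one] at hlim
  refine hlim.trans (add_le_add ?_ ?_)
  · exact mul_le_mul_of_nonneg_left (tr_mul_le τ CFC.rpow_nonneg (star_mul_self_le hw))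
      (by positivity)
  · refine mul_le_mul_of_nonneg_left ?_ (by positivity)
    rw [mul_assoc, tr_comm, mul_assoc, tr_comm]
    exact tr_mul_le τ CFC.rpow_nonneg (mul_star_self_le hw)

theorem smul_rpow {a : M} (ha : 0 ≤ a) {r p : ℝ} (hr : 0 ≤ r) (hp : 0 < p) :
    (r • a) ^ p = r ^ p • a ^ p := by
  have hsa : IsSelfAdjoint a := ha.isSelfAdjoint
  have hcont : Continuous fun s : ℝ => s ^ p := Real.continuous_rpow_const hp.le
  rw [CFC.rpow_eq_cfc_real (smul_nonneg hr ha), CFC.rpow_eq_cfc_real ha,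
    ← cfc_comp_const_mul (R := ℝ) r _ a (hcont.continuousOn), ← cfc_const_mul (R := ℝ) _ _ a
      hcont.continuousOn]
  refine cfc_congr fun s hs => ?_
  exact Real.mul_rpow hr (spectrum_nonneg_of_nonneg ha hs)

theorem tr_conj_le {p q : ℝ} (hpq : p.HolderConjugate q) {a b w : M} (ha : 0 ≤ a) (hb : 0 ≤ b)
    (hw : ‖w‖ ≤ 1) :
    reTr τ (star w * b * w * a) ≤ reTr τ (a ^ p) ^ (1 / p) * reTr τ (b ^ q) ^ (1 / q) := by
  have hp0 := hpq.pos
  have hq0 := hpq.symm.pos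
  -- first under the normalisation of `b`
  have main : ∀ b : M, 0 ≤ b → ‖b‖ ≤ 1 →
      reTr τ (star w * b * w * a) ≤ reTr τ (a ^ p) ^ (1 / p) * reTr τ (b ^ q) ^ (1 / q) := by
    intro b hb hb1
    set P := reTr τ (a ^ p) with hP
    set Q := reTr τ (b ^ q) with hQ
    have hP0 : 0 ≤ P := tr_nonneg τ CFC.rpow_nonneg
    have hQ0 : 0 ≤ Q := tr_nonneg τ CFC.rpow_nonneg
    have hε : ∀ ε : ℝ, 0 < ε →
        reTr τ (star w * b * w * a) ≤ (P + ε) ^ (1 / p) * (Q + ε) ^ (1 / q) := by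
      intro ε he
      have hPe : 0 < P + ε := by linarith
      have hQe : 0 < Q + ε := by linarith
      have hy := trace_young τ hpq ha hb hb1 hw (l := (P + ε) ^ (-(1 / p))) (r := (Q + ε) ^ (-(1 / q)))
        (by positivity) (by positivity)
      rw [← Real.rpow_mul hPe.le, ← Real.rpow_mul hQe.le, ← hP, ← hQ] at hy
      have e1 : -(1 / p) * p = -1 := by field_simp
      have e2 : -(1 / q) * q = -1 := by field_simp
      rw [e1, e2, Real.rpow_neg_one, Real.rpow_neg_one, Real.rpow_neg hPe.le,
        Real.rpow_neg hQe.le] at hy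
      have b1 : (P + ε)⁻¹ / p * P ≤ 1 / p := by
        rw [div_mul_eq_mul_div]
        gcongr
        rw [inv_mul_le_iff₀ hPe]; linarith
      have b2 : (Q + ε)⁻¹ / q * Q ≤ 1 / q := by
        rw [div_mul_eq_mul_div]
        gcongr
        rw [inv_mul_le_iff₀ hQe]; linarith
      have b3 : 1 / p + 1 / q = 1 := by
        have := hpq.inv_add_inv_eq_one
        simpa using this
      have hA : 0 < (P + ε) ^ (1 / p) := by positivity
      have hB : 0 < (Q + ε) ^ (1 / q) := by positivity
      have hy2 : ((P + ε) ^ (1 / p))⁻¹ * ((Q + ε) ^ (1 / q))⁻¹ * reTr τ (star w * b * w * a) ≤ 1 := by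
        linarith
      rw [← mul_inv, inv_mul_le_iff₀ (by positivity)] at hy2
      linarith
    have hlim : Tendsto (fun ε : ℝ => (P + ε) ^ (1 / p) * (Q + ε) ^ (1 / q)) (𝓝[>] 0)
        (𝓝 ((P + 0) ^ (1 / p) * (Q + 0) ^ (1 / q))) := by
      refine Tendsto.mono_left ?_ nhdsWithin_le_nhds
      refine Continuous.tendsto ?_ 0
      exact ((Real.continuous_rpow_const (by positivity)).comp (by fun_prop)).mul
        ((Real.continuous_rpow_const (by positivity)).comp (by fun_prop))
    rw [add_zero, add_zero] at hlim
    exact ge_of_tendsto hlim (eventually_mem_nhdsWithin.mono fun ε he => hε ε he)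
  set r := ‖b‖ + 1 with hr
  have hr0 : 0 < r := by positivity
  have hb' : b = r • (r⁻¹ • b) := by rw [smul_smul, mul_inv_cancel₀ hr0.ne', one_smul]
  have hn : ‖r⁻¹ • b‖ ≤ 1 := by
    rw [norm_smul, Real.norm_of_nonneg (by positivity), inv_mul_le_iff₀ hr0]; linarith
  have hm := main (r⁻¹ • b) (smul_nonneg (by positivity) hb) hn
  rw [hb', smul_rpow (smul_nonneg (by positivity) hb) hr0.le hq0]
  simp only [mul_smul_comm, smul_mul_assoc, map_smul, smul_eq_mul] at hm ⊢
  rw [Real.mul_rpow (by positivity) (tr_nonneg τ CFC.rpow_nonneg), ← Real.rpow_mul hr0.le,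
    mul_one_div_cancel hq0.ne', Real.rpow_one]
  calc _ = r * (r⁻¹ * (reTr τ (star w * b * w * a)) * r) / r := by field_simp
    _ ≤ r * (reTr τ (a ^ p) ^ (1 / p) * reTr τ ((r⁻¹ • b) ^ q) ^ (1 / q) * r) / r := by
      gcongr
    _ = _ := by field_simp

theorem norm_toPos_mul_le {p q : ℝ} (hpq : p.HolderConjugate q) {a b w : M} (ha : 0 ≤ a)
    (hb : 0 ≤ b) (hw : ‖w‖ ≤ 1) :
    ‖τ.toPos (b * w * a)‖ ≤ reTr τ (a ^ p) ^ (1 / p) * reTr τ (b ^ q) ^ (1 / q) := by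
  have sa := (CFC.sqrt_nonneg a).isSelfAdjoint.star_eq
  have sb := (CFC.sqrt_nonneg b).isSelfAdjoint.star_eq
  have ma := CFC.sqrt_mul_sqrt_self a
  have mb := CFC.sqrt_mul_sqrt_self b
  set α := CFC.sqrt a
  set β := CFC.sqrt b
  have h := cauchySchwarz τ (β * α) (β * w * α)
  have e0 : τ.toPos (star (β * α) * (β * w * α)) = τ.toPos (b * w * a) := by
    rw [← ma, ← mb, star_mul, sa, sb]
    rw [show α * β * (β * w * α) = α * (β * β * w * α) by simp only [mul_assoc], τ.tracial]
    simp only [mul_assoc]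
  have e1 : reTr τ (star (β * α) * (β * α)) = reTr τ (star 1 * b * 1 * a) := by
    rw [← ma, ← mb, star_mul, sa, sb, star_one, one_mul, mul_one,
      show α * β * (β * α) = α * (β * β * α) by simp only [mul_assoc], tr_comm]
    simp only [mul_assoc]
  have e2 : reTr τ (star (β * w * α) * (β * w * α)) = reTr τ (star w * b * w * a) := by
    rw [← ma, ← mb, star_mul, star_mul, sa, sb,
      show α * (star w * β) * (β * w * α) = α * (star w * (β * β) * w * α) by
        simp only [mul_assoc], tr_comm]
    simp only [mul_assoc]
  rw [e0, e1, e2] at h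
  set X := reTr τ (a ^ p) ^ (1 / p) * reTr τ (b ^ q) ^ (1 / q) with hX
  have hX0 : 0 ≤ X := mul_nonneg (Real.rpow_nonneg (tr_nonneg τ CFC.rpow_nonneg) _)
    (Real.rpow_nonneg (tr_nonneg τ CFC.rpow_nonneg) _)
  have h1 : ‖(1 : M)‖ ≤ 1 := by
    rcases subsingleton_or_nontrivial M with _ | _
    · rw [Subsingleton.elim (1 : M) 0]; simp
    · simp
  calc _ ≤ _ := h
    _ ≤ √X * √X := by
      gcongr
      · exact tr_conj_le τ hpq ha hb h1
      · exact tr_conj_le τ hpq ha hb hw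
    _ = X := Real.mul_self_sqrt hX0

/-- Approximate polar decomposition. -/
theorem exists_polar (x : M) {ε : ℝ} (hε : 0 < ε) :
    ∃ u : M, ‖u‖ ≤ 1 ∧ ‖x - u * CFC.abs x‖ ≤ ε := by
  set a := CFC.abs x with ha
  have ha0 : 0 ≤ a := CFC.abs_nonneg x
  have hsa : IsSelfAdjoint a := ha0.isSelfAdjoint
  have haa : a * a = star x * x := CFC.abs_mul_abs x
  have hpos : ∀ s ∈ spectrum ℝ a, 0 ≤ s := fun s hs => spectrum_nonneg_of_nonneg ha0 hs
  have hcont : ContinuousOn (fun s : ℝ => (s + ε)⁻¹) (spectrum ℝ a) :=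
    ContinuousOn.inv₀ (by fun_prop) fun s hs => by have := hpos s hs; positivity
  -- the norm of `x * f(|x|)` is that of `|x| * f(|x|)`
  have hnorm : ∀ f : ℝ → ℝ, ContinuousOn f (spectrum ℝ a) → ∀ c : ℝ, 0 ≤ c →
      (∀ s ∈ spectrum ℝ a, ‖s * f s‖ ≤ c) → ‖x * cfc f a‖ ≤ c := by
    intro f hf c hc hfc
    have hst : star (cfc f a) = cfc f a := (IsSelfAdjoint.cfc (f := f) (a := a)).star_eq
    have e : star (x * cfc f a) * (x * cfc f a) = star (a * cfc f a) * (a * cfc f a) := by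
      rw [star_mul, star_mul, hst, hsa.star_eq]
      calc cfc f a * star x * (x * cfc f a) = cfc f a * (star x * x) * cfc f a := by
            simp only [mul_assoc]
        _ = _ := by rw [← haa]; simp only [mul_assoc]
    have e2 : ‖x * cfc f a‖ = ‖a * cfc f a‖ := by
      have := congrArg norm e
      rw [CStarRing.norm_star_mul_self, CStarRing.norm_star_mul_self] at this
      nlinarith [norm_nonneg (x * cfc f a), norm_nonneg (a * cfc f a)]
    rw [e2]
    have e3 : a * cfc f a = cfc (fun s => s * f s) a := by
      rw [cfc_mul (R := ℝ) (fun s => s) f a (by fun_prop) hf, cfc_id' ℝ a]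
    rw [e3]
    exact norm_cfc_le hc hfc
  refine ⟨x * cfc (fun s : ℝ => (s + ε)⁻¹) a, hnorm _ hcont 1 zero_le_one fun s hs => ?_, ?_⟩
  · have := hpos s hs
    rw [Real.norm_of_nonneg (by positivity), mul_inv_le_iff₀ (by positivity)]
    linarith
  · have e : x - x * cfc (fun s : ℝ => (s + ε)⁻¹) a * a
        = x * cfc (fun s : ℝ => 1 - (s + ε)⁻¹ * s) a := by
      rw [cfc_sub (R := ℝ) (fun _ => 1) (fun s => (s + ε)⁻¹ * s) a (by fun_prop)
        (hcont.mul continuousOn_id), cfc_const_one ℝ a, mul_sub, mul_one,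
        cfc_mul (R := ℝ) (fun s => (s + ε)⁻¹) (fun s => s) a hcont (by fun_prop), cfc_id' ℝ a,
        mul_assoc]
    rw [e]
    refine hnorm _ (continuousOn_const.sub (hcont.mul continuousOn_id)) ε hε.le fun s hs => ?_
    have := hpos s hs
    change ‖s * (1 - (s + ε)⁻¹ * s)‖ ≤ ε
    have h1 : s * (1 - (s + ε)⁻¹ * s) = ε * (s / (s + ε)) := by
      field_simp; ring
    rw [h1, Real.norm_of_nonneg (by positivity)]
    have : s / (s + ε) ≤ 1 := by rw [div_le_one (by positivity)]; linarith
    nlinarith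

theorem pNorm_nonneg (p : ℝ) (x : M) : 0 ≤ pNorm τ p x :=
  Real.rpow_nonneg (tr_nonneg τ CFC.rpow_nonneg) _

theorem pNorm_eq (p : ℝ) (x : M) : pNorm τ p x = reTr τ (CFC.abs x ^ p) ^ (1 / p) := rfl

/-- Passing to the limit in approximate polar decompositions. -/
theorem bound_of_polar (x y : M) {C : ℝ}
    (h : ∀ u v : M, ‖u‖ ≤ 1 → ‖v‖ ≤ 1 →
      ‖τ.toPos (star (v * CFC.abs y) * (u * CFC.abs x))‖ ≤ C) :
    ‖τ.toPos (star y * x)‖ ≤ C := by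
  choose u hu hu' using fun n : ℕ => exists_polar x (ε := 1 / ((n : ℝ) + 1)) (by positivity)
  choose v hv hv' using fun n : ℕ => exists_polar y (ε := 1 / ((n : ℝ) + 1)) (by positivity)
  have hx : Tendsto (fun n => u n * CFC.abs x) atTop (𝓝 x) := by
    rw [tendsto_iff_norm_sub_tendsto_zero]
    refine squeeze_zero (fun _ => norm_nonneg _) (fun n => ?_) tendsto_one_div_add_atTop_nhds_zero_nat
    rw [norm_sub_rev]; exact hu' n
  have hy : Tendsto (fun n => v n * CFC.abs y) atTop (𝓝 y) := by
    rw [tendsto_iff_norm_sub_tendsto_zero]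
    refine squeeze_zero (fun _ => norm_nonneg _) (fun n => ?_) tendsto_one_div_add_atTop_nhds_zero_nat
    rw [norm_sub_rev]; exact hv' n
  have hc : Continuous τ.toPos :=
    (τ.toPos.toLinearMap.mkContinuous 1 (by simpa using norm_toPos_le τ)).continuous
  have := ((hc.tendsto _).comp (hy.star.mul hx)).norm
  exact le_of_tendsto this (Eventually.of_forall fun n => h _ _ (hu n) (hv n))

/-- The noncommutative Hölder inequality. -/
theorem holder {p q : ℝ} (hpq : p.HolderConjugate q) (x y : M) :
    ‖τ.toPos (star y * x)‖ ≤ pNorm τ p x * pNorm τ q y := by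
  refine bound_of_polar τ x y fun u v hu hv => ?_
  have hw : ‖star v * u‖ ≤ 1 := by
    refine (norm_mul_le _ _).trans ?_
    rw [norm_star]
    nlinarith [norm_nonneg u, norm_nonneg v]
  have := norm_toPos_mul_le τ hpq (CFC.abs_nonneg x) (CFC.abs_nonneg y) hw
  rw [star_mul, (CFC.abs_nonneg y).isSelfAdjoint.star_eq]
  simpa only [mul_assoc, pNorm_eq] using this

theorem norm_toPos_mul_abs_le {a : M} (ha : 0 ≤ a) (c : M) :
    ‖τ.toPos (c * a)‖ ≤ ‖c‖ * reTr τ a := by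
  have sa := (CFC.sqrt_nonneg a).isSelfAdjoint.star_eq
  have ma := CFC.sqrt_mul_sqrt_self a
  set α := CFC.sqrt a
  have h := cauchySchwarz τ α (c * α)
  have e0 : τ.toPos (star α * (c * α)) = τ.toPos (c * a) := by
    rw [← ma, sa, τ.tracial, mul_assoc]
  have e1 : reTr τ (star α * α) = reTr τ a := by rw [sa, ma]
  have e2 : reTr τ (star (c * α) * (c * α)) ≤ ‖c‖ ^ 2 * reTr τ a := by
    have h1 : star α * (star c * c) * α ≤ star α * algebraMap ℝ M (‖c‖ ^ 2) * α :=
      star_left_conjugate_le_conjugate CStarAlgebra.star_mul_le_algebraMap_norm_sq α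
    have h2 := tr_mono τ h1
    rw [Algebra.algebraMap_eq_smul_one, mul_smul_comm, mul_one, smul_mul_assoc, map_smul,
      smul_eq_mul, sa, ma] at h2
    rw [star_mul, sa]
    simpa only [mul_assoc] using h2
  have hT : 0 ≤ reTr τ a := tr_nonneg τ ha
  rw [e0, e1] at h
  calc _ ≤ _ := h
    _ ≤ √(reTr τ a) * √(‖c‖ ^ 2 * reTr τ a) := by gcongr
    _ = ‖c‖ * (√(reTr τ a) * √(reTr τ a)) := by
      rw [Real.sqrt_mul (by positivity), Real.sqrt_sq (norm_nonneg _)]; ring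
    _ = _ := by rw [Real.mul_self_sqrt hT]

theorem pNorm_one (x : M) : pNorm τ 1 x = reTr τ (CFC.abs x) := by
  rw [pNorm_eq, CFC.rpow_one _ (CFC.abs_nonneg x)]; simp

theorem holder_one (x y : M) : ‖τ.toPos (star y * x)‖ ≤ pNorm τ 1 x * ‖y‖ := by
  refine bound_of_polar τ x y fun u v hu hv => ?_
  rw [← mul_assoc]
  refine (norm_toPos_mul_abs_le τ (CFC.abs_nonneg x) _).trans ?_
  rw [pNorm_one, mul_comm]
  refine mul_le_mul_of_nonneg_left ?_ (tr_nonneg τ (CFC.abs_nonneg x))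
  refine (norm_mul_le _ _).trans ?_
  rw [norm_star]
  have h1 : ‖v * CFC.abs y‖ ≤ ‖y‖ := by
    refine (norm_mul_le _ _).trans ?_
    rw [CFC.norm_abs]
    nlinarith [norm_nonneg y]
  nlinarith [norm_nonneg u, norm_nonneg (v * CFC.abs y), norm_nonneg y]

/-- The modulus of `x f(|x|)` for `f ≥ 0`. -/
theorem abs_mul_cfc (x : M) {f : ℝ → ℝ} (hf : ContinuousOn f (spectrum ℝ (CFC.abs x)))
    (hf0 : ∀ s ∈ spectrum ℝ (CFC.abs x), 0 ≤ f s) :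
    CFC.abs (x * cfc f (CFC.abs x)) = cfc (fun s => s * f s) (CFC.abs x) := by
  have ha0 : 0 ≤ CFC.abs x := CFC.abs_nonneg x
  have haa : CFC.abs x * CFC.abs x = star x * x := CFC.abs_mul_abs x
  set a := CFC.abs x
  have hst : star (cfc f a) = cfc f a := (IsSelfAdjoint.cfc (f := f) (a := a)).star_eq
  have e : star (x * cfc f a) * (x * cfc f a) =
      cfc (fun s => s * f s) a * cfc (fun s => s * f s) a := by
    have hc : cfc (fun s => s * f s) a = a * cfc f a := by
      rw [cfc_mul (R := ℝ) (fun s => s) f a (by fun_prop) hf, cfc_id' ℝ a]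
    have hc' : cfc (fun s => s * f s) a = cfc f a * a := by
      rw [cfc_congr (g := fun s => f s * s) (fun s _ => mul_comm _ _),
        cfc_mul (R := ℝ) f (fun s => s) a hf (by fun_prop), cfc_id' ℝ a]
    rw [star_mul, hst]
    calc cfc f a * star x * (x * cfc f a) = cfc f a * (star x * x) * cfc f a := by
          simp only [mul_assoc]
      _ = (cfc f a * a) * (a * cfc f a) := by rw [← haa]; simp only [mul_assoc]
      _ = _ := by rw [← hc, ← hc']
  rw [CFC.abs, e]
  exact CFC.sqrt_mul_self _ (cfc_nonneg fun s hs =>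
    mul_nonneg (spectrum_nonneg_of_nonneg ha0 hs) (hf0 s hs))

/-- The duality argument behind Minkowski's inequality. -/
theorem duality (z : M) {f : ℝ → ℝ} (hf : ContinuousOn f (spectrum ℝ (CFC.abs z))) {S : ℝ}
    (hS : ‖τ.toPos (star (z * cfc f (CFC.abs z)) * z)‖ ≤ S) :
    reTr τ (cfc (fun s => f s * (s * s)) (CFC.abs z)) ≤ S := by
  refine le_trans ?_ hS
  have haa : CFC.abs z * CFC.abs z = star z * z := CFC.abs_mul_abs z
  have hsa : IsSelfAdjoint (CFC.abs z) := (CFC.abs_nonneg z).isSelfAdjoint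
  set a := CFC.abs z
  have hst : star (cfc f a) = cfc f a := (IsSelfAdjoint.cfc (f := f) (a := a)).star_eq
  rw [star_mul, hst, mul_assoc, ← haa, cfc_mul (R := ℝ) f (fun s => s * s) a hf (by fun_prop),
    cfc_mul (R := ℝ) (fun s => s) (fun s => s) a (by fun_prop) (by fun_prop), cfc_id' ℝ a]
  exact Complex.re_le_norm _

theorem pNorm_add_le_one (x y : M) : pNorm τ 1 (x + y) ≤ pNorm τ 1 x + pNorm τ 1 y := by
  rw [pNorm_one τ (x + y)]
  refine le_of_forall_pos_le_add fun ε hε => ?_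
  have ha0 : 0 ≤ CFC.abs (x + y) := CFC.abs_nonneg _
  have hpos : ∀ s ∈ spectrum ℝ (CFC.abs (x + y)), 0 ≤ s :=
    fun s hs => spectrum_nonneg_of_nonneg ha0 hs
  have hcont : ContinuousOn (fun s : ℝ => (s + ε)⁻¹) (spectrum ℝ (CFC.abs (x + y))) :=
    ContinuousOn.inv₀ (by fun_prop) fun s hs => by have := hpos s hs; positivity
  set w := (x + y) * cfc (fun s : ℝ => (s + ε)⁻¹) (CFC.abs (x + y)) with hw
  have hw1 : ‖w‖ ≤ 1 := by
    rw [← CFC.norm_abs, hw, abs_mul_cfc _ hcont fun s hs => by have := hpos s hs; positivity]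
    refine norm_cfc_le zero_le_one fun s hs => ?_
    have := hpos s hs
    rw [Real.norm_of_nonneg (by positivity), mul_inv_le_iff₀ (by positivity)]
    linarith
  have h1 := duality τ (x + y) hcont (S := pNorm τ 1 x + pNorm τ 1 y) (by
    rw [← hw, mul_add, map_add]
    refine (norm_add_le _ _).trans (add_le_add ?_ ?_)
    · refine (holder_one τ x w).trans ?_
      nlinarith [pNorm_nonneg τ 1 x]
    · refine (holder_one τ y w).trans ?_
      nlinarith [pNorm_nonneg τ 1 y])
  set a := CFC.abs (x + y)
  have h2 : a ≤ cfc (fun s : ℝ => (s + ε)⁻¹ * (s * s) + ε) a := by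
    conv_lhs => rw [← cfc_id' ℝ a]
    refine cfc_mono (fun s hs => ?_) (by fun_prop) ((hcont.mul (by fun_prop)).add (by fun_prop))
    have := hpos s hs
    have e : (s + ε)⁻¹ * (s * s) + ε - s = ε ^ 2 / (s + ε) := by field_simp; ring
    have : 0 ≤ ε ^ 2 / (s + ε) := by positivity
    linarith
  have h3 := tr_mono τ h2
  rw [cfc_add_const (R := ℝ) ε (fun s : ℝ => (s + ε)⁻¹ * (s * s)) a (hcont.mul (by fun_prop)),
    map_add, Algebra.algebraMap_eq_smul_one, map_smul, tr_one, smul_eq_mul, mul_one] at h3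
  linarith

theorem pNorm_add_le_of_one_lt {p : ℝ} (hp : 1 < p) (x y : M) :
    pNorm τ p (x + y) ≤ pNorm τ p x + pNorm τ p y := by
  obtain ⟨q, hpq⟩ : ∃ q, p.HolderConjugate q := ⟨_, Real.HolderConjugate.conjExponent hp⟩
  have hp0 := hpq.pos
  have hq0 := hpq.symm.pos
  have ha0 : 0 ≤ CFC.abs (x + y) := CFC.abs_nonneg _
  have hpos : ∀ s ∈ spectrum ℝ (CFC.abs (x + y)), 0 ≤ s :=
    fun s hs => spectrum_nonneg_of_nonneg ha0 hs
  set T := reTr τ (CFC.abs (x + y) ^ p) with hT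
  set S := pNorm τ p x + pNorm τ p y with hS
  have hT0 : 0 ≤ T := tr_nonneg τ CFC.rpow_nonneg
  have hS0 : 0 ≤ S := add_nonneg (pNorm_nonneg _ _ _) (pNorm_nonneg _ _ _)
  have hpc : Continuous fun s : ℝ => s ^ p := Real.continuous_rpow_const hp0.le
  have hp1c : Continuous fun s : ℝ => s ^ (p - 1) := Real.continuous_rpow_const (by linarith)
  have main : ∀ ε : ℝ, 0 < ε →
      T ≤ S * T ^ (1 / q) + ε * reTr τ (cfc (fun s : ℝ => s ^ (p - 1)) (CFC.abs (x + y))) := by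
    intro ε hε
    set g : ℝ → ℝ := fun s => s ^ (p - 1) * (s + ε)⁻¹ with hg
    have hcont : ContinuousOn g (spectrum ℝ (CFC.abs (x + y))) :=
      hp1c.continuousOn.mul
        (ContinuousOn.inv₀ (by fun_prop) fun s hs => by have := hpos s hs; positivity)
    have hg0 : ∀ s ∈ spectrum ℝ (CFC.abs (x + y)), 0 ≤ g s := fun s hs => by
      have := hpos s hs
      simp only [hg]; positivity
    set w := (x + y) * cfc g (CFC.abs (x + y)) with hw
    have hwq : pNorm τ q w ≤ T ^ (1 / q) := by
      rw [pNorm_eq]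
      refine Real.rpow_le_rpow (tr_nonneg τ CFC.rpow_nonneg) (tr_mono τ ?_) (by positivity)
      rw [hw, abs_mul_cfc _ hcont hg0, CFC.rpow_eq_cfc_real ha0,
        CFC.rpow_eq_cfc_real (cfc_nonneg fun s hs => mul_nonneg (hpos s hs) (hg0 s hs))]
      have hqc : Continuous fun s : ℝ => s ^ q := Real.continuous_rpow_const hq0.le
      have hgc : ContinuousOn (fun s => s * g s) (spectrum ℝ (CFC.abs (x + y))) :=
        continuousOn_id.mul hcont
      rw [← cfc_comp' (R := ℝ) (fun s => s ^ q) (fun s => s * g s) _ hqc.continuousOn hgc]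
      refine cfc_mono (fun s hs => ?_) (hqc.comp_continuousOn hgc) hpc.continuousOn
      have hs0 := hpos s hs
      have h1 : s * g s ≤ s ^ (p - 1) := by
        simp only [hg]
        rw [← mul_assoc, mul_inv_le_iff₀ (by positivity)]
        have : 0 ≤ s ^ (p - 1) := by positivity
        nlinarith
      refine (Real.rpow_le_rpow (mul_nonneg hs0 (hg0 s hs)) h1 hq0.le).trans (le_of_eq ?_)
      rw [← Real.rpow_mul hs0, hpq.sub_one_mul_conj]
    have h1 := duality τ (x + y) hcont (S := S * T ^ (1 / q)) (by
      rw [← hw, mul_add, map_add, hS, add_mul]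
      refine (norm_add_le _ _).trans (add_le_add ?_ ?_)
      · exact (holder τ hpq x w).trans (mul_le_mul_of_nonneg_left hwq (pNorm_nonneg _ _ _))
      · exact (holder τ hpq y w).trans (mul_le_mul_of_nonneg_left hwq (pNorm_nonneg _ _ _)))
    set a := CFC.abs (x + y)
    have hgs : ContinuousOn (fun s => g s * (s * s)) (spectrum ℝ a) := hcont.mul (by fun_prop)
    have h2 : a ^ p ≤ cfc (fun s : ℝ => g s * (s * s) + ε * s ^ (p - 1)) a := by
      rw [CFC.rpow_eq_cfc_real ha0]
      refine cfc_mono (fun s hs => ?_) hpc.continuousOn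
        (hgs.add (hp1c.continuousOn.const_mul ε |>.congr fun _ _ => rfl))
      have hs0 := hpos s hs
      have e0 : s ^ p = s ^ (p - 1) * s := by
        rcases hs0.eq_or_lt with h | h
        · rw [← h, mul_zero, Real.zero_rpow hp0.ne']
        · rw [Real.rpow_sub_one h.ne']; field_simp
      have e : g s * (s * s) + ε * s ^ (p - 1) - s ^ p = s ^ (p - 1) * (ε ^ 2 / (s + ε)) := by
        rw [e0]; simp only [hg]; field_simp; ring
      have : 0 ≤ s ^ (p - 1) * (ε ^ 2 / (s + ε)) := by positivity
      linarith
    have h3 := tr_mono τ h2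
    rw [cfc_add (R := ℝ) (fun s => g s * (s * s)) (fun s => ε * s ^ (p - 1)) (a := a) hgs
      (continuousOn_const.mul hp1c.continuousOn),
      cfc_const_mul (R := ℝ) _ _ a hp1c.continuousOn, map_add, map_smul, smul_eq_mul] at h3
    linarith
  have hle : T ≤ S * T ^ (1 / q) := by
    set K := reTr τ (cfc (fun s : ℝ => s ^ (p - 1)) (CFC.abs (x + y)))
    have hlim : Tendsto (fun ε : ℝ => S * T ^ (1 / q) + ε * K) (𝓝[>] 0)
        (𝓝 (S * T ^ (1 / q) + 0 * K)) :=
      Tendsto.mono_left (Continuous.tendsto (by fun_prop) 0) nhdsWithin_le_nhds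
    rw [zero_mul, add_zero] at hlim
    exact ge_of_tendsto hlim (eventually_mem_nhdsWithin.mono fun ε he => main ε he)
  rw [pNorm_eq, ← hT]
  rcases hT0.eq_or_lt with h | h
  · rw [← h, Real.zero_rpow (by positivity)]; exact hS0
  · have e : T = T ^ (1 / p) * T ^ (1 / q) := by
      rw [← Real.rpow_add h]
      have := hpq.inv_add_inv_eq_one
      rw [one_div, one_div, this, Real.rpow_one]
    have hTq : 0 < T ^ (1 / q) := by positivity
    nlinarith [hle, e]

/-- Minkowski's inequality: `‖·‖_p` is subadditive for `1 ≤ p`. -/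
theorem pNorm_add_le {p : ℝ} (hp : 1 ≤ p) (x y : M) :
    pNorm τ p (x + y) ≤ pNorm τ p x + pNorm τ p y := by
  rcases hp.eq_or_lt with h | h
  · subst h; exact pNorm_add_le_one τ x y
  · exact pNorm_add_le_of_one_lt τ h x y

theorem pNorm_smul {p : ℝ} (hp : 0 < p) (c : ℂ) (x : M) :
    pNorm τ p (c • x) = ‖c‖ * pNorm τ p x := by
  rw [pNorm_eq, pNorm_eq, CFC.abs_smul, smul_rpow (CFC.abs_nonneg x) (norm_nonneg c) hp, map_smul,
    smul_eq_mul, Real.mul_rpow (by positivity) (tr_nonneg τ CFC.rpow_nonneg),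
    ← Real.rpow_mul (norm_nonneg c), mul_one_div_cancel hp.ne', Real.rpow_one]

theorem pNorm_le_norm {p : ℝ} (hp : 0 < p) (x : M) : pNorm τ p x ≤ ‖x‖ := by
  rw [pNorm_eq]
  have ha0 : 0 ≤ CFC.abs x := CFC.abs_nonneg x
  have h1 : ‖CFC.abs x ^ p‖ ≤ ‖x‖ ^ p := by
    rw [CFC.rpow_eq_cfc_real ha0]
    refine norm_cfc_le (by positivity) fun s hs => ?_
    have hs0 : 0 ≤ s := spectrum_nonneg_of_nonneg ha0 hs
    have hs1 : s ≤ ‖x‖ := by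
      have := IsSelfAdjoint.le_algebraMap_norm_self (a := CFC.abs x)
      rw [CFC.norm_abs] at this
      exact (le_algebraMap_iff_spectrum_le (R := ℝ) (a := CFC.abs x)).mp this s hs
    rw [Real.norm_of_nonneg (by positivity)]
    exact Real.rpow_le_rpow hs0 hs1 hp.le
  have h2 := (le_abs_self _).trans ((abs_tr_le τ (CFC.abs x ^ p)).trans h1)
  refine (Real.rpow_le_rpow (tr_nonneg τ CFC.rpow_nonneg) h2 (by positivity)).trans (le_of_eq ?_)
  rw [← Real.rpow_mul (norm_nonneg x), mul_one_div_cancel hp.ne', Real.rpow_one]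

theorem norm_toPos_star_mul_le {p : ℝ} (hp : 1 ≤ p) (x y : M) :
    ‖τ.toPos (star y * x)‖ ≤ ‖y‖ * pNorm τ p x := by
  rw [mul_comm]
  rcases hp.eq_or_lt with h | h
  · subst h; exact holder_one τ x y
  · have hpq := Real.HolderConjugate.conjExponent h
    exact (holder τ hpq x y).trans
      (mul_le_mul_of_nonneg_left (pNorm_le_norm τ hpq.symm.pos y) (pNorm_nonneg _ _ _))

end TracialState

section NCLp

variable {M : Type*} [CStarAlgebra M] [PartialOrder M] [StarOrderedRing M]

/-- A copy of the algebra `M`, which carries the seminorm `‖·‖_p` of the tracial state `τ`.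
As `τ` is finite, every element of `M` has a support of finite trace. -/
def LpPre (_τ : TracialState M) (_p : ℝ) := M

variable (τ : TracialState M) (p : ℝ)

instance : AddCommGroup (LpPre τ p) := inferInstanceAs (AddCommGroup M)
instance : Module ℂ (LpPre τ p) := inferInstanceAs (Module ℂ M)

/-- The identity map from `M` to its copy with the seminorm `‖·‖_p`. -/
def toLpPre : M ≃ₗ[ℂ] LpPre τ p := LinearEquiv.refl ℂ M

variable [hp : Fact (1 ≤ p)]

instance : SeminormedAddCommGroup (LpPre τ p) :=
  AddGroupSeminorm.toSeminormedAddCommGroup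
    { toFun := fun x => pNorm τ p ((toLpPre τ p).symm x)
      map_zero' := by
        have := pNorm_smul τ (zero_lt_one.trans_le hp.out) 0 0
        simpa using this
      add_le' := fun x y => pNorm_add_le τ hp.out _ _
      neg' := fun x => by
        have := pNorm_smul τ (zero_lt_one.trans_le hp.out) (-1) ((toLpPre τ p).symm x)
        simpa using this }

theorem norm_toLpPre (x : M) : ‖toLpPre τ p x‖ = pNorm τ p x := rfl

instance : NormedSpace ℂ (LpPre τ p) where
  norm_smul_le c x := (pNorm_smul τ (zero_lt_one.trans_le hp.out) c ((toLpPre τ p).symm x)).le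

/-- The noncommutative space `L_p(M, τ)`: the completion of `M` with respect to `‖·‖_p`. -/
abbrev NCLp : Type _ := UniformSpace.Completion (LpPre τ p)

/-- The canonical dense embedding of `M` into `L_p(M, τ)`. -/
def toLp : M →ₗ[ℂ] NCLp τ p :=
  UniformSpace.Completion.toComplL.toLinearMap ∘ₗ (toLpPre τ p).toLinearMap

theorem norm_toLp (x : M) : ‖toLp τ p x‖ = pNorm τ p x :=
  UniformSpace.Completion.norm_coe (toLpPre τ p x)

theorem denseRange_toLp : DenseRange (toLp τ p) := by
  have := (UniformSpace.Completion.denseRange_coe (α := LpPre τ p))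
  rw [DenseRange, show Set.range (toLp τ p) = Set.range (fun x : LpPre τ p => (x : NCLp τ p)) from
    (toLpPre τ p).surjective.range_comp _]
  exact this

/-- The continuous extension to `L_p(M, τ)` of the functional `x ↦ τ (y* x)` on `M`. -/
def lpPairing (y : M) : NCLp τ p →L[ℂ] ℂ :=
  ContinuousLinearMap.extend
    (LinearMap.mkContinuous
      (τ.toPos.toLinearMap ∘ₗ LinearMap.mulLeft ℂ (star y) ∘ₗ (toLpPre τ p).symm.toLinearMap) ‖y‖
      (fun _ => norm_toPos_star_mul_le τ hp.out _ y))
    (UniformSpace.Completion.toComplL : LpPre τ p →L[ℂ] NCLp τ p)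

theorem lpPairing_toLp (y x : M) : lpPairing τ p y (toLp τ p x) = τ.toPos (star y * x) :=
  ContinuousLinearMap.extend_eq _ UniformSpace.Completion.denseRange_coe
    (UniformSpace.Completion.isUniformInducing_coe _) _

end NCLp

section GNS

variable {A : Type*} [CStarAlgebra A] [PartialOrder A] [StarOrderedRing A] (τ : TracialState A)

/-- The commutant of the image of the GNS representation of `τ`. -/
def gnsCommutant : StarSubalgebra ℂ (τ.toPos.GNS →L[ℂ] τ.toPos.GNS) :=
  StarSubalgebra.centralizer ℂ (Set.range τ.toPos.gnsStarAlgHom)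

/-- The von Neumann algebra generated by `A` in the GNS representation of `τ`: the double commutant
of the image of `A` (equivalently, by the double commutant theorem, its w*-closure). -/
def gnsVN : VonNeumannAlgebra τ.toPos.GNS where
  toStarSubalgebra := StarSubalgebra.centralizer ℂ (SetLike.coe (gnsCommutant τ))
  centralizer_centralizer' := by
    change Set.centralizer (Set.centralizer (SetLike.coe (StarSubalgebra.centralizer ℂ
      (SetLike.coe (gnsCommutant τ))))) = SetLike.coe (StarSubalgebra.centralizer ℂ
      (SetLike.coe (gnsCommutant τ)))
    rw [StarSubalgebra.coe_centralizer]
    exact Set.centralizer_centralizer_centralizer _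

theorem mem_gnsVN {x : τ.toPos.GNS →L[ℂ] τ.toPos.GNS} :
    x ∈ (gnsVN τ).toStarSubalgebra ↔ ∀ y : τ.toPos.GNS →L[ℂ] τ.toPos.GNS,
      (∀ a, τ.toPos.gnsStarAlgHom a * y = y * τ.toPos.gnsStarAlgHom a) → y * x = x * y := by
  have h : ∀ y : τ.toPos.GNS →L[ℂ] τ.toPos.GNS,
      y ∈ gnsCommutant τ ↔
        ∀ a, τ.toPos.gnsStarAlgHom a * y = y * τ.toPos.gnsStarAlgHom a := by
    intro y
    rw [gnsCommutant, StarSubalgebra.mem_centralizer_iff]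
    constructor
    · intro h a; exact (h _ ⟨a, rfl⟩).1
    · rintro h _ ⟨a, rfl⟩
      refine ⟨h a, ?_⟩
      rw [← map_star]; exact h _
  change x ∈ StarSubalgebra.centralizer ℂ (SetLike.coe (gnsCommutant τ)) ↔ _
  rw [StarSubalgebra.mem_centralizer_iff]
  constructor
  · intro hx y hy
    exact (hx y ((h y).2 hy)).1
  · intro hx y hy
    refine ⟨hx y ((h y).1 hy), hx _ ((h _).1 ?_)⟩
    exact star_mem hy

theorem gns_mem (a : A) : τ.toPos.gnsStarAlgHom a ∈ (gnsVN τ).toStarSubalgebra :=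
  (mem_gnsVN τ).2 fun _ hy => (hy a).symm

/-- The von Neumann algebra of the GNS representation of `τ`, as a C*-algebra in its own right. -/
def GNSvN : Type _ := (gnsVN τ).toStarSubalgebra

instance : IsClosed ((gnsVN τ).toStarSubalgebra : Set (τ.toPos.GNS →L[ℂ] τ.toPos.GNS)) := by
  have := (gnsVN τ).centralizer_centralizer'
  change IsClosed (gnsVN τ).carrier
  rw [← this]
  exact Set.isClosed_centralizer _

instance : CStarAlgebra (GNSvN τ) := inferInstanceAs (CStarAlgebra (gnsVN τ).toStarSubalgebra)
instance : PartialOrder (GNSvN τ) := CStarAlgebra.spectralOrder _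
instance : StarOrderedRing (GNSvN τ) := CStarAlgebra.spectralOrderedRing _

/-- The elements of the von Neumann algebra as operators on the GNS space. -/
def GNSvN.toOp : GNSvN τ →⋆ₐ[ℂ] (τ.toPos.GNS →L[ℂ] τ.toPos.GNS) :=
  (gnsVN τ).toStarSubalgebra.subtype

theorem GNSvN.toOp_mem (x : GNSvN τ) : GNSvN.toOp τ x ∈ (gnsVN τ).toStarSubalgebra := x.2

/-- The GNS representation, as a map of `A` into its von Neumann algebra. -/
def gnsHom : A →⋆ₐ[ℂ] GNSvN τ :=
  τ.toPos.gnsStarAlgHom.codRestrict (gnsVN τ).toStarSubalgebra (gns_mem τ)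

theorem toOp_gnsHom (a : A) : GNSvN.toOp τ (gnsHom τ a) = τ.toPos.gnsStarAlgHom a := rfl

/-- The cyclic vector of the GNS representation: the class of `1`. -/
def gnsVec : τ.toPos.GNS := ((τ.toPos.toPreGNS 1 : τ.toPos.PreGNS) : τ.toPos.GNS)

local notation "Ω" => gnsVec τ
local notation "π" => τ.toPos.gnsStarAlgHom

theorem gns_gnsVec (a : A) : π a Ω = ((τ.toPos.toPreGNS a : τ.toPos.PreGNS) : τ.toPos.GNS) := by
  refine (PositiveLinearMap.gnsNonUnitalStarAlgHom_apply_coe (f := τ.toPos) (a := a)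
    (b := τ.toPos.toPreGNS 1)).trans ?_
  simp

theorem gns_cyclic : DenseRange fun a : A => π a Ω := by
  have := UniformSpace.Completion.denseRange_coe (α := τ.toPos.PreGNS)
  simp only [gns_gnsVec]
  rw [DenseRange, show Set.range (fun a : A => ((τ.toPos.toPreGNS a : τ.toPos.PreGNS) : τ.toPos.GNS))
    = Set.range (fun x : τ.toPos.PreGNS => (x : τ.toPos.GNS)) from
    (τ.toPos.toPreGNS).surjective.range_comp (fun x : τ.toPos.PreGNS => (x : τ.toPos.GNS))]
  exact this

/-- Right multiplication on the GNS space, which is bounded as `τ` is tracial. -/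
def rightMulPre (a : A) : τ.toPos.PreGNS →L[ℂ] τ.toPos.PreGNS :=
  (τ.toPos.toPreGNS.toLinearMap ∘ₗ LinearMap.mulRight ℂ a ∘ₗ
    τ.toPos.ofPreGNS.toLinearMap).mkContinuous ‖a‖ fun x => by
    have h := tr_conj_nonneg τ (sub_nonneg.mpr (CStarAlgebra.mul_star_le_algebraMap_norm_sq (a := a)))
      (star_mul_self_nonneg (τ.toPos.ofPreGNS x)) 1
    set b := τ.toPos.ofPreGNS x with hb
    simp only [star_one, one_mul, mul_one, sub_mul, map_sub, Algebra.algebraMap_eq_smul_one,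
      smul_mul_assoc, map_smul, smul_eq_mul] at h
    change √(reTr τ (star (b * a) * (b * a))) ≤ ‖a‖ * √(reTr τ (star b * b))
    have e : reTr τ (star (b * a) * (b * a)) = reTr τ (a * star a * (star b * b)) := by
      rw [star_mul, mul_assoc, tr_comm, mul_assoc, mul_assoc, tr_comm, mul_assoc, tr_comm]
      simp only [mul_assoc]
    rw [e, ← Real.sqrt_sq (norm_nonneg a), ← Real.sqrt_mul (by positivity)]
    exact Real.sqrt_le_sqrt (by linarith)

theorem rightMulPre_coe (a b : A) : (rightMulPre τ a).completion
    (π b Ω) = π (b * a) Ω := by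
  rw [gns_gnsVec, gns_gnsVec, ContinuousLinearMap.completion_apply_coe]
  rfl

theorem gns_inner (a b : A) : ⟪π a Ω, π b Ω⟫_ℂ = τ.toPos (star a * b) := by
  rw [gns_gnsVec, gns_gnsVec, UniformSpace.Completion.inner_coe]; rfl

theorem gns_star (a : A) (ξ η : τ.toPos.GNS) : ⟪ξ, π a η⟫_ℂ = ⟪π (star a) ξ, η⟫_ℂ := by
  rw [map_star, ContinuousLinearMap.star_eq_adjoint, ContinuousLinearMap.adjoint_inner_left]

theorem comm_rightMul {x : τ.toPos.GNS →L[ℂ] τ.toPos.GNS} (hx : x ∈ (gnsVN τ).toStarSubalgebra)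
    (a : A) (ξ : τ.toPos.GNS) :
    x ((rightMulPre τ a).completion ξ) = (rightMulPre τ a).completion (x ξ) := by
  have h := (mem_gnsVN τ).1 hx (rightMulPre τ a).completion fun b => by
    ext ξ
    refine (gns_cyclic τ).induction_on (p := fun ξ => (π b * (rightMulPre τ a).completion) ξ =
      ((rightMulPre τ a).completion * π b) ξ) ξ (isClosed_eq (by fun_prop) (by fun_prop)) fun c => ?_
    rw [mul_apply_eq_comp, mul_apply_eq_comp, rightMulPre_coe,
      ← mul_apply_eq_comp, ← map_mul, ← mul_apply_eq_comp (π b), ← map_mul,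
      rightMulPre_coe, mul_assoc]
  exact (congrArg (fun T : τ.toPos.GNS →L[ℂ] τ.toPos.GNS => T ξ) h).symm

theorem inner_rightMul (a : A) (ξ η : τ.toPos.GNS) :
    ⟪ξ, (rightMulPre τ a).completion η⟫_ℂ = ⟪(rightMulPre τ (star a)).completion ξ, η⟫_ℂ := by
  refine (gns_cyclic τ).induction_on₂ (p := fun ξ η => ⟪ξ, (rightMulPre τ a).completion η⟫_ℂ =
    ⟪(rightMulPre τ (star a)).completion ξ, η⟫_ℂ) (isClosed_eq (by fun_prop) (by fun_prop))
    (fun b c => ?_) ξ η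
  rw [rightMulPre_coe, rightMulPre_coe, gns_inner, gns_inner, star_mul, star_star, ← mul_assoc,
    τ.tracial, mul_assoc]

theorem vec_trace_left {x : τ.toPos.GNS →L[ℂ] τ.toPos.GNS} (hx : x ∈ (gnsVN τ).toStarSubalgebra)
    (a : A) : ⟪Ω, x (π a Ω)⟫_ℂ = ⟪Ω, π a (x Ω)⟫_ℂ := by
  have h1 : Ω = π 1 Ω := by simp
  have h2 : π a Ω = (rightMulPre τ a).completion Ω := by
    conv_rhs => rw [h1, rightMulPre_coe, one_mul]
  have h3 : π (star a) Ω = (rightMulPre τ (star a)).completion Ω := by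
    conv_rhs => rw [h1, rightMulPre_coe, one_mul]
  rw [h2, comm_rightMul τ hx, inner_rightMul, ← h3, gns_star]

theorem norm_star_vec_le {z : τ.toPos.GNS →L[ℂ] τ.toPos.GNS}
    (hz : z ∈ (gnsVN τ).toStarSubalgebra) : ‖star z Ω‖ ≤ ‖z Ω‖ := by
  have hn : ∀ b : A, ‖π (star b) Ω‖ = ‖π b Ω‖ := by
    intro b
    have h : ⟪π (star b) Ω, π (star b) Ω⟫_ℂ = ⟪π b Ω, π b Ω⟫_ℂ := by
      rw [gns_inner, gns_inner, star_star, τ.tracial]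
    rw [inner_self_eq_norm_sq_to_K, inner_self_eq_norm_sq_to_K] at h
    have h' : ‖π (star b) Ω‖ ^ 2 = ‖π b Ω‖ ^ 2 := by exact_mod_cast h
    exact (sq_eq_sq₀ (norm_nonneg _) (norm_nonneg _)).1 h'
  have h : ∀ ξ : τ.toPos.GNS, ‖⟪ξ, star z Ω⟫_ℂ‖ ≤ ‖ξ‖ * ‖z Ω‖ := by
    intro ξ
    refine (gns_cyclic τ).induction_on (p := fun ξ => ‖⟪ξ, star z Ω⟫_ℂ‖ ≤ ‖ξ‖ * ‖z Ω‖) ξ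
      (isClosed_le (by fun_prop) (by fun_prop)) fun b => ?_
    rw [ContinuousLinearMap.star_eq_adjoint, ContinuousLinearMap.adjoint_inner_right,
      norm_inner_symm, vec_trace_left τ hz, gns_star, ← hn b]
    exact norm_inner_le_norm _ _
  have h1 := h (star z Ω)
  rw [inner_self_eq_norm_sq_to_K] at h1
  have h2 : ‖star z Ω‖ ^ 2 ≤ ‖star z Ω‖ * ‖z Ω‖ := by simpa using h1
  rcases (norm_nonneg (star z Ω)).eq_or_lt with h0 | h0
  · rw [← h0]; exact norm_nonneg _
  · nlinarith

theorem vec_trace {x y : τ.toPos.GNS →L[ℂ] τ.toPos.GNS} (hx : x ∈ (gnsVN τ).toStarSubalgebra)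
    (hy : y ∈ (gnsVN τ).toStarSubalgebra) : ⟪Ω, x (y Ω)⟫_ℂ = ⟪Ω, y (x Ω)⟫_ℂ := by
  obtain ⟨v, hv, hlim⟩ := mem_closure_iff_seq_limit.1 ((gns_cyclic τ) (y Ω))
  choose a ha using hv
  have h1 : Tendsto (fun n => π (a n) Ω) atTop (𝓝 (y Ω)) := by simpa only [ha] using hlim
  have h2 : Tendsto (fun n => star (π (a n)) Ω) atTop (𝓝 (star y Ω)) := by
    rw [tendsto_iff_norm_sub_tendsto_zero] at h1 ⊢
    refine squeeze_zero (fun _ => norm_nonneg _) (fun n => ?_) h1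
    have := norm_star_vec_le τ (sub_mem (gns_mem τ (a n)) hy)
    simpa only [star_sub, sub_apply] using this
  have h3 : Tendsto (fun n => ⟪Ω, x (π (a n) Ω)⟫_ℂ) atTop (𝓝 ⟪Ω, x (y Ω)⟫_ℂ) :=
    tendsto_const_nhds.inner ((x.continuous.tendsto _).comp h1)
  have h4 : Tendsto (fun n => ⟪star (π (a n)) Ω, x Ω⟫_ℂ) atTop (𝓝 ⟪star y Ω, x Ω⟫_ℂ) :=
    h2.inner tendsto_const_nhds
  have e : ∀ n, ⟪Ω, x (π (a n) Ω)⟫_ℂ = ⟪star (π (a n)) Ω, x Ω⟫_ℂ := by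
    intro n
    rw [vec_trace_left τ hx, gns_star, map_star]
  have h5 := tendsto_nhds_unique (h3.congr e) h4
  rw [h5, ContinuousLinearMap.star_eq_adjoint, ContinuousLinearMap.adjoint_inner_left]

/-- The extension of `τ` to the von Neumann algebra of its GNS representation, namely the vector
state of the cyclic vector. -/
def vnTrace : TracialState (GNSvN τ) where
  toPos := PositiveLinearMap.mk₀
    { toFun := fun x => ⟪Ω, GNSvN.toOp τ x Ω⟫_ℂ
      map_add' := fun x y => by
        rw [map_add, add_apply, inner_add_right]
      map_smul' := fun c x => by
        rw [map_smul, smul_apply, inner_smul_right]; rfl }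
    (fun x hx => by
      obtain ⟨y, rfl⟩ := CStarAlgebra.nonneg_iff_eq_star_mul_self.1 hx
      change 0 ≤ ⟪Ω, GNSvN.toOp τ (star y * y) Ω⟫_ℂ
      rw [map_mul, map_star, mul_apply_eq_comp, ContinuousLinearMap.star_eq_adjoint,
        ContinuousLinearMap.adjoint_inner_right, inner_self_eq_norm_sq_to_K]
      have h := sq_nonneg ‖GNSvN.toOp τ y Ω‖
      rw [← RCLike.ofReal_pow]
      exact Complex.zero_le_real.2 h)
  map_one := by
    change ⟪Ω, GNSvN.toOp τ 1 Ω⟫_ℂ = 1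
    have h := gns_inner τ 1 1
    simp only [map_one, one_apply_eq_self, star_one, mul_one, τ.map_one] at h ⊢
    exact h
  tracial := fun x y => by
    change ⟪Ω, GNSvN.toOp τ (x * y) Ω⟫_ℂ = ⟪Ω, GNSvN.toOp τ (y * x) Ω⟫_ℂ
    rw [map_mul, map_mul, mul_apply_eq_comp, mul_apply_eq_comp]
    exact vec_trace τ x.2 y.2

theorem vnTrace_gnsHom (a : A) : (vnTrace τ).toPos (gnsHom τ a) = τ.toPos a := by
  change ⟪Ω, GNSvN.toOp τ (gnsHom τ a) Ω⟫_ℂ = τ.toPos a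
  have h := gns_inner τ 1 a
  simpa only [toOp_gnsHom, map_one, one_apply_eq_self, star_one, one_mul] using h

end GNS

section Torus

/-- The real skew-symmetric `d × d` matrices. -/
def SkewMatrix (d : ℕ) : Type := {θ : Matrix (Fin d) (Fin d) ℝ // θ.transpose = -θ}

variable {d : ℕ} (θ : SkewMatrix d)

/-- The commutation relation `V_k V_j = exp(2 π i θ_{kj}) V_j V_k` for unitaries `V_1, …, V_d`. -/
def TorusRelation {B : Type*} [CStarAlgebra B] (V : Fin d → unitary B) : Prop :=
  ∀ k j, (V k * V j : B) = Complex.exp (2 * Real.pi * Complex.I * (θ.1 k j : ℂ)) • (V j * V k : B)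

/-- A realisation of the commutation relation by unitaries in some (nonzero) unital C*-algebra.
A C*-algebra that is generated by `d` elements has at most the cardinality of the continuum, so
C*-algebras `B : Type` exhaust all realisations up to isomorphism. -/
structure TorusRep : Type 1 where
  B : Type
  [cstar : CStarAlgebra B]
  [nontriv : Nontrivial B]
  V : Fin d → unitary B
  rel : TorusRelation θ V

attribute [instance] TorusRep.cstar TorusRep.nontriv

/-- The C*-algebra of bounded families over all realisations, with the supremum norm. -/
abbrev RepProduct : Type 1 := lp (fun ρ : TorusRep θ => ρ.B) ∞

instance : CStarAlgebra (RepProduct θ) where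

/-- The family of the `k`-th unitaries of all realisations. -/
def productGen (k : Fin d) : unitary (RepProduct θ) :=
  ⟨⟨fun ρ => (ρ.V k : ρ.B), memℓp_infty ⟨1, by
      rintro _ ⟨ρ, rfl⟩; exact (CStarRing.norm_coe_unitary (ρ.V k)).le⟩⟩,
    Unitary.mem_iff.2
      ⟨lp.ext (funext fun ρ => Unitary.coe_star_mul_self (ρ.V k)),
        lp.ext (funext fun ρ => Unitary.coe_mul_star_self (ρ.V k))⟩⟩

/-- The closed star subalgebra generated by the `d` universal unitaries. -/
def torusSubalgebra : StarSubalgebra ℂ (RepProduct θ) :=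
  (StarAlgebra.adjoin ℂ (Set.range fun k => (productGen θ k : RepProduct θ))).topologicalClosure

/-- The noncommutative torus `A_θ`: the universal C*-algebra generated by `d` unitaries subject to
the commutation relation; its universal property is `exists_unique_hom` below. -/
def NCTorus : Type 1 := torusSubalgebra θ

instance : IsClosed (torusSubalgebra θ : Set (RepProduct θ)) :=
  StarSubalgebra.isClosed_topologicalClosure _

instance : CStarAlgebra (NCTorus θ) := inferInstanceAs (CStarAlgebra (torusSubalgebra θ))
instance : PartialOrder (NCTorus θ) := CStarAlgebra.spectralOrder _
instance : StarOrderedRing (NCTorus θ) := CStarAlgebra.spectralOrderedRing _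

theorem productGen_mem (k : Fin d) : (productGen θ k : RepProduct θ) ∈ torusSubalgebra θ :=
  StarSubalgebra.le_topologicalClosure _ (StarAlgebra.subset_adjoin ℂ _ ⟨k, rfl⟩)

/-- Membership in the generated subalgebra gives an element of `A_θ`. -/
def NCTorus.mk (x : RepProduct θ) (hx : x ∈ torusSubalgebra θ) : NCTorus θ :=
  (⟨x, hx⟩ : torusSubalgebra θ)

/-- The generators `U_1, …, U_d` of `A_θ`. -/
def generator (k : Fin d) : unitary (NCTorus θ) :=
  ⟨NCTorus.mk θ (productGen θ k) (productGen_mem θ k), Unitary.mem_iff.2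
    ⟨Subtype.ext (Unitary.coe_star_mul_self (productGen θ k)),
      Subtype.ext (Unitary.coe_mul_star_self (productGen θ k))⟩⟩

theorem gen_relation : TorusRelation θ (generator θ) := by
  intro k j
  refine Subtype.ext (Subtype.ext (funext fun ρ => ?_))
  exact ρ.rel k j

/-- The coordinate projection of the product of all realisations. -/
def evalProduct (ρ : TorusRep θ) : RepProduct θ →⋆ₐ[ℂ] ρ.B where
  toFun x := x ρ
  map_one' := rfl
  map_mul' _ _ := rfl
  map_zero' := rfl
  map_add' _ _ := rfl
  commutes' _ := rfl
  map_star' _ := rfl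

/-- The representation of `A_θ` attached to a realisation of the relation. -/
def evalHom (ρ : TorusRep θ) : NCTorus θ →⋆ₐ[ℂ] ρ.B :=
  (evalProduct θ ρ).comp (torusSubalgebra θ).subtype

theorem evalHom_gen (ρ : TorusRep θ) (k : Fin d) : evalHom θ ρ (generator θ k) = ρ.V k := rfl

/-- Induction principle for `A_θ`: it is generated by the `U_k` as a closed star subalgebra. -/
theorem induction_on {P : NCTorus θ → Prop} (hclosed : IsClosed {x | P x})
    (hgen : ∀ k, P (generator θ k)) (hscalar : ∀ c : ℂ, P (algebraMap ℂ _ c))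
    (hadd : ∀ x y, P x → P y → P (x + y)) (hmul : ∀ x y, P x → P y → P (x * y))
    (hstar : ∀ x, P x → P (star x)) (x : NCTorus θ) : P x := by
  let S := StarAlgebra.adjoin ℂ (Set.range fun k => (productGen θ k : RepProduct θ))
  have hS : ∀ y (hy : y ∈ S), P (⟨y, S.le_topologicalClosure hy⟩ : torusSubalgebra θ) := by
    intro y hy
    induction hy using StarAlgebra.adjoin_induction with
    | mem y hy => obtain ⟨k, rfl⟩ := hy; exact hgen k
    | algebraMap r => exact hscalar r
    | add x y _ _ hx hy => exact hadd _ _ hx hy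
    | mul x y _ _ hx hy => exact hmul _ _ hx hy
    | star x _ hx => exact hstar _ hx
  obtain ⟨v, hv, hlim⟩ := mem_closure_iff_seq_limit.1 x.2
  have hlim' : Tendsto (fun n => (⟨v n, S.le_topologicalClosure (hv n)⟩ : torusSubalgebra θ))
      atTop (𝓝 (x : torusSubalgebra θ)) := tendsto_subtype_rng.2 hlim
  exact hclosed.mem_of_tendsto hlim' (Eventually.of_forall fun n => hS _ (hv n))

/-- The universal property of `A_θ`. -/
theorem exists_unique_hom (B : Type) [CStarAlgebra B] (V : Fin d → unitary B) (hV : TorusRelation θ V) :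
    ∃! φ : NCTorus θ →⋆ₐ[ℂ] B, ∀ k, φ (generator θ k) = V k := by
  have huniq : ∀ φ ψ : NCTorus θ →⋆ₐ[ℂ] B, (∀ k, φ (generator θ k) = V k) → (∀ k, ψ (generator θ k) = V k) →
      φ = ψ := by
    intro φ ψ hφ hψ
    ext x
    have hc : ∀ φ : NCTorus θ →⋆ₐ[ℂ] B, Continuous φ := fun φ =>
      AddMonoidHomClass.continuous_of_bound φ 1 fun x => by
        simpa using NonUnitalStarAlgHom.norm_apply_le φ x
    refine induction_on θ (P := fun x => φ x = ψ x) (isClosed_eq (hc φ) (hc ψ))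
      (fun k => (hφ k).trans (hψ k).symm) (fun c => ?_) (fun x y hx hy => ?_)
      (fun x y hx hy => ?_) (fun x hx => ?_) x
    · rw [AlgHomClass.commutes, AlgHomClass.commutes]
    · rw [map_add, map_add, hx, hy]
    · rw [map_mul, map_mul, hx, hy]
    · rw [map_star, map_star, hx]
  rcases subsingleton_or_nontrivial B with _ | _
  · refine ⟨⟨⟨⟨⟨⟨fun _ => 0, Subsingleton.elim _ _⟩, fun _ _ => Subsingleton.elim _ _⟩,
      Subsingleton.elim _ _, fun _ _ => Subsingleton.elim _ _⟩, fun _ => Subsingleton.elim _ _⟩,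
      fun _ => Subsingleton.elim _ _⟩, fun _ => Subsingleton.elim _ _,
      fun ψ _ => StarAlgHom.ext fun _ => Subsingleton.elim _ _⟩
  · exact ⟨evalHom θ ⟨B, V, hV⟩, fun k => rfl, fun ψ hψ => huniq _ _ hψ fun k => rfl⟩

/-! The regular representation, on `ℓ²(ℤ^d)`, and the trace. -/

/-- The Hilbert space `ℓ²(ℤ^d)`. -/
abbrev L2 (d : ℕ) : Type := lp (fun _ : Fin d → ℤ => ℂ) 2

theorem memℓp_shift (f : L2 d) (c : (Fin d → ℤ) → Circle) (e : Fin d → ℤ) :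
    Memℓp (fun n : Fin d → ℤ => (c n : ℂ) * f (n - e)) 2 := by
  have h2 : 0 < (2 : ℝ≥0∞).toReal := by norm_num
  refine memℓp_gen ?_
  have h := (lp.memℓp f).summable h2
  simp only [norm_mul, Circle.norm_coe, one_mul]
  exact (Equiv.subRight e).summable_iff.2 h

theorem norm_shift (f : L2 d) (c : (Fin d → ℤ) → Circle) (e : Fin d → ℤ) :
    ‖(⟨_, memℓp_shift f c e⟩ : L2 d)‖ = ‖f‖ := by
  have h2 : 0 < (2 : ℝ≥0∞).toReal := by norm_num
  rw [lp.norm_eq_tsum_rpow h2, lp.norm_eq_tsum_rpow h2]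
  simp only [norm_mul, Circle.norm_coe, one_mul]
  congr 1
  exact (Equiv.subRight e).tsum_eq (fun n => ‖f n‖ ^ (2 : ℝ≥0∞).toReal)

/-- The unitary on `ℓ²(ℤ^d)` which maps the basis vector at `n` to `c n` times that at `n + e`. -/
def weightedShift (c : (Fin d → ℤ) → Circle) (e : Fin d → ℤ) : L2 d ≃ₗᵢ[ℂ] L2 d where
  toFun f := ⟨_, memℓp_shift f (fun n => c (n - e)) e⟩
  invFun f := ⟨_, memℓp_shift f (fun n => (c n)⁻¹) (-e)⟩
  map_add' f g := lp.ext (funext fun n => mul_add _ _ _)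
  map_smul' r f := lp.ext (funext fun n => mul_left_comm _ _ _)
  left_inv f := lp.ext (funext fun n => by
    change ((c n)⁻¹ : ℂ) * ((c (n - -e - e) : ℂ) * f (n - -e - e)) = f n
    rw [sub_neg_eq_add, add_sub_cancel_right, inv_mul_cancel_left₀ (Circle.coe_ne_zero _)])
  right_inv f := lp.ext (funext fun n => by
    change (c (n - e) : ℂ) * ((c (n - e) : ℂ)⁻¹ * f (n - e - -e)) = f n
    rw [sub_neg_eq_add, sub_add_cancel, mul_inv_cancel_left₀ (Circle.coe_ne_zero _)])
  norm_map' f := norm_shift f _ e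

theorem weightedShift_apply (c : (Fin d → ℤ) → Circle) (e : Fin d → ℤ) (f : L2 d)
    (n : Fin d → ℤ) : weightedShift c e f n = c (n - e) * f (n - e) := rfl

theorem weightedShift_symm_apply (c : (Fin d → ℤ) → Circle) (e : Fin d → ℤ) (f : L2 d)
    (n : Fin d → ℤ) : (weightedShift c e).symm f n = (c n : ℂ)⁻¹ * f (n + e) := by
  change ((c n)⁻¹ : ℂ) * f (n - -e) = _
  rw [sub_neg_eq_add]

/-- The standard basis vectors of `ℓ²(ℤ^d)`. -/
def basisVec (n : Fin d → ℤ) : L2 d := lp.single 2 n 1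

theorem δ_apply (n m : Fin d → ℤ) : basisVec n m = if m = n then (1 : ℂ) else 0 := by
  rw [basisVec, lp.single_apply]
  by_cases h : m = n
  · subst h; simp
  · simp [h]

theorem weightedShift_δ (c : (Fin d → ℤ) → Circle) (e n : Fin d → ℤ) :
    weightedShift c e (basisVec n) = (c n : ℂ) • basisVec (n + e) := by
  refine lp.ext (funext fun m => ?_)
  rw [weightedShift_apply, lp.coeFn_smul, Pi.smul_apply, δ_apply, δ_apply, smul_eq_mul]
  by_cases h : m = n + e
  · subst h; simp
  · rw [if_neg h, if_neg (fun h' => h (by rw [← h']; simp))]; simp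

theorem weightedShift_symm_δ (c : (Fin d → ℤ) → Circle) (e n : Fin d → ℤ) :
    (weightedShift c e).symm (basisVec n) = (c (n - e) : ℂ)⁻¹ • basisVec (n - e) := by
  rw [LinearIsometryEquiv.symm_apply_eq, map_smul, weightedShift_δ, smul_smul, sub_add_cancel,
    inv_mul_cancel₀ (Circle.coe_ne_zero _), one_smul]

theorem inner_δ (n m : Fin d → ℤ) : ⟪basisVec n, basisVec m⟫_ℂ = if n = m then (1 : ℂ) else 0 := by
  rw [basisVec, lp.inner_single_left, δ_apply]; simp

/-- The phase `exp(π i (A n)_k)`. -/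
def phase (A : Matrix (Fin d) (Fin d) ℝ) (k : Fin d) (n : Fin d → ℤ) : Circle :=
  Circle.exp (Real.pi * ∑ j, A k j * n j)

theorem phase_add_single (A : Matrix (Fin d) (Fin d) ℝ) (k j : Fin d) (n : Fin d → ℤ) :
    phase A k (n + Pi.single j 1) = phase A k n * Circle.exp (Real.pi * A k j) := by
  rw [phase, phase, ← Circle.exp_add, ← mul_add]
  congr 2
  simp only [Pi.add_apply, Int.cast_add, mul_add, Finset.sum_add_distrib]
  congr 1
  rw [Finset.sum_eq_single j]
  · simp
  · intro b _ hb; simp [hb]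
  · simp

/-- The twisted translation in the `k`-th direction. -/
def twistedShift (A : Matrix (Fin d) (Fin d) ℝ) (k : Fin d) : L2 d ≃ₗᵢ[ℂ] L2 d :=
  weightedShift (phase A k) (Pi.single k 1)

theorem twistedShift_comp_apply (A B : Matrix (Fin d) (Fin d) ℝ) (k j : Fin d) (f : L2 d)
    (n : Fin d → ℤ) : twistedShift A k (twistedShift B j f) (n + Pi.single k 1 + Pi.single j 1) =
      phase A k n * phase B j n * Circle.exp (Real.pi * A k j) * f n := by
  have e1 : n + Pi.single k 1 + Pi.single j 1 - Pi.single k 1 = n + Pi.single j (1 : ℤ) := by abel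
  rw [twistedShift, twistedShift, weightedShift_apply, weightedShift_apply, e1,
    add_sub_cancel_right, phase_add_single]
  push_cast
  ring

/-- The unitaries of the regular representation. -/
def regUnitary (k : Fin d) : unitary (L2 d →L[ℂ] L2 d) :=
  Unitary.linearIsometryEquiv.symm (twistedShift θ.1 k)

theorem SkewMatrix.swap (k j : Fin d) : θ.1 j k = -θ.1 k j := by
  have := congrFun (congrFun θ.2 k) j
  simpa using this

theorem lp_ext_add {f g : L2 d} (e : Fin d → ℤ) (h : ∀ n, f (n + e) = g (n + e)) : f = g :=
  lp.ext (funext fun n => by simpa using h (n - e))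

theorem regUnitary_relation : TorusRelation θ (regUnitary θ) := by
  intro k j
  refine ContinuousLinearMap.ext fun f => ?_
  change twistedShift θ.1 k (twistedShift θ.1 j f) = Complex.exp _ •
    twistedShift θ.1 j (twistedShift θ.1 k f)
  refine lp_ext_add (Pi.single k 1 + Pi.single j 1) fun n => ?_
  rw [lp.coeFn_smul, Pi.smul_apply, ← add_assoc, twistedShift_comp_apply,
    add_right_comm, twistedShift_comp_apply, smul_eq_mul, θ.swap k j, Circle.coe_exp,
    Circle.coe_exp]
  have : Complex.exp (2 * Real.pi * Complex.I * (θ.1 k j : ℂ)) *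
      Complex.exp (((Real.pi * -θ.1 k j : ℝ) : ℂ) * Complex.I) =
      Complex.exp (((Real.pi * θ.1 k j : ℝ) : ℂ) * Complex.I) := by
    rw [← Complex.exp_add]; congr 1; push_cast; ring
  rw [← this]; ring

instance : Nontrivial (L2 d →L[ℂ] L2 d) := by
  have : Nontrivial (L2 d) := ⟨basisVec 0, 0, fun h => by
    have := inner_δ (d := d) 0 0
    rw [h] at this; simp at this⟩
  infer_instance

/-- The regular representation, as a realisation of the relation. -/
def regRep : TorusRep θ := ⟨L2 d →L[ℂ] L2 d, regUnitary θ, regUnitary_relation θ⟩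

/-- The regular representation of `A_θ`. -/
def regHom : NCTorus θ →⋆ₐ[ℂ] (L2 d →L[ℂ] L2 d) := evalHom θ (regRep θ)

theorem regHom_gen (k : Fin d) (f : L2 d) : regHom θ (generator θ k) f = twistedShift θ.1 k f := rfl

theorem continuous_regHom : Continuous (regHom θ) :=
  AddMonoidHomClass.continuous_of_bound (regHom θ) 1 fun x => by
    simpa using NonUnitalStarAlgHom.norm_apply_le (regHom θ) x

/-- The translations twisted by `-θ` commute with the regular representation. -/
theorem commute_right (k : Fin d) (x : NCTorus θ) :
    Commute (regHom θ x) ((Unitary.linearIsometryEquiv.symm (twistedShift (-θ.1) k) :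
      unitary (L2 d →L[ℂ] L2 d)) : L2 d →L[ℂ] L2 d) := by
  set R := (Unitary.linearIsometryEquiv.symm (twistedShift (-θ.1) k) :
      unitary (L2 d →L[ℂ] L2 d)) with hR
  refine induction_on θ (P := fun x => Commute (regHom θ x) R)
    (isClosed_eq ((continuous_regHom θ).mul continuous_const)
      (continuous_const.mul (continuous_regHom θ))) (fun j => ?_) (fun c => ?_)
    (fun x y hx hy => ?_) (fun x y hx hy => ?_) (fun x hx => ?_) x
  · refine ContinuousLinearMap.ext fun f => ?_
    change twistedShift θ.1 j (twistedShift (-θ.1) k f) =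
      twistedShift (-θ.1) k (twistedShift θ.1 j f)
    refine lp_ext_add (Pi.single j 1 + Pi.single k 1) fun n => ?_
    rw [← add_assoc, twistedShift_comp_apply, add_right_comm, twistedShift_comp_apply,
      Matrix.neg_apply, θ.swap j k, neg_neg]
    ring
  · rw [AlgHomClass.commutes]; exact Algebra.commutes _ _
  · rw [map_add]; exact hx.add_left hy
  · rw [map_mul]; exact hx.mul_left hy
  · rw [map_star]
    have h := hx.star_star
    have h1 : Commute (star (regHom θ x)) ((star R : unitary (L2 d →L[ℂ] L2 d)) : _) := h
    have h2 := (Commute.units_inv_right_iff (u := Unitary.toUnits R)).1 h1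
    exact h2

theorem reg_trace_gen (k : Fin d) (y : NCTorus θ) :
    ⟪basisVec 0, regHom θ (generator θ k * y) (basisVec 0)⟫_ℂ = ⟪basisVec 0, regHom θ (y * generator θ k) (basisVec 0)⟫_ℂ := by
  have hp : ∀ (A : Matrix (Fin d) (Fin d) ℝ), phase A k 0 = 1 := fun A => by simp [phase]
  have hz : θ.1 k k = 0 := by have := θ.swap k k; linarith
  have hp' : ∀ (A : Matrix (Fin d) (Fin d) ℝ), A k k = 0 → phase A k (0 - Pi.single k 1) = 1 := by
    intro A hA
    rw [phase, Finset.sum_eq_zero, mul_zero, Circle.exp_zero]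
    intro j _
    by_cases h : j = k
    · subst h; rw [hA, zero_mul]
    · simp [h]
  have h1 : twistedShift θ.1 k (basisVec 0) = twistedShift (-θ.1) k (basisVec 0) := by
    rw [twistedShift, twistedShift, weightedShift_δ, weightedShift_δ, hp, hp]
  have h2 : (twistedShift θ.1 k).symm (basisVec 0) = (twistedShift (-θ.1) k).symm (basisVec 0) := by
    rw [twistedShift, twistedShift, weightedShift_symm_δ, weightedShift_symm_δ, hp' _ hz,
      hp' _ (by simp [hz])]
  have hsym : ∀ (W : L2 d ≃ₗᵢ[ℂ] L2 d) (f g : L2 d), ⟪f, W g⟫_ℂ = ⟪W.symm f, g⟫_ℂ := by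
    intro W f g
    rw [← W.inner_map_map (W.symm f) g, W.apply_symm_apply]
  rw [map_mul, map_mul, mul_apply_eq_comp, mul_apply_eq_comp, regHom_gen, regHom_gen, hsym, h2,
    ← hsym, h1]
  exact congrArg (fun T : L2 d →L[ℂ] L2 d => ⟪basisVec 0, T (basisVec 0)⟫_ℂ) (commute_right θ k y).symm.eq

/-- The canonical tracial state `τ` of `A_θ`, the continuous extension of
`∑ α_m U^m ↦ α_0` (see `trace_monomial`). -/
def canonicalTrace : TracialState (NCTorus θ) where
  toPos := PositiveLinearMap.mk₀
    { toFun := fun x => ⟪basisVec 0, regHom θ x (basisVec 0)⟫_ℂ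
      map_add' := fun x y => by
        rw [map_add, add_apply, inner_add_right]
      map_smul' := fun c x => by
        rw [map_smul, smul_apply, inner_smul_right]; rfl }
    (fun x hx => by
      obtain ⟨y, rfl⟩ := CStarAlgebra.nonneg_iff_eq_star_mul_self.1 hx
      change 0 ≤ ⟪basisVec 0, regHom θ (star y * y) (basisVec 0)⟫_ℂ
      rw [map_mul, map_star, mul_apply_eq_comp, ContinuousLinearMap.star_eq_adjoint,
        ContinuousLinearMap.adjoint_inner_right, inner_self_eq_norm_sq_to_K]
      have h := sq_nonneg ‖regHom θ y (basisVec 0)‖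
      rw [← RCLike.ofReal_pow]
      exact Complex.zero_le_real.2 h)
  map_one := by
    change ⟪basisVec 0, regHom θ 1 (basisVec 0)⟫_ℂ = 1
    rw [map_one, one_apply_eq_self, inner_δ, if_pos rfl]
  tracial := fun x y => by
    change ⟪basisVec 0, regHom θ (x * y) (basisVec 0)⟫_ℂ = ⟪basisVec 0, regHom θ (y * x) (basisVec 0)⟫_ℂ
    have hc : Continuous fun x : NCTorus θ => ⟪basisVec 0, regHom θ x (basisVec 0)⟫_ℂ :=
      Continuous.inner continuous_const ((continuous_regHom θ).clm_apply continuous_const)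
    refine induction_on θ (P := fun x => ∀ y, ⟪basisVec 0, regHom θ (x * y) (basisVec 0)⟫_ℂ =
      ⟪basisVec 0, regHom θ (y * x) (basisVec 0)⟫_ℂ) ?_ (reg_trace_gen θ) (fun c y => ?_)
      (fun a b ha hb y => ?_) (fun a b ha hb y => ?_) (fun a ha y => ?_) x y
    · rw [Set.ofPred_forall]
      exact isClosed_iInter fun y => isClosed_eq (hc.comp (continuous_id.mul continuous_const))
        (hc.comp (continuous_const.mul continuous_id))
    · rw [Algebra.commutes]
    · rw [add_mul, mul_add, map_add, map_add, add_apply, add_apply, inner_add_right,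
        inner_add_right, ha, hb]
    · rw [mul_assoc, ha, mul_assoc, hb, mul_assoc]
    · have hstar : ∀ z : NCTorus θ, ⟪basisVec 0, regHom θ (star z) (basisVec 0)⟫_ℂ =
          star ⟪basisVec 0, regHom θ z (basisVec 0)⟫_ℂ := by
        intro z
        rw [map_star, ContinuousLinearMap.star_eq_adjoint,
          ContinuousLinearMap.adjoint_inner_right]
        exact (inner_conj_symm _ _).symm
      have h := hstar (a * star y)
      rw [star_mul, star_star] at h
      have h' := hstar (star y * a)
      rw [star_mul, star_star] at h'
      rw [h', h, ha]

/-- The monomial `U^m = U_1^{m_1} ⋯ U_d^{m_d}` for `m ∈ ℤ^d`. -/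
def monomial (m : Fin d → ℤ) : unitary (NCTorus θ) := (List.ofFn fun k => generator θ k ^ m k).prod

/-- The action of the unitaries of `A_θ` on `ℓ²(ℤ^d)`. -/
def regAction : unitary (NCTorus θ) →* (L2 d ≃ₗᵢ[ℂ] L2 d) :=
  Unitary.linearIsometryEquiv.toMonoidHom.comp (Unitary.map (.ofClass (regHom θ))).toMonoidHom

theorem regAction_apply (u : unitary (NCTorus θ)) (f : L2 d) :
    regAction θ u f = regHom θ u f := rfl

theorem regAction_gen (k : Fin d) : regAction θ (generator θ k) = twistedShift θ.1 k :=
  LinearIsometryEquiv.ext fun _ => rfl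

theorem isometry_mul_apply (S T : L2 d ≃ₗᵢ[ℂ] L2 d) (f : L2 d) : (S * T) f = S (T f) := rfl

theorem regAction_gen_zpow (k : Fin d) (z : ℤ) (n : Fin d → ℤ) :
    ∃ c : ℂ, regAction θ (generator θ k ^ z) (basisVec n) = c • basisVec (n + Pi.single k z) := by
  rw [map_zpow, regAction_gen]
  induction z generalizing n with
  | zero => exact ⟨1, by simp⟩
  | succ z ih =>
    obtain ⟨c, hc⟩ := ih (n + Pi.single k 1)
    refine ⟨(phase θ.1 k n : ℂ) * c, ?_⟩
    rw [zpow_add_one, isometry_mul_apply, twistedShift, weightedShift_δ, map_smul,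
      ← twistedShift, hc, smul_smul, add_assoc, ← Pi.single_add, add_comm (1 : ℤ)]
  | pred z ih =>
    obtain ⟨c, hc⟩ := ih (n - Pi.single k 1)
    refine ⟨(phase θ.1 k (n - Pi.single k 1) : ℂ)⁻¹ * c, ?_⟩
    rw [zpow_sub_one, isometry_mul_apply]
    change (twistedShift θ.1 k ^ (-(z : ℤ))) ((twistedShift θ.1 k).symm (basisVec n)) = _
    rw [twistedShift, weightedShift_symm_δ, map_smul, ← twistedShift, hc, smul_smul,
      sub_eq_add_neg, add_assoc, ← Pi.single_neg, ← Pi.single_add, neg_add_eq_sub]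

theorem regAction_monomial (m n : Fin d → ℤ) :
    ∃ c : ℂ, regAction θ (monomial θ m) (basisVec n) = c • basisVec (n + m) := by
  have key : ∀ (L : List (Fin d)) (n : Fin d → ℤ), ∃ c : ℂ,
      regAction θ (L.map fun k => generator θ k ^ m k).prod (basisVec n) =
        c • basisVec (n + (L.map fun k => Pi.single k (m k)).sum) := by
    intro L
    induction L with
    | nil => intro n; exact ⟨1, by simp⟩
    | cons k L ih =>
      intro n
      obtain ⟨c, hc⟩ := ih n
      obtain ⟨c', hc'⟩ := regAction_gen_zpow θ k (m k)
        (n + (L.map fun k => Pi.single k (m k)).sum)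
      refine ⟨c * c', ?_⟩
      rw [List.map_cons, List.prod_cons, map_mul, isometry_mul_apply, hc, map_smul,
        hc', smul_smul, List.map_cons, List.sum_cons, add_assoc, add_comm (List.sum _)]
  obtain ⟨c, hc⟩ := key (List.finRange d) n
  refine ⟨c, ?_⟩
  rw [monomial, List.ofFn_eq_map, hc, ← List.ofFn_eq_map, List.sum_ofFn, Finset.univ_sum_single]

/-- The trace of `∑ α_m U^m` is `α_0`. -/
theorem trace_monomial (m : Fin d → ℤ) :
    (canonicalTrace θ).toPos (monomial θ m : NCTorus θ) = if m = 0 then 1 else 0 := by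
  by_cases h : m = 0
  · subst h
    have : monomial θ 0 = 1 := by
      rw [monomial]; exact List.prod_eq_one (by simp)
    rw [this, if_pos rfl]
    exact (canonicalTrace θ).map_one
  · obtain ⟨c, hc⟩ := regAction_monomial θ m 0
    change ⟪basisVec 0, regHom θ (monomial θ m : NCTorus θ) (basisVec 0)⟫_ℂ = _
    rw [← regAction_apply, hc, inner_smul_right, inner_δ, zero_add, if_neg (Ne.symm h), if_neg h,
      mul_zero]

end Torus

section Means

variable {d : ℕ} {E : Type*} [NormedAddCommGroup E] [NormedSpace ℂ E]

/-- The square Fejér mean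
`∑_{|m|_∞ ≤ N} (1 - |m_1|/(N+1)) ⋯ (1 - |m_d|/(N+1)) c_m u_m`. Here, as below, `u_m` stands for the
monomial `U^m` and `c_m` for the Fourier coefficient. -/
def fejerMean (u : (Fin d → ℤ) → E) (c : (Fin d → ℤ) → ℂ) (N : ℕ) : E :=
  ∑ m ∈ Fintype.piFinset fun _ : Fin d => Finset.Icc (-(N : ℤ)) N,
    (((∏ j, (1 - |(m j : ℝ)| / (N + 1)) : ℝ) : ℂ) * c m) • u m

/-- A lattice point as a point of `ℝ^d` with the Euclidean norm. -/
def latticePoint (m : Fin d → ℤ) : EuclideanSpace ℝ (Fin d) :=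
  WithLp.toLp 2 fun j => (m j : ℝ)

/-- The terms `c_m r^{|m|_1} u_m` of the square Poisson mean. -/
def squarePoissonTerm (u : (Fin d → ℤ) → E) (c : (Fin d → ℤ) → ℂ) (r : ℝ) (m : Fin d → ℤ) : E :=
  (c m * ((r ^ ∑ j, (m j).natAbs : ℝ) : ℂ)) • u m

/-- The terms `c_m r^{|m|_2} u_m` of the circular Poisson mean. -/
def circularPoissonTerm (u : (Fin d → ℤ) → E) (c : (Fin d → ℤ) → ℂ) (r : ℝ) (m : Fin d → ℤ) : E :=
  (c m * ((r ^ ‖latticePoint m‖ : ℝ) : ℂ)) • u m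

/-- The terms `Φ(ε m) c_m u_m` of the mean `Φ^ε`. -/
def dilatedTerm (Φ : EuclideanSpace ℝ (Fin d) → ℂ) (u : (Fin d → ℤ) → E)
    (c : (Fin d → ℤ) → ℂ) (ε : ℝ) (m : Fin d → ℤ) : E :=
  (Φ (ε • latticePoint m) * c m) • u m

/-- The condition on `Φ`: it is continuous with `Φ 0 = 1`, it is the Fourier transform
`Φ(s) = ∫ φ(t) exp(-2 π i ⟨t, s⟩) dt` of a function `φ` of integral `1`, and
`|Φ(s)| + |φ(s)| ≤ A (1 + |s|)^{-d-δ}` for some `A, δ > 0` and all `s`. -/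
structure IsSummationFunction (Φ : EuclideanSpace ℝ (Fin d) → ℂ) : Prop where
  continuous : Continuous Φ
  map_zero : Φ 0 = 1
  exists_kernel : ∃ φ : EuclideanSpace ℝ (Fin d) → ℂ,
    Φ = FourierTransform.fourier φ ∧ ∫ s, φ s = 1 ∧
      ∃ A > 0, ∃ δ > 0, ∀ s, ‖Φ s‖ + ‖φ s‖ ≤ A * (1 + ‖s‖) ^ (-(d : ℝ) - δ)

end Means

section QLp
variable {d : ℕ} (θ : SkewMatrix d) (p : ℝ) [Fact (1 ≤ p)]

/-- The quantum torus `𝕋^d_θ`: the von Neumann algebra of `A_θ` in the GNS representation of `τ`. -/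
abbrev QTorus : Type 1 := GNSvN (canonicalTrace θ)

/-- The space `L_p(𝕋^d_θ)`. -/
abbrev QLp : Type 1 := NCLp (M := QTorus θ) (vnTrace (canonicalTrace θ)) p

/-- The monomial `U^m` as an element of `L_p(𝕋^d_θ)`. -/
def monomialLp (m : Fin d → ℤ) : QLp θ p :=
  toLp (vnTrace (canonicalTrace θ)) p (gnsHom (canonicalTrace θ) (monomial θ m : NCTorus θ))

/-- The Fourier coefficients `τ((U^m)* x)` of `x ∈ L_p(𝕋^d_θ)`. -/
def coeffLp (x : QLp θ p) (m : Fin d → ℤ) : ℂ :=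
  lpPairing (vnTrace (canonicalTrace θ)) p (gnsHom (canonicalTrace θ) (monomial θ m : NCTorus θ)) x

/-- The Fourier coefficients `τ((U^m)* x)` of `x ∈ A_θ`. -/
def coeffAlg (x : NCTorus θ) (m : Fin d → ℤ) : ℂ :=
  (canonicalTrace θ).toPos (star (monomial θ m : NCTorus θ) * x)

end QLp

end QuantumTorus

end

open Filter Topology QuantumTorus

/-! All the means are Fourier multipliers `u_m ↦ M_m u_m`, and only a few properties of the
monomials matter: dense span, bounded biorthogonal coefficients, and the isometric action `u_m ↦ exp
(i⟨t, m⟩) u_m` of the torus on the span. These are collected in `FourierSystem`. For summable `M`,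
the series converges absolutely, and a bound on the span extends by density. If the multipliers are
moreover uniformly bounded and tend to `1` for each `m`, the means converge on polynomials and hence
everywhere (`tendsto_multiplier`). What remains is to bound each family of multipliers and to
exhibit the two Fourier systems.

The bounds follow from the contractivity of characters, because contractive multipliers are stable
under products, convex combinations and pointwise limits. The Fejér multipliers are limits of convex
combinations of characters, with the Fejér kernel sampled at roots of unity as weights
(`fejer_coord_bound`). Cosines are averages of characters, and Gaussians are limits of `exp (-k (1 -
cos))` (`gaussian_coord_bound`). Poisson multipliers arise from Gaussians by subordination, which
rests on the contractivity of `1 - √(1 - M)` (`exp_neg_sqrt`, `sub_sqrt`). The multipliers `Φ(εm)`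
are integrals of characters against `φ`, so their bound is the `L¹` norm of `φ` for every `ε`
(`dilated_bound`).

In `A_θ` the torus acts by star homomorphisms, which are contractive. They preserve the trace, hence
also the `p`-norms, and this gives the action needed in `L_p`. Density of the polynomials in `L_p`
requires `A_θ` to be dense there: by a form of Kaplansky's theorem every element of the von Neumann
algebra is a 2-norm limit of a bounded sequence from `A_θ`, and on bounded sets the 2-norm controls
the `p`-norm (`boundedlyApprox`, `pNorm_le_of_norm_le`). -/

noncomputable section

namespace QuantumTorus

open scoped ComplexOrder InnerProductSpace ENNReal
open Filter Topology

/-! ### Calculus of bounded multipliers: products, sums, limits and subordination. -/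

section Multiplier

variable {ι E : Type*} [NormedAddCommGroup E] [NormedSpace ℂ E] {u : ι → E}

/-- The multiplier `u_m ↦ M_m u_m` has norm at most `C` on the span of the `u_m`. -/
def MultiplierBound (u : ι → E) (C : ℝ) (M : ι → ℂ) : Prop :=
  ∀ (s : Finset ι) (a : ι → ℂ), ‖∑ m ∈ s, (M m * a m) • u m‖ ≤ C * ‖∑ m ∈ s, a m • u m‖

namespace MultiplierBound

theorem mul {C₁ C₂ : ℝ} {M₁ M₂ : ι → ℂ} (h₁ : MultiplierBound u C₁ M₁)
    (h₂ : MultiplierBound u C₂ M₂) (hC : 0 ≤ C₁) :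
    MultiplierBound u (C₁ * C₂) fun m => M₁ m * M₂ m := fun s a => by
  have := h₁ s fun m => M₂ m * a m
  simp only [mul_assoc] at this ⊢
  exact this.trans (mul_le_mul_of_nonneg_left (h₂ s a) hC)

theorem add {C₁ C₂ : ℝ} {M₁ M₂ : ι → ℂ} (h₁ : MultiplierBound u C₁ M₁)
    (h₂ : MultiplierBound u C₂ M₂) : MultiplierBound u (C₁ + C₂) fun m => M₁ m + M₂ m :=
  fun s a => by
    simp only [add_mul, add_smul, Finset.sum_add_distrib]
    exact (norm_add_le _ _).trans (add_le_add (h₁ s a) (h₂ s a))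

theorem const_mul {C : ℝ} {M : ι → ℂ} (h : MultiplierBound u C M) (c : ℂ) :
    MultiplierBound u (‖c‖ * C) fun m => c * M m := fun s a => by
  simp only [mul_assoc, mul_smul c, ← Finset.smul_sum, norm_smul]
  exact mul_le_mul_of_nonneg_left (h s a) (norm_nonneg c)

theorem one : MultiplierBound u 1 fun _ => 1 := fun s a => by simp

theorem zero : MultiplierBound u 0 fun _ => 0 := fun s a => by simp

theorem mono {C C' : ℝ} {M : ι → ℂ} (h : MultiplierBound u C M) (hC : C ≤ C') :
    MultiplierBound u C' M := fun s a =>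
  (h s a).trans (mul_le_mul_of_nonneg_right hC (norm_nonneg _))

theorem sum {κ : Type*} (t : Finset κ) {C : κ → ℝ} {M : κ → ι → ℂ}
    (h : ∀ k ∈ t, MultiplierBound u (C k) (M k)) :
    MultiplierBound u (∑ k ∈ t, C k) fun m => ∑ k ∈ t, M k m := by
  classical
  induction t using Finset.induction_on with
  | empty => simpa using zero
  | insert k t hk ih =>
    simp only [Finset.sum_insert hk]
    exact (h k (by simp)).add (ih fun j hj => h j (by simp [hj]))

theorem prod {κ : Type*} (t : Finset κ) {M : κ → ι → ℂ}
    (h : ∀ k ∈ t, MultiplierBound u 1 (M k)) :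
    MultiplierBound u 1 fun m => ∏ k ∈ t, M k m := by
  classical
  induction t using Finset.induction_on with
  | empty => simpa using one
  | insert k t hk ih =>
    simp only [Finset.prod_insert hk]
    simpa using (h k (by simp)).mul (ih fun j hj => h j (by simp [hj])) zero_le_one

theorem pow {M : ι → ℂ} (h : MultiplierBound u 1 M) (n : ℕ) :
    MultiplierBound u 1 fun m => M m ^ n := by
  simpa using prod (Finset.range n) (M := fun _ => M) fun _ _ => h

/-- The bound is a family of inequalities about finite sums, so convergence at each index suffices
and no uniformity is needed. -/
theorem of_tendsto {κ : Type*} {l : Filter κ} [l.NeBot] {C : ℝ} {M : κ → ι → ℂ} {M' : ι → ℂ}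
    (h : ∀ᶠ k in l, MultiplierBound u C (M k))
    (hM : ∀ m, Tendsto (fun k => M k m) l (𝓝 (M' m))) : MultiplierBound u C M' := fun s a =>
  le_of_tendsto (tendsto_finsetSum s fun m _ => ((hM m).mul_const (a m)).smul_const (u m)).norm
    (h.mono fun _ hk => hk s a)

/-- If `M` is contractive, then so is `exp (-k (1 - M))`. -/
theorem exp_neg {M : ι → ℝ} (h : MultiplierBound u 1 fun m => (M m : ℂ)) {k : ℝ} (hk : 0 ≤ k) :
    MultiplierBound u 1 fun m => ((Real.exp (-(k * (1 - M m))) : ℝ) : ℂ) := by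
  -- The exponential is the limit of `(1 - k (1 - M) / n) ^ n`, whose base is the convex combination
  -- `(1 - k/n) + (k/n) M` as soon as `n ≥ k`. The `+ 1` in the threshold keeps `n` positive when `k
  -- = 0`.
  refine of_tendsto (l := atTop) (M := fun (n : ℕ) m =>
    (((1 + -(k * (1 - M m)) / n) ^ n : ℝ) : ℂ)) ?_ fun m => ?_
  · filter_upwards [eventually_ge_atTop (⌈k⌉₊ + 1)] with n hn
    have hn0 : (0 : ℝ) < n := by exact_mod_cast (by omega : 0 < n)
    have hkn : k ≤ n := (Nat.le_ceil k).trans (by exact_mod_cast (by omega : ⌈k⌉₊ ≤ n))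
    have h1 : k / n ≤ 1 := (div_le_one hn0).2 hkn
    have hb := ((one (u := u)).const_mul ((1 - k / n : ℝ) : ℂ)).add (h.const_mul ((k / n : ℝ) : ℂ))
    rw [Complex.norm_real, Complex.norm_real, Real.norm_of_nonneg (by linarith),
      Real.norm_of_nonneg (by positivity)] at hb
    have hb' := (hb.mono (C' := 1) (by linarith)).pow n
    convert hb' using 2 with m
    push_cast
    ring
  · exact (Complex.continuous_ofReal.tendsto _).comp (Real.tendsto_one_add_div_pow_exp _)

/-- The iteration `y ↦ (z + y²) / 2`, which increases from `0` to `1 - √(1 - z)`. -/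
def sqrtIter (z : ℝ) : ℕ → ℝ
  | 0 => 0
  | n + 1 => (z + sqrtIter z n ^ 2) / 2

/-- The number `1 - √(1 - z)` is a fixed point of `y ↦ (z + y²) / 2`, and this map is increasing for
`y ≥ 0`. So the iteration from `0` increases and never passes the fixed point. -/
theorem sqrtIter_mem {z : ℝ} (hz : z ∈ Set.Icc (0 : ℝ) 1) (n : ℕ) :
    0 ≤ sqrtIter z n ∧ sqrtIter z n ≤ 1 - √(1 - z) ∧ sqrtIter z n ≤ sqrtIter z (n + 1) := by
  have hs := Real.sq_sqrt (sub_nonneg.2 hz.2)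
  have hs0 := Real.sqrt_nonneg (1 - z)
  have hs1 : √(1 - z) ≤ 1 := Real.sqrt_le_one.2 (by linarith [hz.1])
  induction n with
  | zero => simp only [sqrtIter]; exact ⟨le_rfl, by linarith, by linarith [hz.1]⟩
  | succ n ih =>
    obtain ⟨h1, h2, h3⟩ := ih
    have h4 : sqrtIter z (n + 1) ≤ 1 - √(1 - z) := by simp only [sqrtIter]; nlinarith
    refine ⟨h1.trans h3, h4, ?_⟩
    change (z + sqrtIter z n ^ 2) / 2 ≤ (z + sqrtIter z (n + 1) ^ 2) / 2
    nlinarith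

theorem tendsto_sqrtIter {z : ℝ} (hz : z ∈ Set.Icc (0 : ℝ) 1) :
    Tendsto (sqrtIter z) atTop (𝓝 (1 - √(1 - z))) := by
  have hb : ∀ n, sqrtIter z n ≤ 1 - √(1 - z) := fun n => (sqrtIter_mem hz n).2.1
  have hlim := tendsto_atTop_ciSup (monotone_nat_of_le_succ fun n => (sqrtIter_mem hz n).2.2)
    ⟨1 - √(1 - z), by rintro _ ⟨n, rfl⟩; exact hb n⟩
  set y := ⨆ n, sqrtIter z n
  have h1 : Tendsto (fun n => sqrtIter z (n + 1)) atTop (𝓝 ((z + y ^ 2) / 2)) :=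
    ((hlim.pow 2).const_add z).div_const 2
  have h2 := tendsto_nhds_unique h1 (hlim.comp (tendsto_add_atTop_nat 1))
  have hy : y ≤ 1 - √(1 - z) := ciSup_le hb
  have h3 : √(1 - z) = 1 - y := by
    have := Real.sqrt_nonneg (1 - z)
    -- The limit solves `y = (z + y²) / 2`, that is `(1 - y)² = 1 - z`; the bound `y ≤ 1` selects
    -- the root.
    rw [show 1 - z = (1 - y) ^ 2 by linarith, Real.sqrt_sq (by linarith)]
  rw [h3, sub_sub_cancel]
  exact hlim

/-- Each iterate `(M + y²) / 2` is the mean of two contractive multipliers, so contractivity passes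
along the iteration to its limit. This takes the place of the power series of `1 - √(1 - z)`, whose
coefficients are nonnegative with sum `1`. -/
theorem sub_sqrt {M : ι → ℝ} (h : MultiplierBound u 1 fun m => (M m : ℂ))
    (hM : ∀ m, M m ∈ Set.Icc (0 : ℝ) 1) :
    MultiplierBound u 1 fun m => ((1 - √(1 - M m) : ℝ) : ℂ) := by
  refine of_tendsto (l := atTop) (M := fun (n : ℕ) m => ((sqrtIter (M m) n : ℝ) : ℂ))
    (Eventually.of_forall fun n => ?_)
    fun m => (Complex.continuous_ofReal.tendsto _).comp (tendsto_sqrtIter (hM m))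
  induction n with
  | zero => simpa [sqrtIter] using (zero (u := u)).mono zero_le_one
  | succ n ih =>
    have := ((h.add (ih.pow 2)).const_mul (1 / 2)).mono (C' := 1) (by norm_num)
    convert this using 2 with m
    simp only [sqrtIter]
    push_cast
    ring

/-- Subordination: if `exp (-s G)` is contractive for all `s ≥ 0`, then so is `exp (-s √G)`. -/
theorem exp_neg_sqrt {G : ι → ℝ} (hG : ∀ m, 0 ≤ G m)
    (h : ∀ s, 0 ≤ s → MultiplierBound u 1 fun m => ((Real.exp (-(s * G m)) : ℝ) : ℂ))
    {s : ℝ} (hs : 0 ≤ s) :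
    MultiplierBound u 1 fun m => ((Real.exp (-(s * √(G m))) : ℝ) : ℂ) := by
  -- Take `M = exp (-t G)` in `sub_sqrt`. The complement of `1 - √(1 - M)` is `√(1 - M)`, so
  -- `exp_neg` with `k = s / √t` yields this multiplier. As `t → 0⁺`, the quotient under the root
  -- tends to `G`, the derivative of `1 - exp (-t G)` at `0`.
  have key : ∀ t : ℝ, 0 < t → MultiplierBound u 1 fun m =>
      ((Real.exp (-(s * √((1 - Real.exp (-(t * G m))) / t))) : ℝ) : ℂ) := by
    intro t ht
    have h1 := ((h t ht.le).sub_sqrt fun m => ⟨(Real.exp_pos _).le, Real.exp_le_one_iff.2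
      (neg_nonpos.2 (mul_nonneg ht.le (hG m)))⟩).exp_neg (k := s / √t) (by positivity)
    convert h1 using 5 with m
    rw [Real.sqrt_div' _ ht.le]
    ring
  refine of_tendsto (l := 𝓝[>] (0 : ℝ)) (eventually_mem_nhdsWithin.mono key) fun m => ?_
  refine (Complex.continuous_ofReal.tendsto _).comp ((Real.continuous_exp.tendsto _).comp
    (((Real.continuous_sqrt.tendsto _).comp ?_).const_mul s).neg)
  have hd : HasDerivAt (fun t : ℝ => 1 - Real.exp (-(t * G m))) (G m) 0 := by
    have := (((hasDerivAt_id (0 : ℝ)).mul_const (G m)).neg.exp).const_sub 1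
    simpa using this
  have := hd.tendsto_slope_zero_right
  simpa [div_eq_inv_mul] using this

end MultiplierBound

end Multiplier

/-! ### Summability of the multipliers over the lattice. -/

section Lattice

variable {d : ℕ}

theorem norm_latticePoint (m : Fin d → ℤ) : ‖latticePoint m‖ = √(∑ j, (m j : ℝ) ^ 2) := by
  rw [latticePoint, EuclideanSpace.norm_eq]
  simp

theorem summable_norm_latticePoint_rpow {r : ℝ} (hr : r < -d) :
    Summable fun m : Fin d → ℤ => ‖latticePoint m‖ ^ r := by
  let b := (EuclideanSpace.basisFun (Fin d) ℝ).toBasis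
  let L : Submodule ℤ (EuclideanSpace ℝ (Fin d)) := Submodule.span ℤ (Set.range b)
  have hrank : Module.finrank ℤ L = d := by
    rw [ZLattice.rank ℝ L, finrank_euclideanSpace_fin]
  have h := ZLattice.summable_norm_rpow L r (by rwa [hrank])
  have hmem : ∀ m : Fin d → ℤ, latticePoint m ∈ L := fun m => by
    have : latticePoint m = ∑ j, m j • b j := by
      ext k
      simp [latticePoint, b, Finset.sum_apply, Pi.single_apply]
    rw [this]
    exact L.sum_mem fun j _ => L.smul_mem _ (Submodule.subset_span ⟨j, rfl⟩)
  have hinj : Function.Injective fun m : Fin d → ℤ => (⟨latticePoint m, hmem m⟩ : L) := by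
    intro m n hmn
    ext j
    have := congrArg (fun x : EuclideanSpace ℝ (Fin d) => x j) (congrArg Subtype.val hmn)
    simpa [latticePoint] using this
  have h2 := h.comp_injective hinj
  simpa only [Function.comp_def, Submodule.coe_norm] using h2

/-- The Euclidean norm is at most the `ℓ¹` norm; thus for `0 < r < 1` the square Poisson multiplier
is dominated by the circular one. -/
theorem norm_latticePoint_le_sum (m : Fin d → ℤ) :
    ‖latticePoint m‖ ≤ ((∑ j, (m j).natAbs : ℕ) : ℝ) := by
  rw [norm_latticePoint]
  refine Real.sqrt_le_iff.2 ⟨by positivity, ?_⟩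
  push_cast
  refine (Finset.sum_le_sum fun j _ => le_of_eq ?_).trans
    (Finset.sum_sq_le_sq_sum_of_nonneg (f := fun j => ((m j).natAbs : ℝ)) fun j _ => by positivity)
  rw [Nat.cast_natAbs, Int.cast_abs, sq_abs]

theorem summable_of_norm_le_rpow {F : (Fin d → ℤ) → ℂ} {A δ ε : ℝ} (hA : 0 ≤ A) (hδ : 0 < δ) (hε : 0 < ε)
    (h : ∀ m, ‖F m‖ ≤ A * (1 + ‖ε • latticePoint m‖) ^ (-(d : ℝ) - δ)) : Summable F := by
  refine Summable.of_norm_bounded_eventually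
    ((summable_norm_latticePoint_rpow (d := d) (r := -d - δ) (by linarith)).mul_left
      (A * ε ^ (-(d : ℝ) - δ))) ?_
  -- The origin must be left out: there the comparison term is `0` to a negative power, which is `0`
  -- by convention.
  refine (Set.finite_singleton (0 : Fin d → ℤ)).subset fun m hm => ?_
  by_contra hne
  refine hm ?_
  have hpos : 0 < ‖latticePoint m‖ := by
    refine norm_pos_iff.2 fun h0 => hne (funext fun j => ?_)
    have := congrArg (fun x : EuclideanSpace ℝ (Fin d) => x j) h0
    simpa [latticePoint] using this
  rw [Set.mem_ofPred_eq, mul_assoc, ← Real.mul_rpow hε.le hpos.le]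
  refine (h m).trans (mul_le_mul_of_nonneg_left ?_ hA)
  rw [norm_smul, Real.norm_of_nonneg hε.le]
  exact Real.rpow_le_rpow_of_nonpos (by positivity) (by linarith) (by
    have : (0 : ℝ) ≤ d := by positivity
    linarith)

theorem summable_circularPoisson {r : ℝ} (hr : 0 ≤ r) (hr1 : r < 1) :
    Summable fun m : Fin d → ℤ => ((r ^ ‖latticePoint m‖ : ℝ) : ℂ) := by
  -- The maximum keeps `c` positive when `r = 0`, where `Real.log 0 = 0` would give nothing.
  set c : ℝ := -Real.log (max r (1 / 2)) with hc
  have hc0 : 0 < c := neg_pos.2 (Real.log_neg (by positivity) (max_lt hr1 (by norm_num)))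
  -- The constant comes from `x ^ (d + 1) / (d + 1)! ≤ exp x` at `x = c (1 + t)`, which bounds `exp
  -- (-c t)` by a multiple of `(1 + t) ^ (-d - 1)`; so `δ = ε = 1`.
  refine summable_of_norm_le_rpow (A := (d + 1).factorial * Real.exp c / c ^ (d + 1))
    (by positivity) one_pos one_pos fun m => ?_
  rw [Complex.norm_real, Real.norm_of_nonneg (by positivity), one_smul]
  set t := ‖latticePoint m‖
  have ht : 0 ≤ t := norm_nonneg _
  have h1 : r ^ t ≤ Real.exp (-(c * t)) := by
    refine (Real.rpow_le_rpow hr (le_max_left r (1 / 2)) ht).trans (le_of_eq ?_)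
    rw [Real.rpow_def_of_pos (by positivity), hc]
    ring_nf
  have h2 := Real.pow_div_factorial_le_exp (c * (1 + t)) (by positivity) (d + 1)
  have h3 : (1 + t) ^ (-(d : ℝ) - 1) = ((1 + t) ^ (d + 1))⁻¹ := by
    rw [← Real.rpow_natCast, ← Real.rpow_neg (by positivity)]
    congr 1
    push_cast
    ring
  rw [h3]
  refine h1.trans ?_
  rw [mul_pow, mul_add, mul_one, Real.exp_add, div_le_iff₀ (by positivity)] at h2
  rw [Real.exp_neg, ← div_eq_mul_inv, div_div, ← one_div, div_le_div_iff₀ (by positivity)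
    (by positivity)]
  linarith

theorem summable_squarePoisson {r : ℝ} (hr : 0 ≤ r) (hr1 : r < 1) :
    Summable fun m : Fin d → ℤ => ((r ^ ∑ j, (m j).natAbs : ℝ) : ℂ) := by
  refine Summable.of_norm_bounded_eventually (summable_circularPoisson (d := d) hr hr1).norm ?_
  refine (Set.finite_singleton (0 : Fin d → ℤ)).subset fun m hm => ?_
  by_contra hne
  refine hm ?_
  rw [Set.mem_ofPred_eq, Complex.norm_real, Complex.norm_real, Real.norm_of_nonneg (by positivity),
    Real.norm_of_nonneg (by positivity)]
  rcases hr.eq_or_lt with rfl | h0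
  · rw [zero_pow]
    · positivity
    · intro h
      refine hne (funext fun j => ?_)
      simpa using (Finset.sum_eq_zero_iff.1 h) j (Finset.mem_univ j)
  · rw [← Real.rpow_natCast]
    exact Real.rpow_le_rpow_of_exponent_ge h0 hr1.le (norm_latticePoint_le_sum m)

end Lattice

/-! ### Fourier systems: uniform bounds for the means, and the approximation principle. -/

section FourierSystem

variable {d : ℕ} {E : Type*} [NormedAddCommGroup E] [NormedSpace ℂ E]

/-- The character `m ↦ exp (i ⟨t, m⟩)` of `ℤ^d`. -/
def latticeChar (t : Fin d → ℝ) (m : Fin d → ℤ) : ℂ := Complex.exp ((∑ j, t j * m j : ℝ) * Complex.I)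

theorem latticeChar_single (j : Fin d) (t : ℝ) (m : Fin d → ℤ) :
    latticeChar (Pi.single j t) m = Complex.exp ((t * m j : ℝ) * Complex.I) := by
  rw [latticeChar, Finset.sum_eq_single j]
  · simp
  · intro b _ hb; simp [hb]
  · simp

/-- Elements `u_m` with dense span and biorthogonal coefficient functionals `c_m`, for which the
torus acts isometrically on the span by `u_m ↦ exp (i ⟨t, m⟩) u_m`. -/
structure FourierSystem (u : (Fin d → ℤ) → E) (c : (Fin d → ℤ) → E →L[ℂ] ℂ) : Prop where
  norm_le : ∀ m, ‖u m‖ ≤ 1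
  coeff_le : ∀ m x, ‖c m x‖ ≤ ‖x‖
  biorthogonal : ∀ m n, c m (u n) = if m = n then 1 else 0
  dense : Dense (Submodule.span ℂ (Set.range u) : Set E)
  rotation : ∀ t, MultiplierBound u 1 (latticeChar t)

namespace FourierSystem

variable {u : (Fin d → ℤ) → E} {c : (Fin d → ℤ) → E →L[ℂ] ℂ} (h : FourierSystem u c)
include h

theorem cos_bound (j : Fin d) (t : ℝ) :
    MultiplierBound u 1 fun m => ((Real.cos (t * m j) : ℝ) : ℂ) := by
  have := ((h.rotation (Pi.single j t)).add (h.rotation (Pi.single j (-t)))).const_mul (1 / 2)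
  have := this.mono (C' := 1) (by norm_num)
  convert this using 2 with m
  rw [latticeChar_single, latticeChar_single, Complex.ofReal_cos, Complex.cos]
  push_cast
  ring_nf

/-- The heat semigroup is a limit of random walks: `(2 s / t²) (1 - cos (t m_j)) → s m_j²` as `t →
0`, and `exp_neg` applies to the contractive multiplier `cos (t m_j)`. -/
theorem gaussian_coord_bound (j : Fin d) {s : ℝ} (hs : 0 ≤ s) :
    MultiplierBound u 1 fun m => ((Real.exp (-(s * (m j : ℝ) ^ 2)) : ℝ) : ℂ) := by
  refine MultiplierBound.of_tendsto (l := 𝓝[≠] (0 : ℝ)) (M := fun t m =>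
    ((Real.exp (-(2 * s / t ^ 2 * (1 - Real.cos (t * m j)))) : ℝ) : ℂ))
    (Eventually.of_forall fun t => MultiplierBound.exp_neg (M := fun m : Fin d → ℤ => Real.cos (t * m j))
      (h.cos_bound j t) (by positivity)) fun m => ?_
  refine (Complex.continuous_ofReal.tendsto _).comp ((Real.continuous_exp.tendsto _).comp
    (Tendsto.neg ?_))
  -- By `1 - cos x = 2 sin² (x/2)` the exponent is a multiple of a squared `sinc`, which is
  -- continuous through `t = 0`.
  have h1 : Tendsto (fun t : ℝ => s * (m j : ℝ) ^ 2 * Real.sinc (t * m j / 2) ^ 2) (𝓝[≠] 0)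
      (𝓝 (s * (m j : ℝ) ^ 2)) := by
    have : Continuous fun t : ℝ => s * (m j : ℝ) ^ 2 * Real.sinc (t * m j / 2) ^ 2 :=
      continuous_const.mul ((Real.continuous_sinc.comp (by fun_prop)).pow 2)
    simpa using (this.tendsto 0).mono_left nhdsWithin_le_nhds
  refine h1.congr' (eventually_mem_nhdsWithin.mono fun t ht => ?_)
  have ht0 : t ≠ 0 := ht
  have hc : 1 - Real.cos (t * m j) = 2 * Real.sin (t * m j / 2) ^ 2 := by
    have h1 := Real.cos_sq' (t * m j / 2)
    have h2 := Real.cos_two_mul (t * m j / 2)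
    rw [mul_div_cancel₀ _ two_ne_zero] at h2
    linarith
  beta_reduce
  rw [hc]
  by_cases hm : (m j : ℝ) = 0
  · simp [hm]
  · rw [Real.sinc_of_ne_zero (by positivity)]
    field_simp

theorem gaussian_bound {s : ℝ} (hs : 0 ≤ s) :
    MultiplierBound u 1 fun m => ((Real.exp (-(s * ∑ j, (m j : ℝ) ^ 2)) : ℝ) : ℂ) := by
  have := MultiplierBound.prod Finset.univ fun j _ => h.gaussian_coord_bound j hs
  convert this using 2 with m
  rw [Finset.mul_sum, ← Finset.sum_neg_distrib, Real.exp_sum, Complex.ofReal_prod]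

/-- Subordination with `G = |m|_2²` and `s = -log r`, since `r ^ |m|_2 = exp (-s √G)`. -/
theorem circularPoisson_bound {r : ℝ} (hr : 0 < r) (hr1 : r < 1) :
    MultiplierBound u 1 fun m => ((r ^ ‖latticePoint m‖ : ℝ) : ℂ) := by
  have := MultiplierBound.exp_neg_sqrt (fun m => Finset.sum_nonneg fun j _ => sq_nonneg (m j : ℝ))
    (fun s hs => h.gaussian_bound hs) (s := -Real.log r) (by
      have := Real.log_neg hr hr1; linarith)
  convert this using 3 with m
  rw [norm_latticePoint, Real.rpow_def_of_pos hr]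
  ring_nf

/-- The multiplier factors over the coordinates, and each factor is subordinate to the Gaussian with
`G = m_j²`, for which `√G = |m_j|`. -/
theorem squarePoisson_bound {r : ℝ} (hr : 0 < r) (hr1 : r < 1) :
    MultiplierBound u 1 fun m => ((r ^ ∑ j, (m j).natAbs : ℝ) : ℂ) := by
  have := MultiplierBound.prod Finset.univ fun j _ =>
    MultiplierBound.exp_neg_sqrt (u := u) (G := fun m : Fin d → ℤ => (m j : ℝ) ^ 2) (fun m => sq_nonneg (m j : ℝ))
      (fun s hs => h.gaussian_coord_bound j hs) (s := -Real.log r) (by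
        have := Real.log_neg hr hr1; linarith)
  convert this using 2 with m
  rw [← Finset.prod_pow_eq_pow_sum, Complex.ofReal_prod]
  refine Finset.prod_congr rfl fun j _ => ?_
  rw [Real.sqrt_sq_eq_abs, ← Real.rpow_natCast, Real.rpow_def_of_pos hr, Nat.cast_natAbs,
    Int.cast_abs]
  ring_nf

omit h in
-- Orthogonality of characters modulo `L`: the sum is geometric in an `L`-th root of unity, which
-- equals `1` exactly when `L` divides `k`.
theorem sum_exp_eq_ite {L : ℕ} (hL : 0 < L) (k : ℤ) :
    ∑ r ∈ Finset.range L, Complex.exp (2 * Real.pi * Complex.I * (r * k / L)) =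
      if (L : ℤ) ∣ k then (L : ℂ) else 0 := by
  have hL0 : (L : ℂ) ≠ 0 := by exact_mod_cast hL.ne'
  set x := Complex.exp (2 * Real.pi * Complex.I * (k / L)) with hx
  have hpow : ∀ r : ℕ, Complex.exp (2 * Real.pi * Complex.I * (r * k / L)) = x ^ r := fun r => by
    rw [hx, ← Complex.exp_nat_mul]; ring_nf
  simp only [hpow]
  have hxL : x ^ L = 1 := by
    rw [← hpow, mul_div_cancel_left₀ _ hL0, Complex.exp_eq_one_iff]
    exact ⟨k, by ring⟩
  have h2 : (2 * Real.pi * Complex.I : ℂ) ≠ 0 := Complex.two_pi_I_ne_zero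
  have hx1 : x = 1 ↔ (L : ℤ) ∣ k := by
    rw [hx, Complex.exp_eq_one_iff]
    constructor
    · rintro ⟨n, hn⟩
      rw [mul_comm (n : ℂ)] at hn
      have := mul_left_cancel₀ h2 hn
      rw [div_eq_iff hL0] at this
      exact ⟨n, by rw [mul_comm]; exact_mod_cast this⟩
    · rintro ⟨n, rfl⟩
      refine ⟨n, ?_⟩
      push_cast
      field_simp
  split_ifs with hk
  · simp [hx1.2 hk]
  · have := mul_geom_sum x L
    rw [hxL, sub_self] at this
    exact (mul_eq_zero.1 this).resolve_left (sub_ne_zero.2 fun h => hk (hx1.1 h))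

/-- The Dirichlet kernel at the `L`-th roots of unity. -/
def dirichletValue (N L r : ℕ) : ℂ :=
  ∑ a ∈ Finset.range (N + 1), Complex.exp (2 * Real.pi * Complex.I * (r * a / L))

/-- The Fejér kernel at the `L`-th roots of unity, divided by `L`. -/
def fejerWeight (N L r : ℕ) : ℝ := Complex.normSq (dirichletValue N L r) / (L * (N + 1))

omit h in
-- The triangular coefficients of the Fejér kernel, as numbers of pairs with a given difference.
-- Truncated subtraction gives the correct value `0` for `|k| ≥ n`.
theorem card_sub_eq (n : ℕ) (k : ℤ) :
    ∑ a ∈ Finset.range n, ∑ b ∈ Finset.range n, (if (a : ℤ) - b = k then 1 else 0 : ℕ) =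
      n - k.natAbs := by
  rcases le_total 0 k with hk | hk
  · obtain ⟨k, rfl⟩ := Int.eq_ofNat_of_zero_le hk
    rw [Finset.sum_comm]
    have : ∀ b ∈ Finset.range n, ∑ a ∈ Finset.range n, (if (a : ℤ) - b = k then 1 else 0 : ℕ) =
        if b ∈ Finset.range (n - k) then 1 else 0 := fun b _ => by
      have : ∀ a : ℕ, ((a : ℤ) - b = k) ↔ b + k = a := fun a => by omega
      simp only [this, Finset.sum_ite_eq, Finset.mem_range]
      congr 1
      simp only [eq_iff_iff]; omega
    rw [Finset.sum_congr rfl this, Finset.sum_ite_mem,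
      Finset.inter_eq_right.2 (Finset.range_mono (by omega))]
    simp
  · obtain ⟨k, rfl⟩ := Int.exists_eq_neg_ofNat hk
    have : ∀ a ∈ Finset.range n, ∑ b ∈ Finset.range n, (if (a : ℤ) - b = -k then 1 else 0 : ℕ) =
        if a ∈ Finset.range (n - k) then 1 else 0 := fun a _ => by
      have : ∀ b : ℕ, ((a : ℤ) - b = -k) ↔ a + k = b := fun b => by omega
      simp only [this, Finset.sum_ite_eq, Finset.mem_range]
      congr 1
      simp only [eq_iff_iff]; omega
    rw [Finset.sum_congr rfl this, Finset.sum_ite_mem,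
      Finset.inter_eq_right.2 (Finset.range_mono (by omega))]
    simp

omit h in
-- Expanding `|D_N|²` over pairs `(a, b)`, orthogonality keeps those with `a - b ≡ k` modulo `L`.
-- Since `|a - b - k| ≤ N + |k| < L`, this congruence is an equality, so the discrete sum has no
-- aliasing error.
theorem sum_fejerWeight_mul {N L : ℕ} {k : ℤ} (hL : N + k.natAbs < L) :
    ∑ r ∈ Finset.range L, (fejerWeight N L r : ℂ) *
      Complex.exp (2 * Real.pi * Complex.I * (r * (-k : ℤ) / L)) =
      ((N + 1 - k.natAbs : ℕ) : ℂ) / (N + 1) := by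
  have hL0 : (L : ℂ) ≠ 0 := by exact_mod_cast (by omega : L ≠ 0)
  have hN0 : (N + 1 : ℂ) ≠ 0 := by exact_mod_cast (by omega : N + 1 ≠ 0)
  have hconj : ∀ r b : ℕ, (starRingEnd ℂ) (Complex.exp (2 * Real.pi * Complex.I * (r * b / L))) =
      Complex.exp (-(2 * Real.pi * Complex.I * (r * b / L))) := fun r b => by
    rw [← Complex.exp_conj]
    simp [Complex.conj_ofNat]
  have hw : ∀ r : ℕ, (fejerWeight N L r : ℂ) *
      Complex.exp (2 * Real.pi * Complex.I * (r * (-k : ℤ) / L)) =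
      (∑ a ∈ Finset.range (N + 1), ∑ b ∈ Finset.range (N + 1),
        Complex.exp (2 * Real.pi * Complex.I * (r * ((a - b - k : ℤ) : ℂ) / L))) /
          (L * (N + 1)) := fun r => by
    rw [fejerWeight, Complex.ofReal_div, Complex.normSq_eq_conj_mul_self, mul_comm (starRingEnd ℂ _),
      dirichletValue, map_sum, Finset.sum_mul_sum]
    push_cast
    rw [div_mul_eq_mul_div, Finset.sum_mul]
    congr 1
    refine Finset.sum_congr rfl fun a _ => ?_
    rw [Finset.sum_mul]
    refine Finset.sum_congr rfl fun b _ => ?_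
    rw [hconj, ← Complex.exp_add, ← Complex.exp_add]
    ring_nf
  simp only [hw]
  rw [← Finset.sum_div, Finset.sum_comm]
  have : ∀ a ∈ Finset.range (N + 1), ∑ r ∈ Finset.range L, ∑ b ∈ Finset.range (N + 1),
      Complex.exp (2 * Real.pi * Complex.I * (r * ((a - b - k : ℤ) : ℂ) / L)) =
      L * ((∑ b ∈ Finset.range (N + 1), (if (a : ℤ) - b = k then 1 else 0 : ℕ) : ℕ) : ℂ) := by
    intro a ha
    rw [Finset.sum_comm, Nat.cast_sum, Finset.mul_sum]
    refine Finset.sum_congr rfl fun b hb => ?_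
    rw [sum_exp_eq_ite (by omega)]
    have hiff : (L : ℤ) ∣ (a : ℤ) - b - k ↔ (a : ℤ) - b = k := by
      constructor
      · intro hd
        have := Int.eq_zero_of_abs_lt_dvd hd (by
          rw [Finset.mem_range] at ha hb
          rw [abs_lt]; omega)
        omega
      · intro hd; rw [hd]; simp
    simp only [hiff]
    split_ifs <;> simp
  rw [Finset.sum_congr rfl this, ← Finset.mul_sum, ← Nat.cast_sum, card_sub_eq]
  field_simp

/-- The Fejér weights are nonnegative and, by the case `k = 0` of `sum_fejerWeight_mul`, have sum
`1`; thus a convex combination of characters appears for each `L`. No single `L` serves all `m`, but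
at each `m` the value is exact for large `L`. -/
theorem fejer_coord_bound (N : ℕ) (j : Fin d) :
    MultiplierBound u 1 fun m => (((N + 1 - (m j).natAbs : ℕ) : ℂ) / (N + 1)) := by
  refine MultiplierBound.of_tendsto (l := atTop) (M := fun (L : ℕ) m =>
    ∑ r ∈ Finset.range L, (fejerWeight N L r : ℂ) *
      Complex.exp (2 * Real.pi * Complex.I * (r * (-(m j) : ℤ) / L))) ?_ fun m => ?_
  · filter_upwards [eventually_gt_atTop N] with L hL
    have hb := MultiplierBound.sum (Finset.range L) fun r _ =>
      (h.rotation (Pi.single j (-(2 * Real.pi * r / L)))).const_mul (fejerWeight N L r : ℂ)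
    have hsum : ∑ r ∈ Finset.range L, ‖(fejerWeight N L r : ℂ)‖ * 1 = 1 := by
      have h0 := sum_fejerWeight_mul (N := N) (L := L) (k := 0) (by simpa using hL)
      have hN0 : (N + 1 : ℂ) ≠ 0 := by exact_mod_cast (by omega : N + 1 ≠ 0)
      simp only [neg_zero, Int.cast_zero, mul_zero, zero_div, Complex.exp_zero, mul_one,
        Int.natAbs_zero, Nat.sub_zero, Nat.cast_add, Nat.cast_one, div_self hN0] at h0
      have h1 : ∑ r ∈ Finset.range L, fejerWeight N L r = 1 := by exact_mod_cast h0
      refine (Finset.sum_congr rfl fun r _ => ?_).trans h1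
      rw [mul_one, Complex.norm_real, Real.norm_of_nonneg]
      exact div_nonneg (Complex.normSq_nonneg _) (by positivity)
    rw [hsum] at hb
    convert hb using 4 with m r
    rw [latticeChar_single]
    push_cast
    ring_nf
  · refine tendsto_const_nhds.congr' ?_
    filter_upwards [eventually_gt_atTop (N + (m j).natAbs)] with L hL
    exact (sum_fejerWeight_mul hL).symm

/-- On the span the multiplier is the average, with density `φ(v)`, of the rotations by the angles
`-2π ε v_j`. Each of these is contractive, so the triangle inequality for integrals gives a bound
independent of `ε`. -/
theorem dilated_bound [CompleteSpace E] {φ : EuclideanSpace ℝ (Fin d) → ℂ}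
    (hφ : MeasureTheory.Integrable φ) (ε : ℝ) :
    MultiplierBound u (∫ s, ‖φ s‖) fun m => FourierTransform.fourier φ (ε • latticePoint m) := by
  intro s a
  let e : EuclideanSpace ℝ (Fin d) → (Fin d → ℤ) → ℂ := fun v =>
    latticeChar fun j => -(2 * Real.pi * ε * v j)
  have he : ∀ v m, (Real.fourierChar (-inner ℝ v (ε • latticePoint m)) : ℂ) = e v m := by
    intro v m
    rw [Real.fourierChar_apply, real_inner_smul_right]
    simp only [e, latticeChar, latticePoint, PiLp.inner_apply, RCLike.inner_apply, conj_trivial]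
    congr 3
    rw [Finset.mul_sum, ← Finset.sum_neg_distrib, Finset.mul_sum]
    refine Finset.sum_congr rfl fun j _ => ?_
    ring
  have hF : ∀ m, FourierTransform.fourier φ (ε • latticePoint m) = ∫ v, e v m * φ v := fun m => by
    rw [Real.fourier_eq]
    refine MeasureTheory.integral_congr_ae (Eventually.of_forall fun v => ?_)
    simp only [← he, Circle.smul_def, smul_eq_mul]
  have hint : ∀ m, MeasureTheory.Integrable fun v => e v m * φ v := fun m => by
    refine hφ.bdd_mul (c := 1) ?_ (Eventually.of_forall fun v => ?_)
    · refine Continuous.aestronglyMeasurable ?_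
      simp only [e, latticeChar]
      fun_prop
    · simp only [e, latticeChar, Complex.norm_exp_ofReal_mul_I, le_refl]
  have hS : ∑ m ∈ s, (FourierTransform.fourier φ (ε • latticePoint m) * a m) • u m =
      ∫ v, φ v • ∑ m ∈ s, (e v m * a m) • u m := by
    simp only [hF, Finset.smul_sum]
    rw [MeasureTheory.integral_finsetSum]
    · refine Finset.sum_congr rfl fun m _ => ?_
      rw [mul_smul, ← integral_smul_const]
      refine MeasureTheory.integral_congr_ae (Eventually.of_forall fun v => ?_)
      simp only [smul_smul]
      ring_nf
    · intro m _
      have := (hint m).smul_const (a m • u m)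
      refine this.congr (Eventually.of_forall fun v => ?_)
      simp only [smul_smul]
      ring_nf
  rw [hS, ← MeasureTheory.integral_mul_const]
  refine MeasureTheory.norm_integral_le_of_norm_le (hφ.norm.mul_const _)
    (Eventually.of_forall fun v => ?_)
  rw [norm_smul]
  refine mul_le_mul_of_nonneg_left ?_ (norm_nonneg _)
  simpa using h.rotation _ s a

theorem coeff_sum (a : (Fin d → ℤ) →₀ ℂ) (m : Fin d → ℤ) :
    c m (∑ n ∈ a.support, a n • u n) = a m := by
  simp only [map_sum, map_smul, h.biorthogonal, smul_eq_mul, mul_ite, mul_one, mul_zero,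
    Finset.sum_ite_eq, Finsupp.mem_support_iff]
  by_cases hm : a m = 0 <;> simp [hm]

omit h in
theorem exists_of_mem_span {x : E} (hx : x ∈ Submodule.span ℂ (Set.range u)) :
    ∃ a : (Fin d → ℤ) →₀ ℂ, x = ∑ m ∈ a.support, a m • u m := by
  obtain ⟨a, rfl⟩ := Finsupp.mem_span_range_iff_exists_finsupp.1 hx
  exact ⟨a, rfl⟩

theorem norm_term_le (M : (Fin d → ℤ) → ℂ) (x : E) (m : Fin d → ℤ) :
    ‖(M m * c m x) • u m‖ ≤ ‖M m‖ * ‖x‖ := by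
  rw [norm_smul, norm_mul]
  calc _ ≤ ‖M m‖ * ‖x‖ * 1 := by gcongr; exacts [h.coeff_le m x, h.norm_le m]
    _ = _ := mul_one _

variable [CompleteSpace E]

/-- Convergence is absolute, as the terms are at most `‖M m‖ * ‖x‖`. `Summable` expresses
unconditional convergence. -/
theorem summable_term {M : (Fin d → ℤ) → ℂ} (hM : Summable M) (x : E) :
    Summable fun m => (M m * c m x) • u m :=
  Summable.of_norm_bounded (hM.norm.mul_right ‖x‖) (h.norm_term_le M x)

/-- Continuity comes first, from the crude bound `∑ ‖M m‖`; it then lets the bound `C` pass from the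
dense span, where the series is a finite sum, to all of `E`. -/
theorem exists_multiplier {M : (Fin d → ℤ) → ℂ} (hM : Summable M) {C : ℝ}
    (hC : MultiplierBound u C M) : ∃ T : E →L[ℂ] E,
      (∀ x, T x = ∑' m, (M m * c m x) • u m) ∧ ∀ x, ‖T x‖ ≤ C * ‖x‖ := by
  let T : E →L[ℂ] E := LinearMap.mkContinuous
    { toFun := fun x => ∑' m, (M m * c m x) • u m
      map_add' := fun x y => by
        rw [← (h.summable_term hM x).tsum_add (h.summable_term hM y)]
        simp only [map_add, mul_add, add_smul]
      map_smul' := fun r x => by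
        rw [RingHom.id_apply, ← (h.summable_term hM x).tsum_const_smul]
        simp only [map_smul, smul_eq_mul, smul_smul, mul_left_comm] }
    (∑' m, ‖M m‖) fun x => by
      rw [← tsum_mul_right]
      exact tsum_of_norm_bounded (hM.norm.mul_right ‖x‖).hasSum (h.norm_term_le M x)
  have hT : ∀ x, T x = ∑' m, (M m * c m x) • u m := fun _ => rfl
  refine ⟨T, hT, fun x => ?_⟩
  refine h.dense.induction (P := fun x => ‖T x‖ ≤ C * ‖x‖) (fun x hx => ?_)
    (isClosed_le (by fun_prop) (by fun_prop)) x
  obtain ⟨a, rfl⟩ := exists_of_mem_span hx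
  rw [hT]
  simp only [h.coeff_sum]
  rw [tsum_eq_sum (s := a.support) fun m hm => by
    rw [Finsupp.notMem_support_iff.1 hm, mul_zero, zero_smul]]
  exact hC _ _

/-- Multipliers that are uniformly bounded and tend to `1` pointwise form an approximate identity. -/
theorem tendsto_multiplier {κ : Type*} {l : Filter κ} {M : κ → (Fin d → ℤ) → ℂ} {C : ℝ}
    (hM : ∀ᶠ k in l, Summable (M k)) (hC : ∀ᶠ k in l, MultiplierBound u C (M k))
    (hlim : ∀ m, Tendsto (fun k => M k m) l (𝓝 1)) (x : E) :
    Tendsto (fun k => ∑' m, (M k m * c m x) • u m) l (𝓝 x) := by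
  -- A negative bound can be weakened to `0`; the radii below need `C + 1 > 0`.
  wlog hC0 : 0 ≤ C generalizing C
  · exact this (C := 0) (hC.mono fun k hk => hk.mono (le_of_not_ge hC0)) le_rfl
  rw [Metric.tendsto_nhds]
  intro ε hε
  -- The distance from `x` to `y` enters twice, as `‖T (x - y)‖ ≤ C ‖x - y‖` and as `‖y - x‖`; hence
  -- the factor `C + 1`.
  obtain ⟨y, hy, hxy⟩ := Metric.mem_closure_iff.1 (h.dense x) (ε / (2 * (C + 1))) (by positivity)
  obtain ⟨a, rfl⟩ := exists_of_mem_span hy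
  set y := ∑ m ∈ a.support, a m • u m with hydef
  have hy1 : Tendsto (fun k => ∑ m ∈ a.support, (M k m * a m) • u m) l (𝓝 y) := by
    have := tendsto_finsetSum a.support fun m _ =>
      ((hlim m).mul_const (a m)).smul_const (u m)
    simpa only [one_mul] using this
  filter_upwards [hM, hC, Metric.tendsto_nhds.1 hy1 (ε / 2) (by positivity)] with k hk1 hk2 hk3
  obtain ⟨T, hT, hTb⟩ := h.exists_multiplier hk1 hk2
  rw [← hT]
  have hTy : T y = ∑ m ∈ a.support, (M k m * a m) • u m := by
    rw [hT]
    simp only [hydef, h.coeff_sum]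
    exact tsum_eq_sum fun m hm => by
      rw [Finsupp.notMem_support_iff.1 hm, mul_zero, zero_smul]
  rw [← hTy] at hk3
  rw [dist_eq_norm] at hxy hk3 ⊢
  have h1 := hTb (x - y)
  rw [map_sub] at h1
  have h2 : (C + 1) * ‖x - y‖ < ε / 2 := by
    rw [lt_div_iff₀ (by positivity)] at hxy
    linarith
  calc ‖T x - x‖ = ‖(T x - T y) + (T y - y) + (y - x)‖ := by congr 1; abel
    _ ≤ ‖T x - T y‖ + ‖T y - y‖ + ‖y - x‖ := norm_add₃_le
    _ < ε := by rw [norm_sub_rev y x]; linarith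

end FourierSystem

end FourierSystem

/-! ### Star homomorphisms and `p`-norms. -/

section TraceHom

variable {A B : Type*} [CStarAlgebra A] [PartialOrder A] [StarOrderedRing A]
  [CStarAlgebra B] [PartialOrder B] [StarOrderedRing B]

theorem continuous_starAlgHom {A B : Type*} [CStarAlgebra A] [CStarAlgebra B] (φ : A →⋆ₐ[ℂ] B) :
    Continuous φ :=
  AddMonoidHomClass.continuous_of_bound φ 1 fun x => by
    simpa using NonUnitalStarAlgHom.norm_apply_le φ x

theorem starAlgHom_nonneg (φ : A →⋆ₐ[ℂ] B) {a : A} (ha : 0 ≤ a) : 0 ≤ φ a := by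
  obtain ⟨y, rfl⟩ := CStarAlgebra.nonneg_iff_eq_star_mul_self.1 ha
  rw [map_mul, map_star]
  exact star_mul_self_nonneg _

theorem starAlgHom_abs (φ : A →⋆ₐ[ℂ] B) (x : A) : CFC.abs (φ x) = φ (CFC.abs x) := by
  rw [CFC.abs]
  refine CFC.sqrt_unique ?_ (starAlgHom_nonneg φ (CFC.abs_nonneg x))
  rw [← map_mul, CFC.abs_mul_abs, map_mul, map_star]

theorem starAlgHom_rpow (φ : A →⋆ₐ[ℂ] B) {a : A} (ha : 0 ≤ a) {p : ℝ} (hp : 0 ≤ p) :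
    φ (a ^ p) = φ a ^ p := by
  rw [CFC.rpow_eq_cfc_real ha, CFC.rpow_eq_cfc_real (starAlgHom_nonneg φ ha)]
  exact φ.map_cfc (fun s : ℝ => s ^ p) a (Real.continuous_rpow_const hp).continuousOn
    (continuous_starAlgHom φ) ha.isSelfAdjoint (starAlgHom_nonneg φ ha).isSelfAdjoint

/-- Trace preserving homomorphisms preserve the `p`-norms. -/
theorem pNorm_starAlgHom {τ : TracialState A} {σ : TracialState B} (φ : A →⋆ₐ[ℂ] B)
    (hφ : ∀ x, σ.toPos (φ x) = τ.toPos x) {p : ℝ} (hp : 0 ≤ p) (x : A) :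
    pNorm σ p (φ x) = pNorm τ p x := by
  rw [pNorm, pNorm, starAlgHom_abs, ← starAlgHom_rpow φ (CFC.abs_nonneg x) hp, hφ]

theorem norm_unitary_le_one {A : Type*} [CStarAlgebra A] (v : unitary A) : ‖(v : A)‖ ≤ 1 := by
  rcases subsingleton_or_nontrivial A with _ | _
  · rw [Subsingleton.elim (v : A) 0, norm_zero]; exact zero_le_one
  · exact (CStarRing.norm_coe_unitary v).le

theorem continuous_toPos (τ : TracialState A) : Continuous τ.toPos :=
  (τ.toPos.toLinearMap.mkContinuous 1 (by simpa using norm_toPos_le τ)).continuous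

end TraceHom

/-! ### Monomials modulo scalars, and trigonometric polynomials. -/

section Monomials

variable {d : ℕ} (θ : SkewMatrix d)

/-- The scalar unitaries. -/
def scalarUnitary : Subgroup (unitary (NCTorus θ)) where
  carrier := {g | ∃ c : ℂ, (g : NCTorus θ) = algebraMap ℂ _ c}
  mul_mem' := by
    rintro g h ⟨a, ha⟩ ⟨b, hb⟩
    exact ⟨a * b, by rw [Submonoid.coe_mul, ha, hb, map_mul]⟩
  one_mem' := ⟨1, by simp⟩
  inv_mem' := by
    rintro g ⟨a, ha⟩
    refine ⟨star a, ?_⟩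
    change star (g : NCTorus θ) = _
    rw [ha, algebraMap_star_comm]

instance : (scalarUnitary θ).Normal where
  conj_mem := by
    rintro g ⟨a, ha⟩ h
    refine ⟨a, ?_⟩
    rw [Submonoid.coe_mul, Submonoid.coe_mul, ha, ← Algebra.commutes, mul_assoc,
      ← Submonoid.coe_mul, mul_inv_cancel, Submonoid.coe_one, mul_one]

theorem mk_eq_mk_iff {g h : unitary (NCTorus θ)} :
    (g : unitary (NCTorus θ) ⧸ scalarUnitary θ) = h ↔ ∃ c : ℂ, (h : NCTorus θ) = c • (g : NCTorus θ) := by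
  rw [QuotientGroup.eq]
  constructor
  · rintro ⟨c, hc⟩
    refine ⟨c, ?_⟩
    have : (h : NCTorus θ) = g * ((g⁻¹ * h : unitary (NCTorus θ)) : NCTorus θ) := by
      rw [← Submonoid.coe_mul, mul_inv_cancel_left]
    rw [this, hc, ← Algebra.commutes, Algebra.smul_def]
  · rintro ⟨c, hc⟩
    refine ⟨c, ?_⟩
    rw [Submonoid.coe_mul, hc, mul_smul_comm, ← Submonoid.coe_mul, inv_mul_cancel,
      Submonoid.coe_one, Algebra.algebraMap_eq_smul_one]

/-- Modulo scalars, `m ↦ U^m` is a homomorphism which maps the unit vectors to the generators. -/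
theorem monomial_mod_scalar :
    (∀ m n : Fin d → ℤ, (monomial θ (m + n) : unitary (NCTorus θ) ⧸ scalarUnitary θ) =
      (monomial θ m * monomial θ n : unitary (NCTorus θ))) ∧
    ∀ k, (monomial θ (Pi.single k 1) : unitary (NCTorus θ) ⧸ scalarUnitary θ) = generator θ k := by
  let q : unitary (NCTorus θ) →* unitary (NCTorus θ) ⧸ scalarUnitary θ := QuotientGroup.mk' _
  have hcomm : ∀ j k, q (generator θ j) * q (generator θ k) = q (generator θ k) * q (generator θ j) := by
    intro j k
    rw [← map_mul, ← map_mul]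
    refine (mk_eq_mk_iff θ).2 ⟨Complex.exp (2 * Real.pi * Complex.I * (θ.1 k j : ℂ)), ?_⟩
    exact gen_relation θ k j
  let S : Set (unitary (NCTorus θ) ⧸ scalarUnitary θ) := Set.range fun k => q (generator θ k)
  -- Modulo scalars the generators commute, so the ordered product becomes an unordered one in a
  -- commutative group and is multiplicative in `m` factor by factor. The commutation phases never
  -- need to be computed.
  have : IsMulCommutative (Subgroup.closure S) := Subgroup.isMulCommutative_closure (by
    rintro _ ⟨j, rfl⟩ _ ⟨k, rfl⟩
    exact hcomm j k)
  let : CommGroup (Subgroup.closure S) := { mul_comm := fun a b => mul_comm' a b }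
  let g : Fin d → Subgroup.closure S := fun k => ⟨q (generator θ k), Subgroup.subset_closure ⟨k, rfl⟩⟩
  have hq : ∀ m : Fin d → ℤ, q (monomial θ m) = ((∏ k, g k ^ m k : Subgroup.closure S) : _) := by
    intro m
    rw [← List.prod_ofFn, monomial, map_list_prod, List.map_ofFn]
    refine Eq.trans ?_ (map_list_prod (Subgroup.closure S).subtype _).symm
    rw [List.map_ofFn]
    congr 2
  refine ⟨fun m n => ?_, fun k => ?_⟩
  · change q _ = q _
    rw [map_mul, hq, hq, hq, ← Subgroup.coe_mul, ← Finset.prod_mul_distrib]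
    simp only [Pi.add_apply, zpow_add]
  · change q _ = q _
    rw [hq, Finset.prod_eq_single k]
    · simp [g]
    · intro j _ hj; simp [hj]
    · simp

theorem monomial_zero : (monomial θ 0 : NCTorus θ) = 1 := by
  rw [monomial, List.prod_eq_one (by simp), Submonoid.coe_one]

theorem exists_monomial_add (m n : Fin d → ℤ) : ∃ c : ℂ,
    (monomial θ (m + n) : NCTorus θ) = c • (monomial θ m * monomial θ n : NCTorus θ) :=
  (mk_eq_mk_iff θ).1 ((monomial_mod_scalar θ).1 m n).symm

theorem exists_monomial_mul (m n : Fin d → ℤ) : ∃ c : ℂ,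
    (monomial θ m * monomial θ n : NCTorus θ) = c • (monomial θ (m + n) : NCTorus θ) :=
  (mk_eq_mk_iff θ).1 ((monomial_mod_scalar θ).1 m n)

theorem exists_star_monomial (m : Fin d → ℤ) : ∃ c : ℂ,
    star (monomial θ m : NCTorus θ) = c • (monomial θ (-m) : NCTorus θ) := by
  obtain ⟨c, hc⟩ := exists_monomial_add θ m (-m)
  refine ⟨c, ?_⟩
  rw [add_neg_cancel, monomial_zero] at hc
  calc star (monomial θ m : NCTorus θ) = star (monomial θ m : NCTorus θ) * 1 := (mul_one _).symm
    _ = _ := by rw [hc, mul_smul_comm, ← mul_assoc, Unitary.coe_star_mul_self, one_mul]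

/-- The noncommutative trigonometric polynomials. -/
def trigPoly : Submodule ℂ (NCTorus θ) :=
  Submodule.span ℂ (Set.range fun m : Fin d → ℤ => (monomial θ m : NCTorus θ))

theorem monomial_mem (m : Fin d → ℤ) : (monomial θ m : NCTorus θ) ∈ trigPoly θ :=
  Submodule.subset_span ⟨m, rfl⟩

theorem trigPoly_mul_mem {x y : NCTorus θ} (hx : x ∈ trigPoly θ) (hy : y ∈ trigPoly θ) :
    x * y ∈ trigPoly θ := by
  refine Submodule.span_induction₂ (p := fun x y _ _ => x * y ∈ trigPoly θ) ?_ (by simp) (by simp)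
    ?_ ?_ ?_ ?_ hx hy
  · rintro _ _ ⟨m, rfl⟩ ⟨n, rfl⟩
    obtain ⟨c, hc⟩ := exists_monomial_mul θ m n
    beta_reduce
    rw [hc]
    exact Submodule.smul_mem _ _ (monomial_mem θ _)
  · intro x y z _ _ _ h1 h2; rw [add_mul]; exact add_mem h1 h2
  · intro x y z _ _ _ h1 h2; rw [mul_add]; exact add_mem h1 h2
  · intro r x y _ _ h1; rw [smul_mul_assoc]; exact Submodule.smul_mem _ _ h1
  · intro r x y _ _ h1; rw [mul_smul_comm]; exact Submodule.smul_mem _ _ h1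

theorem trigPoly_star_mem {x : NCTorus θ} (hx : x ∈ trigPoly θ) : star x ∈ trigPoly θ := by
  refine Submodule.span_induction (p := fun x _ => star x ∈ trigPoly θ) ?_ (by simp) ?_ ?_ hx
  · rintro _ ⟨m, rfl⟩
    obtain ⟨c, hc⟩ := exists_star_monomial θ m
    beta_reduce
    rw [hc]
    exact Submodule.smul_mem _ _ (monomial_mem θ _)
  · intro x y _ _ h1 h2; rw [star_add]; exact add_mem h1 h2
  · intro r x _ h1; rw [star_smul]; exact Submodule.smul_mem _ _ h1

/-- Products and adjoints of monomials are scalar multiples of monomials, so the closure of the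
polynomials is a closed star subalgebra; it contains the generators. -/
theorem dense_trigPoly : Dense (trigPoly θ : Set (NCTorus θ)) := by
  intro x
  refine induction_on θ (P := fun x => x ∈ closure (trigPoly θ : Set (NCTorus θ))) isClosed_closure
    (fun k => subset_closure ?_) (fun c => subset_closure ?_) (fun x y hx hy => ?_)
    (fun x y hx hy => ?_) (fun x hx => ?_) x
  · obtain ⟨c, hc⟩ := (mk_eq_mk_iff θ).1 ((monomial_mod_scalar θ).2 k)
    rw [hc]
    exact Submodule.smul_mem _ _ (monomial_mem θ _)
  · rw [Algebra.algebraMap_eq_smul_one, ← monomial_zero]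
    exact Submodule.smul_mem _ _ (monomial_mem θ _)
  · exact map_mem_closure₂ continuous_add hx hy fun _ h1 _ h2 => add_mem h1 h2
  · exact map_mem_closure₂ continuous_mul hx hy fun _ h1 _ h2 => trigPoly_mul_mem θ h1 h2
  · exact map_mem_closure continuous_star hx fun _ h1 => trigPoly_star_mem θ h1

/-- Off the diagonal `(U^m)* U^n` is some scalar multiple of `U^(n-m)`, which has trace zero
whatever the scalar; on the diagonal it is `1` by unitarity. -/
theorem coeffAlg_monomial (m n : Fin d → ℤ) :
    coeffAlg θ (monomial θ n) m = if m = n then 1 else 0 := by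
  rw [coeffAlg]
  split_ifs with h
  · subst h
    rw [Unitary.coe_star_mul_self, (canonicalTrace θ).map_one]
  · obtain ⟨c, hc⟩ := exists_star_monomial θ m
    obtain ⟨c', hc'⟩ := exists_monomial_mul θ (-m) n
    rw [hc, smul_mul_assoc, hc', map_smul, map_smul, trace_monomial,
      if_neg (fun h0 => h (neg_add_eq_zero.1 h0)), smul_zero, smul_zero]

theorem norm_coeffAlg_le (x : NCTorus θ) (m : Fin d → ℤ) : ‖coeffAlg θ x m‖ ≤ ‖x‖ := by
  refine (norm_toPos_le _ _).trans ((norm_mul_le _ _).trans ?_)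
  rw [norm_star]
  have : ‖(monomial θ m : NCTorus θ)‖ ≤ 1 := norm_unitary_le_one (monomial θ m)
  nlinarith [norm_nonneg x]

end Monomials

/-! ### The action of the torus on `A_θ`. -/

section Rotation

variable {d : ℕ} (θ : SkewMatrix d) (z : Fin d → Circle)

/-- The realisation in which the unitaries are multiplied by the phases `z_k`. -/
abbrev TorusRep.rotate (ρ : TorusRep θ) : TorusRep θ where
  B := ρ.B
  V k := ⟨(z k : ℂ) • (ρ.V k : ρ.B), by
    have h : (starRingEnd ℂ) (z k : ℂ) * (z k : ℂ) = 1 := by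
      rw [← Circle.coe_inv_eq_conj, ← Circle.coe_mul, inv_mul_cancel, Circle.coe_one]
    refine Unitary.mem_iff.2 ⟨?_, ?_⟩
    · rw [star_smul, smul_mul_smul_comm, Unitary.coe_star_mul_self]
      exact (congrArg (· • (1 : ρ.B)) h).trans (one_smul _ _)
    · rw [star_smul, smul_mul_smul_comm]
      exact (congrArg₂ (· • ·) ((mul_comm _ _).trans h) (Unitary.coe_mul_star_self (ρ.V k))).trans
        (one_smul _ _)⟩
  rel k j := by
    change ((z k : ℂ) • (ρ.V k : ρ.B)) * ((z j : ℂ) • (ρ.V j : ρ.B)) =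
      _ • (((z j : ℂ) • (ρ.V j : ρ.B)) * ((z k : ℂ) • (ρ.V k : ρ.B)))
    rw [smul_mul_smul_comm, smul_mul_smul_comm, ρ.rel k j, smul_comm, mul_comm (z k : ℂ)]

/-- The rotation of the product of all realisations. -/
def rotateProduct : RepProduct θ →⋆ₐ[ℂ] RepProduct θ where
  -- Rotation acts by reindexing the realisations. The property `exists_unique_hom` does not apply
  -- directly, its target being in `Type` while `NCTorus θ` is in `Type 1`.
  toFun x := ⟨fun ρ => x (ρ.rotate θ z), memℓp_infty ⟨‖x‖, by
    rintro _ ⟨ρ, rfl⟩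
    exact lp.norm_apply_le_norm ENNReal.top_ne_zero x (ρ.rotate θ z)⟩⟩
  map_one' := rfl
  map_mul' _ _ := rfl
  map_zero' := rfl
  map_add' _ _ := rfl
  commutes' _ := rfl
  map_star' _ := rfl

theorem rotateProduct_gen (k : Fin d) :
    rotateProduct θ z (productGen θ k) = (z k : ℂ) • (productGen θ k : RepProduct θ) := rfl

theorem rotateProduct_mem (x : NCTorus θ) :
    rotateProduct θ z ((torusSubalgebra θ).subtype x) ∈ torusSubalgebra θ := by
  have hc : Continuous fun x : NCTorus θ => rotateProduct θ z ((torusSubalgebra θ).subtype x) :=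
    (continuous_starAlgHom (rotateProduct θ z)).comp continuous_subtype_val
  refine induction_on θ
    (P := fun x => rotateProduct θ z ((torusSubalgebra θ).subtype x) ∈ torusSubalgebra θ)
    ((StarSubalgebra.isClosed_topologicalClosure _).preimage hc) (fun k => ?_) (fun c => ?_)
    (fun x y hx hy => ?_) (fun x y hx hy => ?_) (fun x hx => ?_) x
  · change rotateProduct θ z (productGen θ k) ∈ _
    rw [rotateProduct_gen]
    exact (torusSubalgebra θ).smul_mem (productGen_mem θ k) _
  · change rotateProduct θ z (algebraMap ℂ _ c) ∈ _
    rw [AlgHomClass.commutes]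
    exact (torusSubalgebra θ).algebraMap_mem c
  · exact add_mem hx hy
  · exact mul_mem hx hy
  · exact star_mem (s := torusSubalgebra θ) hx

/-- The action of the torus on `A_θ`, with `U_k ↦ z_k U_k`. -/
def rotate : NCTorus θ →⋆ₐ[ℂ] NCTorus θ :=
  ((rotateProduct θ z).comp (torusSubalgebra θ).subtype).codRestrict (torusSubalgebra θ)
    (rotateProduct_mem θ z)

theorem rotate_gen (k : Fin d) :
    rotate θ z (generator θ k) = (z k : ℂ) • (generator θ k : NCTorus θ) := rfl

/-- The scalar unitary of a point of the circle. -/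
def circleUnitary : Circle →* unitary (NCTorus θ) where
  toFun w := ⟨algebraMap ℂ _ (w : ℂ), by
    have h : star (w : ℂ) * (w : ℂ) = 1 := by
      change (starRingEnd ℂ) (w : ℂ) * (w : ℂ) = 1
      rw [← Circle.coe_inv_eq_conj, ← Circle.coe_mul, inv_mul_cancel, Circle.coe_one]
    refine Unitary.mem_iff.2 ⟨?_, ?_⟩
    · rw [← algebraMap_star_comm, ← map_mul, h, map_one]
    · rw [← algebraMap_star_comm, ← map_mul, mul_comm, h, map_one]⟩
  map_one' := Subtype.ext (by simp)
  map_mul' a b := Subtype.ext (by simp)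

theorem commute_circleUnitary (w : Circle) (g : unitary (NCTorus θ)) :
    Commute (circleUnitary θ w) g := Subtype.ext (Algebra.commutes (w : ℂ) (g : NCTorus θ))

theorem rotate_monomial (m : Fin d → ℤ) : rotate θ z (monomial θ m) =
    ((∏ k, z k ^ m k : Circle) : ℂ) • (monomial θ m : NCTorus θ) := by
  let R : unitary (NCTorus θ) →* unitary (NCTorus θ) :=
    (Unitary.map (.ofClass (rotate θ z))).toMonoidHom
  have hR : ∀ k, R (generator θ k) = circleUnitary θ (z k) * generator θ k := fun k =>
    Subtype.ext ((rotate_gen θ z k).trans (Algebra.smul_def _ _))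
  have key : ∀ L : List (Fin d), R (L.map fun k => generator θ k ^ m k).prod =
      circleUnitary θ (L.map fun k => z k ^ m k).prod * (L.map fun k => generator θ k ^ m k).prod := by
    intro L
    induction L with
    | nil => simp
    | cons k L ih =>
      rw [List.map_cons, List.prod_cons, map_mul, ih, map_zpow, hR,
        (commute_circleUnitary θ (z k) _).mul_zpow, List.map_cons, List.prod_cons, map_mul, map_zpow]
      rw [mul_assoc, mul_assoc, ← mul_assoc (generator θ k ^ m k),
        ← (commute_circleUnitary θ _ (generator θ k ^ m k)).eq, mul_assoc]
  have := congrArg (fun g : unitary (NCTorus θ) => (g : NCTorus θ)) (key (List.finRange d))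
  rw [← List.ofFn_eq_map, ← List.ofFn_eq_map, List.prod_ofFn] at this
  rw [Algebra.smul_def]
  exact this

/-- A monomial is multiplied by a phase: either its trace is zero, or `m = 0` and the phase is `1`.
Density of the polynomials does the rest. -/
theorem trace_rotate (x : NCTorus θ) :
    (canonicalTrace θ).toPos (rotate θ z x) = (canonicalTrace θ).toPos x := by
  have hc := continuous_toPos (canonicalTrace θ)
  refine (dense_trigPoly θ).induction
    (P := fun x => (canonicalTrace θ).toPos (rotate θ z x) = (canonicalTrace θ).toPos x)
    (fun x hx => ?_) (isClosed_eq (hc.comp (continuous_starAlgHom _)) hc) x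
  refine Submodule.span_induction (p := fun x _ => (canonicalTrace θ).toPos (rotate θ z x) =
    (canonicalTrace θ).toPos x) ?_ (by simp) ?_ ?_ hx
  · rintro _ ⟨m, rfl⟩
    beta_reduce
    rw [rotate_monomial, map_smul, trace_monomial]
    split_ifs with h
    · subst h; simp
    · simp
  · intro x y _ _ h1 h2; rw [map_add, map_add, map_add, h1, h2]
  · intro r x _ h1; rw [map_smul, map_smul, map_smul, h1]

theorem latticeChar_eq (t : Fin d → ℝ) (m : Fin d → ℤ) :
    latticeChar t m = ((∏ k, Circle.exp (t k) ^ m k : Circle) : ℂ) := by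
  rw [latticeChar, Complex.ofReal_sum, Finset.sum_mul, Complex.exp_sum]
  refine Eq.trans ?_ (map_prod Circle.coeHom (fun k => Circle.exp (t k) ^ m k) Finset.univ).symm
  refine Finset.prod_congr rfl fun k _ => ?_
  rw [map_zpow, show Circle.coeHom (Circle.exp (t k)) = Complex.exp (t k * Complex.I) from
    Circle.coe_exp _, ← Complex.exp_int_mul]
  congr 1
  push_cast
  ring

theorem rotate_sum (t : Fin d → ℝ) (s : Finset (Fin d → ℤ)) (a : (Fin d → ℤ) → ℂ) :
    rotate θ (fun k => Circle.exp (t k)) (∑ m ∈ s, a m • (monomial θ m : NCTorus θ)) =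
      ∑ m ∈ s, (latticeChar t m * a m) • (monomial θ m : NCTorus θ) := by
  rw [map_sum]
  refine Finset.sum_congr rfl fun m _ => ?_
  rw [map_smul, rotate_monomial, smul_smul, latticeChar_eq, mul_comm]

end Rotation

/-! ### The Fourier system of `A_θ`. -/

section Alg

variable {d : ℕ} (θ : SkewMatrix d)

/-- The Fourier coefficients on `A_θ` as continuous functionals. -/
def coeffAlgCLM (m : Fin d → ℤ) : NCTorus θ →L[ℂ] ℂ :=
  LinearMap.mkContinuous
    { toFun := fun x => coeffAlg θ x m
      map_add' := fun x y => by simp only [coeffAlg, mul_add, map_add]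
      map_smul' := fun r x => by simp only [coeffAlg, mul_smul_comm, map_smul, RingHom.id_apply] } 1
    fun x => by rw [one_mul]; exact norm_coeffAlg_le θ x m

theorem fourierSystem_alg :
    FourierSystem (fun m : Fin d → ℤ => (monomial θ m : NCTorus θ)) (coeffAlgCLM θ) where
  norm_le m := norm_unitary_le_one (monomial θ m)
  coeff_le m x := norm_coeffAlg_le θ x m
  biorthogonal m n := coeffAlg_monomial θ m n
  dense := dense_trigPoly θ
  rotation t s a := by
    rw [one_mul, ← rotate_sum]
    exact NonUnitalStarAlgHom.norm_apply_le _ _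

end Alg

/-! ### Comparison of the `p`-norm with the 2-norm. -/

section Interpolation

variable {M : Type*} [CStarAlgebra M] [PartialOrder M] [StarOrderedRing M] (τ : TracialState M)

/-- On bounded sets, the `p`-norm is controlled by the `2`-norm. -/
theorem pNorm_le_of_norm_le {p B : ℝ} (hp : 1 ≤ p) {x : M} (hx : ‖x‖ ≤ B) :
    pNorm τ p x ≤ (B ^ (p - 1) * √(reTr τ (star x * x))) ^ (1 / p) := by
  have hB : 0 ≤ B := (norm_nonneg x).trans hx
  have ha0 : 0 ≤ CFC.abs x := CFC.abs_nonneg x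
  have hsa : IsSelfAdjoint (CFC.abs x) := ha0.isSelfAdjoint
  rw [pNorm_eq]
  refine Real.rpow_le_rpow (tr_nonneg τ CFC.rpow_nonneg) ?_ (by positivity)
  -- The spectrum of `|x|` lies in `[0, B]`, where `s ^ p ≤ B ^ (p - 1) * s`. The remaining `τ(|x|)`
  -- is at most the 2-norm of `x` by Cauchy–Schwarz against `1`.
  have h1 : CFC.abs x ^ p ≤ (B ^ (p - 1)) • CFC.abs x := by
    rw [← cfc_const_mul_id (R := ℝ) (B ^ (p - 1)) (CFC.abs x), CFC.rpow_eq_cfc_real ha0]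
    refine cfc_mono (fun s hs => ?_)
      (Real.continuous_rpow_const (zero_le_one.trans hp)).continuousOn (by fun_prop)
    have hs0 : 0 ≤ s := spectrum_nonneg_of_nonneg ha0 hs
    have hs1 : s ≤ ‖x‖ := by
      have := IsSelfAdjoint.le_algebraMap_norm_self (a := CFC.abs x)
      rw [CFC.norm_abs] at this
      exact (le_algebraMap_iff_spectrum_le (R := ℝ) (a := CFC.abs x)).mp this s hs
    rcases hs0.eq_or_lt with h | h
    · rw [← h, mul_zero, Real.zero_rpow (by linarith)]
    · calc s ^ p = s ^ (p - 1) * s := by rw [Real.rpow_sub_one h.ne']; field_simp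
        _ ≤ B ^ (p - 1) * s := by
          gcongr
          linarith
  have h2 := tr_mono τ h1
  rw [map_smul, smul_eq_mul] at h2
  refine h2.trans (mul_le_mul_of_nonneg_left ?_ (by positivity))
  have h3 := cauchySchwarz τ 1 (CFC.abs x)
  simp only [star_one, one_mul, tr_one, Real.sqrt_one] at h3
  rw [hsa.star_eq, CFC.abs_mul_abs] at h3
  exact (Complex.re_le_norm _).trans h3

end Interpolation

/-! ### Kaplansky's density theorem in the GNS representation, and density in `L_p`. -/

section Kaplansky

/-- The function `2 s / (1 + s ^ 2)`, which maps `ℝ` onto `[-1, 1]`. -/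
def boundedTransform (s : ℝ) : ℝ := 2 * s * (1 + s ^ 2)⁻¹

theorem continuous_resolvent : Continuous fun s : ℝ => (1 + s ^ 2)⁻¹ :=
  Continuous.inv₀ (by fun_prop) fun s => by positivity

theorem continuous_boundedTransform : Continuous boundedTransform :=
  (continuous_const.mul continuous_id).mul continuous_resolvent

theorem abs_boundedTransform_le (s : ℝ) : |boundedTransform s| ≤ 1 := by
  have h : (0 : ℝ) < 1 + s ^ 2 := by positivity
  rw [boundedTransform, ← div_eq_mul_inv, abs_div, abs_of_pos h, div_le_one h, abs_le]
  constructor <;> nlinarith [sq_nonneg (s + 1), sq_nonneg (s - 1)]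

/-- The function `s / (1 + √(1 - s²))` is a right inverse of `boundedTransform` on `[-1, 1]`, which
contains the spectrum of `y`. It is continuous on the whole line, since `Real.sqrt` vanishes on
negative numbers. -/
theorem exists_boundedTransform_eq {M : Type*} [CStarAlgebra M] [PartialOrder M] [StarOrderedRing M]
    {y : M} (hy : IsSelfAdjoint y) (hy1 : ‖y‖ ≤ 1) :
    ∃ z : M, IsSelfAdjoint z ∧ cfc boundedTransform z = y := by
  have hg : Continuous fun s : ℝ => s / (1 + √(1 - s ^ 2)) :=
    Continuous.div (by fun_prop) (by fun_prop) fun s => by positivity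
  refine ⟨cfc (fun s : ℝ => s / (1 + √(1 - s ^ 2))) y, IsSelfAdjoint.cfc, ?_⟩
  rw [← cfc_comp' (R := ℝ) boundedTransform (fun s : ℝ => s / (1 + √(1 - s ^ 2))) y
    continuous_boundedTransform.continuousOn hg.continuousOn]
  conv_rhs => rw [← cfc_id' ℝ y]
  refine cfc_congr fun s hs => ?_
  have hs1 : |s| ≤ 1 := by
    have h1 := spectrum.norm_le_norm_mul_of_mem hs
    have h2 : ‖(1 : M)‖ ≤ 1 := by simpa using norm_unitary_le_one (1 : unitary M)
    rw [Real.norm_eq_abs] at h1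
    nlinarith [norm_nonneg y, norm_nonneg (1 : M)]
  have hs2 : 0 ≤ 1 - s ^ 2 := by nlinarith [abs_le.1 hs1]
  have h3 := Real.sq_sqrt hs2
  have h4 := Real.sqrt_nonneg (1 - s ^ 2)
  set c := √(1 - s ^ 2)
  have h5 : 1 + (s / (1 + c)) ^ 2 = 2 / (1 + c) := by
    field_simp
    nlinarith
  simp only [boundedTransform]
  rw [h5]
  field_simp

/-- Kaplansky's identity. With `P = (1 + w²)⁻¹` and `Q = (1 + z²)⁻¹`, the difference is `2 (z Q - P
w)`; insert `P (1 + w²) = 1` on the left of the first term and `(1 + z²) Q = 1` on the right of the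
second. In the result `z - w` stands between contractions, so no bound on `‖z‖` or `‖w‖` is needed.
-/
theorem boundedTransform_sub {M : Type*} [CStarAlgebra M] {w z : M} (hw : IsSelfAdjoint w)
    (hz : IsSelfAdjoint z) :
    cfc boundedTransform z - cfc boundedTransform w =
      (2 : ℝ) • (cfc (fun s : ℝ => (1 + s ^ 2)⁻¹) w * (z - w) * cfc (fun s : ℝ => (1 + s ^ 2)⁻¹) z) +
      (1 / 2 : ℝ) • (cfc boundedTransform w * (w - z) * cfc boundedTransform z) := by
  have h1 : ∀ a : M, IsSelfAdjoint a →
      cfc boundedTransform a = (2 : ℝ) • (a * cfc (fun s : ℝ => (1 + s ^ 2)⁻¹) a) ∧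
      cfc boundedTransform a = (2 : ℝ) • (cfc (fun s : ℝ => (1 + s ^ 2)⁻¹) a * a) ∧
      (1 + a * a) * cfc (fun s : ℝ => (1 + s ^ 2)⁻¹) a = 1 ∧
      cfc (fun s : ℝ => (1 + s ^ 2)⁻¹) a * (1 + a * a) = 1 := by
    intro a ha
    have hr := continuous_resolvent.continuousOn (s := spectrum ℝ a)
    have hcomm : a * cfc (fun s : ℝ => (1 + s ^ 2)⁻¹) a = cfc (fun s : ℝ => (1 + s ^ 2)⁻¹) a * a := by
      have := cfc_commute_cfc (R := ℝ) (fun s => s) (fun s => (1 + s ^ 2)⁻¹) a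
      rwa [cfc_id' ℝ a] at this
    have e1 : cfc boundedTransform a = (2 : ℝ) • (a * cfc (fun s : ℝ => (1 + s ^ 2)⁻¹) a) := by
      have h2 := cfc_mul (R := ℝ) (fun s => s) (fun s => (1 + s ^ 2)⁻¹) a (by fun_prop) hr
      rw [cfc_id' ℝ a] at h2
      rw [← h2,
        ← cfc_const_mul (R := ℝ) 2 (fun s => s * (1 + s ^ 2)⁻¹) a (continuousOn_id.mul hr)]
      exact cfc_congr fun s _ => mul_assoc _ _ _
    have e2 : (1 + a * a) * cfc (fun s : ℝ => (1 + s ^ 2)⁻¹) a = 1 := by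
      have h2 : cfc (fun s : ℝ => 1 + s * s) a = 1 + a * a := by
        rw [cfc_add (R := ℝ) (a := a) (fun _ => 1) (fun s => s * s) (by fun_prop) (by fun_prop),
          cfc_const_one ℝ a, cfc_mul (R := ℝ) (fun s => s) (fun s => s) a (by fun_prop)
          (by fun_prop), cfc_id' ℝ a]
      rw [← h2, ← cfc_mul (R := ℝ) _ _ a (by fun_prop) hr, ← cfc_const_one ℝ a]
      refine cfc_congr fun s _ => ?_
      have : (0 : ℝ) < 1 + s ^ 2 := by positivity
      field_simp
    refine ⟨e1, by rw [e1, hcomm], e2, ?_⟩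
    rw [mul_add, mul_one, ← mul_assoc, ← hcomm, mul_assoc, ← hcomm, ← mul_assoc]
    rwa [add_mul, one_mul] at e2
  obtain ⟨-, w2, -, w4⟩ := h1 w hw
  obtain ⟨z1, -, z3, -⟩ := h1 z hz
  rw [z1, w2]
  set P := cfc (fun s : ℝ => (1 + s ^ 2)⁻¹) w
  set Q := cfc (fun s : ℝ => (1 + s ^ 2)⁻¹) z
  have e1 : z * Q = P * (1 + w * w) * (z * Q) := by rw [w4, one_mul]
  have e2 : P * w = P * w * ((1 + z * z) * Q) := by rw [z3, mul_one]
  have e3 : P * (1 + w * w) * (z * Q) - P * w * ((1 + z * z) * Q) =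
      P * (z - w) * Q + P * w * (w - z) * (z * Q) := by noncomm_ring
  rw [← smul_sub]
  conv_lhs => rw [e1, e2, e3]
  simp only [smul_add, smul_mul_assoc, mul_smul_comm, smul_smul]
  norm_num

variable {A : Type*} [CStarAlgebra A] [PartialOrder A] [StarOrderedRing A] (τ : TracialState A)

/-- The `2`-norm on the von Neumann algebra of the GNS representation. -/
def vnNorm2 (x : GNSvN τ) : ℝ := ‖GNSvN.toOp τ x (gnsVec τ)‖

theorem vnNorm2_add_le (x y : GNSvN τ) : vnNorm2 τ (x + y) ≤ vnNorm2 τ x + vnNorm2 τ y := by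
  rw [vnNorm2, map_add, add_apply]
  exact norm_add_le _ _

theorem vnNorm2_smul (c : ℂ) (x : GNSvN τ) : vnNorm2 τ (c • x) = ‖c‖ * vnNorm2 τ x := by
  rw [vnNorm2, map_smul, smul_apply, norm_smul, vnNorm2]

theorem vnNorm2_star (x : GNSvN τ) : vnNorm2 τ (star x) ≤ vnNorm2 τ x := by
  rw [vnNorm2, map_star]
  exact norm_star_vec_le τ (GNSvN.toOp_mem τ x)

theorem norm_toOp (x : GNSvN τ) : ‖GNSvN.toOp τ x‖ = ‖x‖ := rfl

theorem vnNorm2_mul_left (x y : GNSvN τ) : vnNorm2 τ (x * y) ≤ ‖x‖ * vnNorm2 τ y := by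
  rw [vnNorm2, map_mul, mul_apply_eq_comp, ← norm_toOp]
  exact ContinuousLinearMap.le_opNorm _ _

/-- Taking adjoints turns right multiplication into left multiplication; this is where traciality
enters, through `vnNorm2_star`. -/
theorem vnNorm2_mul_right (x y : GNSvN τ) : vnNorm2 τ (y * x) ≤ ‖x‖ * vnNorm2 τ y := by
  calc vnNorm2 τ (y * x) = vnNorm2 τ (star (star x * star y)) := by rw [star_mul, star_star, star_star]
    _ ≤ vnNorm2 τ (star x * star y) := vnNorm2_star τ _
    _ ≤ ‖star x‖ * vnNorm2 τ (star y) := vnNorm2_mul_left τ _ _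
    _ ≤ ‖x‖ * vnNorm2 τ y := by rw [norm_star]; gcongr; exact vnNorm2_star τ y

theorem sqrt_vnTrace_eq (x : GNSvN τ) : √(reTr (vnTrace τ) (star x * x)) = vnNorm2 τ x := by
  have h : reTr (vnTrace τ) (star x * x) = vnNorm2 τ x ^ 2 := by
    change (⟪gnsVec τ, GNSvN.toOp τ (star x * x) (gnsVec τ)⟫_ℂ).re = _
    rw [map_mul, map_star, mul_apply_eq_comp, ContinuousLinearMap.star_eq_adjoint,
      ContinuousLinearMap.adjoint_inner_right, inner_self_eq_norm_sq_to_K, vnNorm2]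
    norm_cast
  rw [h, Real.sqrt_sq (show 0 ≤ vnNorm2 τ x from norm_nonneg _)]

theorem exists_vnNorm2_sub_lt (y : GNSvN τ) {ε : ℝ} (hε : 0 < ε) :
    ∃ a : A, vnNorm2 τ (gnsHom τ a - y) < ε := by
  obtain ⟨_, ⟨a, rfl⟩, ha⟩ := Metric.mem_closure_iff.1 ((gns_cyclic τ) (GNSvN.toOp τ y (gnsVec τ))) ε hε
  refine ⟨a, ?_⟩
  rw [vnNorm2, map_sub, sub_apply, toOp_gnsHom, ← dist_eq_norm, dist_comm]
  exact ha

theorem exists_selfAdjoint_vnNorm2_sub_lt {y : GNSvN τ} (hy : IsSelfAdjoint y) {ε : ℝ} (hε : 0 < ε) :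
    ∃ a : A, IsSelfAdjoint a ∧ vnNorm2 τ (gnsHom τ a - y) < ε := by
  obtain ⟨a, ha⟩ := exists_vnNorm2_sub_lt τ y hε
  refine ⟨(1 / 2 : ℂ) • (a + star a), ?_, ?_⟩
  · rw [isSelfAdjoint_iff, star_smul, star_add, star_star, add_comm]
    simp
  · have e : gnsHom τ ((1 / 2 : ℂ) • (a + star a)) - y =
        (1 / 2 : ℂ) • ((gnsHom τ a - y) + star (gnsHom τ a - y)) := by
      rw [map_smul, map_add, map_star, star_sub, hy.star_eq]
      module
    rw [e, vnNorm2_smul]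
    have h1 := vnNorm2_add_le τ (gnsHom τ a - y) (star (gnsHom τ a - y))
    have h2 := vnNorm2_star τ (gnsHom τ a - y)
    have h3 : ‖(1 / 2 : ℂ)‖ = 1 / 2 := by norm_num
    rw [h3]
    linarith

/-- `y` is the limit in the `2`-norm of a bounded sequence from the image of `A`. -/
def BoundedlyApprox (y : GNSvN τ) : Prop :=
  ∃ C : ℝ, ∀ ε : ℝ, 0 < ε → ∃ a : A, ‖gnsHom τ a‖ ≤ C ∧ vnNorm2 τ (gnsHom τ a - y) < ε

theorem BoundedlyApprox.add {x y : GNSvN τ} (hx : BoundedlyApprox τ x) (hy : BoundedlyApprox τ y) :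
    BoundedlyApprox τ (x + y) := by
  obtain ⟨C, hC⟩ := hx
  obtain ⟨D, hD⟩ := hy
  refine ⟨C + D, fun ε hε => ?_⟩
  obtain ⟨a, ha1, ha2⟩ := hC (ε / 2) (by positivity)
  obtain ⟨b, hb1, hb2⟩ := hD (ε / 2) (by positivity)
  refine ⟨a + b, ?_, ?_⟩
  · rw [map_add]; exact (norm_add_le _ _).trans (add_le_add ha1 hb1)
  · rw [map_add, add_sub_add_comm]
    exact (vnNorm2_add_le τ _ _).trans_lt (by linarith)

theorem BoundedlyApprox.smul {x : GNSvN τ} (hx : BoundedlyApprox τ x) (c : ℂ) :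
    BoundedlyApprox τ (c • x) := by
  obtain ⟨C, hC⟩ := hx
  refine ⟨‖c‖ * C, fun ε hε => ?_⟩
  obtain ⟨a, ha1, ha2⟩ := hC (ε / (‖c‖ + 1)) (by positivity)
  refine ⟨c • a, ?_, ?_⟩
  · rw [map_smul, norm_smul]; gcongr
  · rw [map_smul, ← smul_sub, vnNorm2_smul]
    rw [lt_div_iff₀ (by positivity)] at ha2
    have : 0 ≤ vnNorm2 τ (gnsHom τ a - x) := norm_nonneg _
    nlinarith

/-- Write `y` as the bounded transform of `z` and approximate `z` in the 2-norm by a self-adjoint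
`a`, without control of `‖a‖`. The transform of `a` is a contraction, and `boundedTransform_sub`
bounds its 2-distance to `y`. -/
theorem boundedlyApprox_of_isSelfAdjoint {y : GNSvN τ} (hy : IsSelfAdjoint y) (hy1 : ‖y‖ ≤ 1) :
    BoundedlyApprox τ y := by
  obtain ⟨z, hz, rfl⟩ := exists_boundedTransform_eq hy hy1
  have hT : ∀ w : GNSvN τ, ‖cfc boundedTransform w‖ ≤ 1 := fun w =>
    norm_cfc_le zero_le_one fun s _ => abs_boundedTransform_le s
  have hR : ∀ w : GNSvN τ, ‖cfc (fun s : ℝ => (1 + s ^ 2)⁻¹) w‖ ≤ 1 := fun w =>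
    norm_cfc_le zero_le_one fun s _ => by
      rw [Real.norm_of_nonneg (by positivity)]
      exact inv_le_one_of_one_le₀ (by nlinarith [sq_nonneg s])
  refine ⟨1, fun ε hε => ?_⟩
  -- The identity costs a factor `2 + 1/2 < 3`.
  obtain ⟨a, ha, hlt⟩ := exists_selfAdjoint_vnNorm2_sub_lt τ hz (ε := ε / 3) (by positivity)
  have hw : IsSelfAdjoint (gnsHom τ a) := ha.map (gnsHom τ)
  have hmap : gnsHom τ (cfc boundedTransform a) = cfc boundedTransform (gnsHom τ a) :=
    (gnsHom τ).map_cfc boundedTransform a continuous_boundedTransform.continuousOn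
      (continuous_starAlgHom _) ha hw
  refine ⟨cfc boundedTransform a, by rw [hmap]; exact hT _, ?_⟩
  rw [hmap, boundedTransform_sub hz hw]
  set w := gnsHom τ a
  have hb : ∀ p q v : GNSvN τ, ‖p‖ ≤ 1 → ‖q‖ ≤ 1 → vnNorm2 τ (p * v * q) ≤ vnNorm2 τ v := by
    intro p q v hp hq
    have hv : 0 ≤ vnNorm2 τ v := norm_nonneg _
    calc _ ≤ ‖q‖ * vnNorm2 τ (p * v) := vnNorm2_mul_right τ _ _
      _ ≤ 1 * (1 * vnNorm2 τ v) := by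
        refine mul_le_mul hq ((vnNorm2_mul_left τ _ _).trans ?_) (norm_nonneg _) zero_le_one
        gcongr
      _ = _ := by ring
  have h1 := hb _ _ (w - z) (hR z) (hR w)
  have h2 := hb _ _ (z - w) (hT z) (hT w)
  have h3 : vnNorm2 τ (z - w) = vnNorm2 τ (w - z) := by
    rw [vnNorm2, vnNorm2, map_sub, map_sub, sub_apply, sub_apply, norm_sub_rev]
  refine (vnNorm2_add_le τ _ _).trans_lt ?_
  rw [← Complex.coe_smul, ← Complex.coe_smul, vnNorm2_smul, vnNorm2_smul, Complex.norm_real,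
    Complex.norm_real, Real.norm_of_nonneg (by norm_num), Real.norm_of_nonneg (by norm_num)]
  linarith

/-- A form of Kaplansky's density theorem. -/
theorem boundedlyApprox (y : GNSvN τ) : BoundedlyApprox τ y := by
  have hsa : ∀ y : GNSvN τ, IsSelfAdjoint y → BoundedlyApprox τ y := by
    intro y hy
    have h1 : ((‖y‖ + 1 : ℝ) : ℂ) • ((‖y‖ + 1 : ℝ)⁻¹ • y) = y := by
      rw [Complex.coe_smul, smul_smul, mul_inv_cancel₀ (by positivity), one_smul]
    rw [← h1]
    refine (boundedlyApprox_of_isSelfAdjoint τ ((IsSelfAdjoint.all (‖y‖ + 1 : ℝ)⁻¹).smul hy) ?_).smul τ _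
    rw [norm_smul, Real.norm_of_nonneg (by positivity), inv_mul_le_iff₀ (by positivity)]
    linarith
  rw [← realPart_add_I_smul_imaginaryPart y]
  exact (hsa _ (realPart y).2).add τ ((hsa _ (imaginaryPart y).2).smul τ _)

variable (p : ℝ) [hp : Fact (1 ≤ p)]

theorem continuous_toLp_gnsHom : Continuous fun a : A => toLp (vnTrace τ) p (gnsHom τ a) := by
  refine AddMonoidHomClass.continuous_of_bound
    ((toLp (vnTrace τ) p) ∘ₗ (gnsHom τ).toAlgHom.toLinearMap) 1 fun x => ?_
  change ‖toLp (vnTrace τ) p (gnsHom τ x)‖ ≤ 1 * ‖x‖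
  rw [norm_toLp, one_mul]
  exact (pNorm_le_norm _ (zero_lt_one.trans_le hp.out) _).trans
    (NonUnitalStarAlgHom.norm_apply_le _ _)

/-- The image of `A` is dense in the `L_p`-space of its von Neumann algebra. -/
theorem denseRange_toLp_gnsHom : DenseRange fun a : A => toLp (vnTrace τ) p (gnsHom τ a) := by
  have hp0 : 0 < p := zero_lt_one.trans_le hp.out
  have h : ∀ y : GNSvN τ, toLp (vnTrace τ) p y ∈
      closure (Set.range fun a : A => toLp (vnTrace τ) p (gnsHom τ a)) := by
    intro y
    obtain ⟨C, hC⟩ := boundedlyApprox τ y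
    choose a ha1 ha2 using fun n : ℕ => hC (1 / ((n : ℝ) + 1)) (by positivity)
    refine mem_closure_of_tendsto (b := atTop)
      (f := fun n => toLp (vnTrace τ) p (gnsHom τ (a n))) ?_ (Eventually.of_forall fun n => ⟨_, rfl⟩)
    rw [tendsto_iff_norm_sub_tendsto_zero]
    have hC0 : 0 ≤ C := (norm_nonneg _).trans (ha1 0)
    -- The differences stay in the ball of radius `C + ‖y‖` while their 2-norms are below `1 / (n +
    -- 1)`, so `pNorm_le_of_norm_le` bounds their `p`-norms by this sequence.
    have hlim : Tendsto (fun n : ℕ => ((C + ‖y‖) ^ (p - 1) * (1 / ((n : ℝ) + 1))) ^ (1 / p)) atTop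
        (𝓝 0) := by
      have := (tendsto_one_div_add_atTop_nhds_zero_nat (𝕜 := ℝ)).const_mul ((C + ‖y‖) ^ (p - 1))
      have := ((Real.continuous_rpow_const (q := 1 / p) (by positivity)).tendsto _).comp this
      rwa [mul_zero, Real.zero_rpow (by positivity)] at this
    refine squeeze_zero (fun _ => norm_nonneg _) (fun n => ?_) hlim
    rw [← map_sub, norm_toLp]
    refine (pNorm_le_of_norm_le (vnTrace τ) hp.out (B := C + ‖y‖)
      ((norm_sub_le _ _).trans (add_le_add (ha1 n) le_rfl))).trans ?_
    rw [sqrt_vnTrace_eq]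
    have h0 : 0 ≤ vnNorm2 τ (gnsHom τ (a n) - y) := norm_nonneg _
    have := (ha2 n).le
    gcongr
  exact fun x => closure_minimal (by rintro _ ⟨y, rfl⟩; exact h y) isClosed_closure
    (denseRange_toLp (vnTrace τ) p x)

theorem norm_lpPairing_le {M : Type*} [CStarAlgebra M] [PartialOrder M] [StarOrderedRing M]
    (σ : TracialState M) (y : M) (x : NCLp σ p) : ‖lpPairing σ p y x‖ ≤ ‖y‖ * ‖x‖ := by
  refine (denseRange_toLp σ p).induction_on (p := fun x => ‖lpPairing σ p y x‖ ≤ ‖y‖ * ‖x‖) x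
    (isClosed_le (by fun_prop) (by fun_prop)) fun a => ?_
  rw [lpPairing_toLp, norm_toLp]
  exact norm_toPos_star_mul_le σ hp.out a y

end Kaplansky

/-! ### The Fourier system of `L_p`. -/

section TorusLp

variable {d : ℕ} (θ : SkewMatrix d) (p : ℝ) [hp : Fact (1 ≤ p)]

theorem sum_monomialLp (s : Finset (Fin d → ℤ)) (a : (Fin d → ℤ) → ℂ) :
    ∑ m ∈ s, a m • monomialLp θ p m = toLp (vnTrace (canonicalTrace θ)) p
      (gnsHom (canonicalTrace θ) (∑ m ∈ s, a m • (monomial θ m : NCTorus θ))) := by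
  simp only [map_sum, map_smul, monomialLp]

theorem norm_toLp_gnsHom (x : NCTorus θ) : ‖toLp (vnTrace (canonicalTrace θ)) p
    (gnsHom (canonicalTrace θ) x)‖ = pNorm (canonicalTrace θ) p x := by
  rw [norm_toLp]
  exact pNorm_starAlgHom _ (vnTrace_gnsHom _) (zero_le_one.trans hp.out) x

/-- The rotations are needed only on polynomials, whose `L_p` norm can be computed in `A_θ` because
`gnsHom` preserves the trace. Thus they need not be extended to the von Neumann algebra. -/
theorem fourierSystem_Lp : FourierSystem (monomialLp θ p) fun m =>
    lpPairing (vnTrace (canonicalTrace θ)) p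
      (gnsHom (canonicalTrace θ) (monomial θ m : NCTorus θ)) where
  norm_le m := by
    rw [monomialLp, norm_toLp_gnsHom]
    exact (pNorm_le_norm _ (zero_lt_one.trans_le hp.out) _).trans (norm_unitary_le_one _)
  coeff_le m x := by
    refine (norm_lpPairing_le p _ _ x).trans (mul_le_of_le_one_left (norm_nonneg x) ?_)
    exact (NonUnitalStarAlgHom.norm_apply_le _ _).trans (norm_unitary_le_one (monomial θ m))
  biorthogonal m n := by
    rw [monomialLp, lpPairing_toLp, ← map_star, ← map_mul, vnTrace_gnsHom]
    exact coeffAlg_monomial θ m n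
  dense := by
    have hmem : ∀ x ∈ trigPoly θ, toLp (vnTrace (canonicalTrace θ)) p
        (gnsHom (canonicalTrace θ) x) ∈ Submodule.span ℂ (Set.range (monomialLp θ p)) := by
      intro x hx
      obtain ⟨a, rfl⟩ := FourierSystem.exists_of_mem_span hx
      rw [← sum_monomialLp]
      exact Submodule.sum_mem _ fun m _ =>
        Submodule.smul_mem _ _ (Submodule.subset_span ⟨m, rfl⟩)
    refine fun x => closure_minimal ?_ isClosed_closure
      (denseRange_toLp_gnsHom (canonicalTrace θ) p x)
    rintro _ ⟨a, rfl⟩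
    exact map_mem_closure (f := fun a => toLp (vnTrace (canonicalTrace θ)) p
      (gnsHom (canonicalTrace θ) a)) (continuous_toLp_gnsHom (canonicalTrace θ) p)
      (dense_trigPoly θ a) hmem
  rotation t s a := by
    rw [one_mul, sum_monomialLp, sum_monomialLp, norm_toLp_gnsHom, norm_toLp_gnsHom, ← rotate_sum,
      pNorm_starAlgHom (rotate θ _) (trace_rotate θ _) (zero_le_one.trans hp.out)]

end TorusLp

/-! ### Convergence of the means in a Fourier system. -/

section Summation

variable {d : ℕ} {E : Type*} [NormedAddCommGroup E] [NormedSpace ℂ E] [CompleteSpace E]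
  {u : (Fin d → ℤ) → E} {c : (Fin d → ℤ) → E →L[ℂ] ℂ} (h : FourierSystem u c)
include h

namespace FourierSystem

theorem tendsto_fejerMean (x : E) :
    Tendsto (fun N : ℕ => fejerMean u (fun m => c m x) N) atTop (𝓝 x) := by
  -- Truncated subtraction makes the multiplier vanish outside the cube `|m|_∞ ≤ N`, so the Fejér
  -- mean is a series over the whole lattice.
  let M : ℕ → (Fin d → ℤ) → ℂ := fun N m => ∏ j, (((N + 1 - (m j).natAbs : ℕ) : ℂ) / (N + 1))
  have hzero : ∀ (N : ℕ) m, m ∉ Fintype.piFinset (fun _ : Fin d => Finset.Icc (-(N : ℤ)) N) → M N m = 0 := by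
    intro N m hm
    simp only [Fintype.mem_piFinset, Finset.mem_Icc, not_forall] at hm
    obtain ⟨j, hj⟩ := hm
    refine Finset.prod_eq_zero (Finset.mem_univ j) ?_
    rw [show N + 1 - (m j).natAbs = 0 by omega]
    simp
  have hM : ∀ N, fejerMean u (fun m => c m x) N = ∑' m, (M N m * c m x) • u m := by
    intro N
    rw [tsum_eq_sum fun m hm => by rw [hzero N m hm, zero_mul, zero_smul], fejerMean]
    refine Finset.sum_congr rfl fun m hm => ?_
    congr 2
    rw [Complex.ofReal_prod]
    refine Finset.prod_congr rfl fun j _ => ?_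
    have hj := Finset.mem_Icc.1 (Fintype.mem_piFinset.1 hm j)
    have hN : (N + 1 : ℂ) ≠ 0 := by exact_mod_cast N.succ_ne_zero
    rw [Nat.cast_sub (by omega), ← Int.cast_abs, ← Nat.cast_natAbs]
    push_cast
    field_simp
  simp only [hM]
  refine h.tendsto_multiplier (C := 1) (Eventually.of_forall fun N => ?_)
    (Eventually.of_forall fun N => MultiplierBound.prod _ fun j _ => h.fejer_coord_bound N j)
    (fun m => ?_) x
  · exact summable_of_ne_finset_zero fun m hm => hzero N m hm
  · have : Tendsto (fun N => M N m) atTop (𝓝 (∏ _j : Fin d, (1 : ℂ))) := by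
      refine tendsto_finsetProd _ fun j _ => ?_
      have h1 : Tendsto (fun N : ℕ => 1 - ((m j).natAbs : ℂ) * (1 / ((N : ℂ) + 1))) atTop
          (𝓝 (1 - ((m j).natAbs : ℂ) * 0)) :=
        (tendsto_one_div_add_atTop_nhds_zero_nat.const_mul _).const_sub _
      rw [mul_zero, sub_zero] at h1
      refine h1.congr' ?_
      filter_upwards [eventually_ge_atTop (m j).natAbs] with N hN
      have hN : (N + 1 : ℂ) ≠ 0 := by exact_mod_cast N.succ_ne_zero
      rw [Nat.cast_sub (by omega)]
      push_cast
      field_simp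
    rwa [Finset.prod_const_one] at this

theorem summable_squarePoissonTerm (x : E) {r : ℝ} (hr : 0 ≤ r) (hr1 : r < 1) :
    Summable (squarePoissonTerm u (fun m => c m x) r) := by
  simpa only [squarePoissonTerm, mul_comm] using! h.summable_term (summable_squarePoisson hr hr1) x

theorem summable_circularPoissonTerm (x : E) {r : ℝ} (hr : 0 ≤ r) (hr1 : r < 1) :
    Summable (circularPoissonTerm u (fun m => c m x) r) := by
  simpa only [circularPoissonTerm, mul_comm] using! h.summable_term (summable_circularPoisson hr hr1) x

omit h in
theorem eventually_mem_Ioo : ∀ᶠ r : ℝ in 𝓝[<] 1, r ∈ Set.Ioo (0 : ℝ) 1 :=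
  Ioo_mem_nhdsLT zero_lt_one

theorem tendsto_squarePoisson (x : E) : Tendsto (fun r : ℝ =>
    ∑' m, squarePoissonTerm u (fun m => c m x) r m) (𝓝[<] 1) (𝓝 x) := by
  simp only [squarePoissonTerm, mul_comm (c _ x)]
  refine h.tendsto_multiplier (C := 1)
    (eventually_mem_Ioo.mono fun r hr => summable_squarePoisson hr.1.le hr.2)
    (eventually_mem_Ioo.mono fun r hr => h.squarePoisson_bound hr.1 hr.2) (fun m => ?_) x
  have : Continuous fun r : ℝ => ((r ^ ∑ j, (m j).natAbs : ℝ) : ℂ) := by fun_prop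
  simpa using (this.tendsto 1).mono_left nhdsWithin_le_nhds

theorem tendsto_circularPoisson (x : E) : Tendsto (fun r : ℝ =>
    ∑' m, circularPoissonTerm u (fun m => c m x) r m) (𝓝[<] 1) (𝓝 x) := by
  simp only [circularPoissonTerm, mul_comm (c _ x)]
  refine h.tendsto_multiplier (C := 1)
    (eventually_mem_Ioo.mono fun r hr => summable_circularPoisson hr.1.le hr.2)
    (eventually_mem_Ioo.mono fun r hr => h.circularPoisson_bound hr.1 hr.2) (fun m => ?_) x
  have : Continuous fun r : ℝ => ((r ^ ‖latticePoint m‖ : ℝ) : ℂ) :=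
    Complex.continuous_ofReal.comp (Real.continuous_rpow_const (norm_nonneg _))
  simpa using (this.tendsto 1).mono_left nhdsWithin_le_nhds

theorem dilated_means (x : E) {Φ : EuclideanSpace ℝ (Fin d) → ℂ} (hΦ : IsSummationFunction Φ) :
    (∀ ε : ℝ, 0 < ε → Summable (dilatedTerm Φ u (fun m => c m x) ε)) ∧
    Tendsto (fun ε : ℝ => ∑' m, dilatedTerm Φ u (fun m => c m x) ε m) (𝓝[>] 0) (𝓝 x) := by
  obtain ⟨φ, hφ, hint, A, hA, δ, hδ, hb⟩ := hΦ.exists_kernel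
  -- The integral of a non-integrable function is `0` by convention, so the normalisation `∫ φ = 1`
  -- already contains integrability, including measurability, which the decay bound does not give.
  have hφint : MeasureTheory.Integrable φ := by
    by_contra hn
    rw [MeasureTheory.integral_undef hn] at hint
    exact zero_ne_one hint
  have hs : ∀ ε : ℝ, 0 < ε → Summable fun m : Fin d → ℤ => Φ (ε • latticePoint m) := fun ε hε =>
    summable_of_norm_le_rpow hA.le hδ hε fun m =>
      (le_add_of_nonneg_right (norm_nonneg _)).trans (hb _)
  refine ⟨fun ε hε => h.summable_term (hs ε hε) x, ?_⟩
  refine h.tendsto_multiplier (C := ∫ s, ‖φ s‖) (eventually_mem_nhdsWithin.mono hs)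
    (Eventually.of_forall fun ε => ?_) (fun m => ?_) x
  · rw [hφ]; exact h.dilated_bound hφint ε
  · have : Continuous fun ε : ℝ => Φ (ε • latticePoint m) := hΦ.continuous.comp (by fun_prop)
    simpa [hΦ.map_zero] using (this.tendsto 0).mono_left nhdsWithin_le_nhds

end FourierSystem

end Summation

end QuantumTorus

end

theorem mainTheorem12 {d : ℕ} (hd : 2 ≤ d) (θ : SkewMatrix d) :
    (∀ (p : ℝ) [Fact (1 ≤ p)] (x : QLp θ p),
      Tendsto (fun N : ℕ => fejerMean (monomialLp θ p) (coeffLp θ p x) N) atTop (𝓝 x) ∧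
      ((∀ r : ℝ, 0 ≤ r → r < 1 →
          Summable (squarePoissonTerm (monomialLp θ p) (coeffLp θ p x) r)) ∧
        Tendsto (fun r : ℝ => ∑' m, squarePoissonTerm (monomialLp θ p) (coeffLp θ p x) r m)
          (𝓝[<] 1) (𝓝 x)) ∧
      ((∀ r : ℝ, 0 ≤ r → r < 1 →
          Summable (circularPoissonTerm (monomialLp θ p) (coeffLp θ p x) r)) ∧
        Tendsto (fun r : ℝ => ∑' m, circularPoissonTerm (monomialLp θ p) (coeffLp θ p x) r m)
          (𝓝[<] 1) (𝓝 x)) ∧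
      ∀ Φ : EuclideanSpace ℝ (Fin d) → ℂ, IsSummationFunction Φ →
        (∀ ε : ℝ, 0 < ε → Summable (dilatedTerm Φ (monomialLp θ p) (coeffLp θ p x) ε)) ∧
        Tendsto (fun ε : ℝ => ∑' m, dilatedTerm Φ (monomialLp θ p) (coeffLp θ p x) ε m)
          (𝓝[>] 0) (𝓝 x)) ∧
    (∀ x : NCTorus θ,
      Tendsto (fun N : ℕ => fejerMean (fun m => (monomial θ m : NCTorus θ)) (coeffAlg θ x) N)
        atTop (𝓝 x) ∧
      ((∀ r : ℝ, 0 ≤ r → r < 1 →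
          Summable (squarePoissonTerm (fun m => (monomial θ m : NCTorus θ)) (coeffAlg θ x) r)) ∧
        Tendsto (fun r : ℝ =>
            ∑' m, squarePoissonTerm (fun m => (monomial θ m : NCTorus θ)) (coeffAlg θ x) r m)
          (𝓝[<] 1) (𝓝 x)) ∧
      ((∀ r : ℝ, 0 ≤ r → r < 1 →
          Summable (circularPoissonTerm (fun m => (monomial θ m : NCTorus θ)) (coeffAlg θ x) r)) ∧
        Tendsto (fun r : ℝ =>
            ∑' m, circularPoissonTerm (fun m => (monomial θ m : NCTorus θ)) (coeffAlg θ x) r m)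
          (𝓝[<] 1) (𝓝 x)) ∧
      ∀ Φ : EuclideanSpace ℝ (Fin d) → ℂ, IsSummationFunction Φ →
        (∀ ε : ℝ, 0 < ε →
          Summable (dilatedTerm Φ (fun m => (monomial θ m : NCTorus θ)) (coeffAlg θ x) ε)) ∧
        Tendsto (fun ε : ℝ =>
            ∑' m, dilatedTerm Φ (fun m => (monomial θ m : NCTorus θ)) (coeffAlg θ x) ε m)
          (𝓝[>] 0) (𝓝 x)) := by
  refine ⟨fun p _ x => ?_, fun x => ?_⟩
  · have h := fourierSystem_Lp θ p
    exact ⟨h.tendsto_fejerMean x,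
      ⟨fun _ hr hr1 => h.summable_squarePoissonTerm x hr hr1, h.tendsto_squarePoisson x⟩,
      ⟨fun _ hr hr1 => h.summable_circularPoissonTerm x hr hr1, h.tendsto_circularPoisson x⟩,
      fun _ hΦ => h.dilated_means x hΦ⟩
  · have h := fourierSystem_alg θ
    exact ⟨h.tendsto_fejerMean x,
      ⟨fun _ hr hr1 => h.summable_squarePoissonTerm x hr hr1, h.tendsto_squarePoisson x⟩,
      ⟨fun _ hr hr1 => h.summable_circularPoissonTerm x hr hr1, h.tendsto_circularPoisson x⟩,
      fun _ hΦ => h.dilated_means x hΦ⟩
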